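/- Let $n,d\ge 1$ be integers. The $n$-particle Anderson model is the random operator $H_\omega=-\Delta+V_\omega+U$ on $\ell^2(\mathbb Z^{nd})$, where points of $\mathbb Z^{nd}$ are written $\mathbf x=(x_1,\dots,x_n)$ with $x_i\in\mathbb Z^d$, and * $(\Delta\psi)(\mathbf x)=\sum_{|\mathbf e|_1=1}\big(\psi(\mathbf x+\mathbf e)-\psi(\mathbf x)\big)$; * $V_\omega(\mathbf x)=\sum_{i=1}^n\omega_{x_i}$, where $\omega=\{\omega_x\}_{x\in\mathbb Z^d}$ are independent identically distributed random variables whose law $\mu$ has a bounded density and satisfies $\{0,M_+\}\subset\operatorname{supp}\mu\subseteq[0,M_+]$ for some $M_+>0$; * $U(\mathbf x)=\sum_{1\le i<j\le n}\widetilde U(x_i-x_j)$, where $\widetilde U:\mathbb Z^d\to[0,\infty)$ is even and $\widetilde U(y)=0$ for $\|y\|_\infty>r_0$, for some $r_0\in[1,\infty)$. For $\mathbf a,\mathbf b\in\mathbb R^{nd}$ let $\mathrm{dist}_\infty(\mathbf a,\mathbf b)=\|\mathbf a-\mathbf b\|_\infty$, $\mathrm{dist}_S(\mathbf a,\mathbf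 b)=\min_{\pi}\|(a_{\pi(1)},\dots,a_{\pi(n)})-\mathbf b\|_\infty$ (minimum over permutations $\pi$ of $\{1,\dots,n\}$), and let $\mathrm{dist}_H(\mathbf a,\mathbf b)$ be the Hausdorff distance, with respect to the sup norm of $\mathbb R^d$, between $\{a_1,\dots,a_n\}$ and $\{b_1,\dots,b_n\}$. Fix $\star\in\{\infty,S,H\}$. For $\mathbf y\in\mathbb R^{nd}$ and $L>0$ put $\Lambda_{\star;L}(\mathbf y)=\{\mathbf u\in\mathbb Z^{nd}:\mathrm{dist}_\star(\mathbf y,\mathbf u)\le L/2\}$. For $\Lambda\subset\mathbb Z^{nd}$ let $H_{\omega,\Lambda}$ be the restriction of $\chi_\Lambda H_\omega\chi_\Lambda$ to $\ell^2(\Lambda)$, and let $\partial_-\Lambda$ be the set of $\mathbf u\in\Lambda$ for which there is $\mathbf v\in\mathbb Z^{nd}\setminus\Lambda$ with $\|\mathbf u-\mathbf v\|_1=1$. Given $\theta>0$ and $E\in\mathbb R$, the box $\Lambda=\Lambda_{\star;L}(\mathbf y)$, $L\ge1$, is $(\theta,E)$-suitable if $E\notin\sigma(H_{\omega,\Lambda})$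 and $|\langle\delta_{\mathbf u},(H_{\omega,\Lambda}-E)^{-1}\delta_{\mathbf v}\rangle|\le L^{-\theta}$ for all $\mathbf u\in\Lambda_{\star;L/3}(\mathbf y)$ and all $\mathbf v\in\partial_-\Lambda$; otherwise it is $(\theta,E)$-nonsuitable. For $p\ge0$, $g\in C_c^\infty(\mathbb R)$ with $g\ge0$, $T>0$ and $\mathbf y\in\mathbb Z^{nd}$ define, with $\langle s\rangle=\sqrt{1+s^2}$, $$\mathcal M(p,g,T,\mathbf y)=\frac2T\int_0^\infty e^{-2t/T}\,\mathbb E\Big[\sum_{\mathbf u\in\mathbb Z^{nd}}\langle\mathrm{dist}_\star(\mathbf y,\mathbf u)\rangle^p\,\big|\langle\delta_{\mathbf u},e^{-itH_\omega}g(H_\omega)\delta_{\mathbf y}\rangle\big|^2\Big]\,dt .$$ **Theorem.** Let $\mathcal I\subset\mathbb R$ be an open interval and let $g\in C_c^\infty(\mathbb R)$, $g\ge0$, satisfy $g\equiv1$ on $\mathcal I$. Suppose that for some $\alpha\ge0$, $\theta>2nd$ and $p>(\theta+2nd)\alpha+6\theta+15nd$ we have $$\liminf_{T\to\infty}\frac1{T^\alpha}\sup_{\mathbf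 y\in\mathbb Z^{nd}}\mathcal M(p,g,T,\mathbf y)<\infty .$$ Then there is a strictly increasing sequence of scales $L_k\ge 1$ with $L_k\to\infty$ such that, for every $E\in\mathcal I$, $$\lim_{k\to\infty}\ \sup_{\mathbf y\in\mathbb R^{nd}}\mathbb P\big\{\Lambda_{\star;L_k}(\mathbf y)\text{ is }(\theta,E)\text{-nonsuitable}\big\}=0 .$$ -/

import Mathlib

open Filter Topology MeasureTheory ProbabilityTheory
open scoped ENNReal NNReal

namespace AndersonTransport

noncomputable section

/-! ### The Hilbert spaces `ℓ²(ι)` and elementary bounded operators on them -/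

/-- The complex Hilbert space `ℓ²(ι)`. -/
abbrev L2 (ι : Type*) := lp (fun _ : ι => ℂ) 2

open Classical in
/-- The canonical orthonormal basis vector `δ_x` of `ℓ²(ι)`. -/
def delta {ι : Type*} (x : ι) : L2 ι := lp.single 2 x (1 : ℂ)

theorem memℓp_comp {ι κ : Type*} {f : ι → κ} (hf : Function.Injective f) (ψ : L2 κ) :
    Memℓp (fun i => (ψ : κ → ℂ) (f i)) 2 := by
  have h2 : 0 < (2 : ℝ≥0∞).toReal := by norm_num
  exact (memℓp_gen_iff h2).2
    ((((memℓp_gen_iff h2).1 (lp.memℓp ψ))).comp_injective hf)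

theorem norm_comp_le {ι κ : Type*} {f : ι → κ} (hf : Function.Injective f) (ψ : L2 κ) :
    ‖(⟨fun i => (ψ : κ → ℂ) (f i), memℓp_comp hf ψ⟩ : L2 ι)‖ ≤ 1 * ‖ψ‖ := by
  have h2 : 0 < (2 : ℝ≥0∞).toReal := by norm_num
  rw [one_mul]
  refine lp.norm_le_of_forall_sum_le h2 (norm_nonneg _) fun s => ?_
  have h := lp.sum_rpow_le_norm_rpow h2 ψ (s.map ⟨f, hf⟩)
  rw [Finset.sum_map] at h
  exact h

/-- Composition `ψ ↦ ψ ∘ f` with an injective map, as a bounded operator `ℓ²(κ) → ℓ²(ι)`. -/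
def compOp {ι κ : Type*} (f : ι → κ) (hf : Function.Injective f) : L2 κ →L[ℂ] L2 ι :=
  LinearMap.mkContinuous
    { toFun := fun ψ => ⟨fun i => (ψ : κ → ℂ) (f i), memℓp_comp hf ψ⟩
      map_add' := fun _ _ => rfl
      map_smul' := fun _ _ => rfl } 1 (norm_comp_le hf)

theorem compOp_apply {ι κ : Type*} (f : ι → κ) (hf : Function.Injective f) (ψ : L2 κ) (i : ι) :
    (compOp f hf ψ : ι → ℂ) i = (ψ : κ → ℂ) (f i) := rfl

theorem memℓp_mul {ι : Type*} {W : ι → ℝ} (hW : ∃ C, ∀ x, |W x| ≤ C) (ψ : L2 ι) :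
    Memℓp (fun i => (W i : ℂ) * (ψ : ι → ℂ) i) 2 := by
  obtain ⟨C, hC⟩ := hW
  refine Memℓp.mono' ((lp.memℓp ψ).const_mul (C : ℂ)) fun i => ?_
  rw [norm_mul, norm_mul, Complex.norm_real, Complex.norm_real, Real.norm_eq_abs, Real.norm_eq_abs]
  exact mul_le_mul_of_nonneg_right ((hC i).trans (le_abs_self C)) (norm_nonneg _)

theorem norm_mul_le {ι : Type*} {W : ι → ℝ} (hW : ∃ C, ∀ x, |W x| ≤ C) (ψ : L2 ι) :
    ‖(⟨fun i => (W i : ℂ) * (ψ : ι → ℂ) i, memℓp_mul hW ψ⟩ : L2 ι)‖ ≤ |hW.choose| * ‖ψ‖ := by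
  have hn : ‖((hW.choose : ℂ) • ψ : L2 ι)‖ = |hW.choose| * ‖ψ‖ := by
    rw [norm_smul, Complex.norm_real, Real.norm_eq_abs]
  rw [← hn]
  refine lp.norm_mono (by norm_num) fun i => ?_
  change ‖(W i : ℂ) * (ψ : ι → ℂ) i‖ ≤ ‖(hW.choose : ℂ) * (ψ : ι → ℂ) i‖
  rw [norm_mul, norm_mul, Complex.norm_real, Complex.norm_real, Real.norm_eq_abs, Real.norm_eq_abs]
  exact mul_le_mul_of_nonneg_right ((hW.choose_spec i).trans (le_abs_self _)) (norm_nonneg _)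

open Classical in
/-- Multiplication `ψ ↦ W ψ` by a bounded real function `W`, as a bounded operator on `ℓ²(ι)`
(set to `0` by convention when `W` is unbounded; the potentials of the Anderson model are bounded
almost surely). -/
def mulOp {ι : Type*} (W : ι → ℝ) : L2 ι →L[ℂ] L2 ι :=
  if hW : ∃ C, ∀ x, |W x| ≤ C then
    LinearMap.mkContinuous
      { toFun := fun ψ => ⟨fun i => (W i : ℂ) * (ψ : ι → ℂ) i, memℓp_mul hW ψ⟩
        map_add' := fun _ _ => by ext i; exact mul_add _ _ _
        map_smul' := fun _ _ => by ext i; exact mul_left_comm _ _ _ } |hW.choose| (norm_mul_le hW)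
  else 0

theorem mulOp_apply {ι : Type*} {W : ι → ℝ} (hW : ∃ C, ∀ x, |W x| ≤ C) (ψ : L2 ι) (i : ι) :
    (mulOp W ψ : ι → ℂ) i = (W i : ℂ) * (ψ : ι → ℂ) i := by
  rw [mulOp, dif_pos hW]; rfl

/-! ### The `n`-particle Anderson model -/

/-- Configurations of `n` particles in `ℤ^d`, i.e. points of `ℤ^{nd}`. -/
abbrev Config (n d : ℕ) := Fin n → Fin d → ℤ

/-- Points of `ℝ^{nd}`, written as `n`-tuples of points of `ℝ^d`.  The norm on this type is the
maximum of the absolute values of all coordinates. -/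
abbrev RConfig (n d : ℕ) := Fin n → Fin d → ℝ

/-- The inclusion `ℤ^{nd} ⊆ ℝ^{nd}`. -/
def toReal {n d : ℕ} (x : Config n d) : RConfig n d := fun i j => (x i j : ℝ)

/-- Translation `(shift e ψ)(x) = ψ(x + e)` on `ℓ²(ℤ^{nd})`. -/
def shift {n d : ℕ} (e : Config n d) : L2 (Config n d) →L[ℂ] L2 (Config n d) :=
  compOp (fun x => x + e) (add_left_injective e)

/-- The unit vector of `ℤ^{nd}` in the `j`-th coordinate of the `i`-th particle. -/
def unitVec {n d : ℕ} (i : Fin n) (j : Fin d) : Config n d := Pi.single i (Pi.single j 1)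

/-- The discrete `nd`-dimensional Laplacian, `(Δψ)(x) = ∑_{|e|₁ = 1} (ψ(x + e) - ψ(x))`. -/
def laplacian (n d : ℕ) : L2 (Config n d) →L[ℂ] L2 (Config n d) :=
  ∑ i : Fin n, ∑ j : Fin d, ((shift (unitVec i j) - 1) + (shift (-unitVec i j) - 1))

/-- The random potential `V(x) = ∑ᵢ v(xᵢ)` for a realization `v` of the single-site variables. -/
def randomPotential {n d : ℕ} (v : (Fin d → ℤ) → ℝ) (x : Config n d) : ℝ := ∑ i, v (x i)

/-- The pair interaction `U(x) = ∑_{i < j} Ũ(xᵢ - xⱼ)`. -/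
def interaction {n d : ℕ} (Ut : (Fin d → ℤ) → ℝ) (x : Config n d) : ℝ :=
  ∑ i, ∑ j ∈ Finset.univ.filter (fun j => i < j), Ut (x i - x j)

/-- The Hamiltonian `H = -Δ + V + U` on `ℓ²(ℤ^{nd})` for a realization `v` of the single-site
variables. -/
def hamiltonian (n : ℕ) {d : ℕ} (Ut : (Fin d → ℤ) → ℝ) (v : (Fin d → ℤ) → ℝ) :
    L2 (Config n d) →L[ℂ] L2 (Config n d) :=
  -laplacian n d + mulOp (randomPotential v) + mulOp (interaction Ut)

/-- A nonnegative, even two-body potential of finite range `r₀ ≥ 1` (in the sup norm of `ℤ^d`). -/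
structure IsPairInteraction {d : ℕ} (Ut : (Fin d → ℤ) → ℝ) (r₀ : ℝ) : Prop where
  one_le : 1 ≤ r₀
  nonneg : ∀ y, 0 ≤ Ut y
  even : ∀ y, Ut (-y) = Ut y
  finite_range : ∀ y, r₀ < ‖y‖ → Ut y = 0

/-- The single-site law: it has a bounded density and `{0, M} ⊆ supp μ ⊆ [0, M]`, `M > 0`. -/
structure IsSingleSiteLaw (μ : Measure ℝ) (M : ℝ) : Prop where
  pos : 0 < M
  bounded_density : ∃ ρ : ℝ → ℝ≥0, Measurable ρ ∧ (∃ C, ∀ x, ρ x ≤ C) ∧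
    μ = volume.withDensity (fun x => (ρ x : ℝ≥0∞))
  endpoints_mem : {0, M} ⊆ μ.support
  support_subset : μ.support ⊆ Set.Icc 0 M

/-- `ω = (ω_x)_{x ∈ ℤ^d}` is a family of independent random variables with common law `μ`. -/
structure IsDisorder {Ω : Type*} [MeasurableSpace Ω] {d : ℕ} (P : Measure Ω)
    (ω : (Fin d → ℤ) → Ω → ℝ) (μ : Measure ℝ) : Prop where
  measurable : ∀ x, Measurable (ω x)
  indep : iIndepFun ω P
  law : ∀ x, P.map (ω x) = μ

/-! ### Distances, boxes and boundaries -/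

/-- The label `⋆ ∈ {∞, S, H}`. -/
inductive DistKind
  | norm
  | symm
  | hausdorff

/-- `dist_∞(a, b) = ‖a - b‖`, `dist_S(a, b) = min_π ‖π(a) - b‖`, and `dist_H(a, b)`, the Hausdorff
distance in the sup norm of `ℝ^d` between `{a₁, …, aₙ}` and `{b₁, …, bₙ}`. -/
def starDist {n d : ℕ} (k : DistKind) (a b : RConfig n d) : ℝ :=
  match k with
  | .norm => ‖a - b‖
  | .symm => ⨅ π : Equiv.Perm (Fin n), ‖(fun i => a (π i)) - b‖
  | .hausdorff => max (⨆ i, ⨅ j, ‖a i - b j‖) (⨆ j, ⨅ i, ‖a i - b j‖)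

/-- The `⋆`-box `{y ∈ ℤ^{nd} : dist_⋆(x, y) ≤ L/2}` of side `L` centered at `x ∈ ℝ^{nd}`. -/
def box {n d : ℕ} (k : DistKind) (L : ℝ) (x : RConfig n d) : Set (Config n d) :=
  {y | starDist k x (toReal y) ≤ L / 2}

/-- The inner boundary `∂₋Λ`: the points of `Λ` having a nearest neighbour outside `Λ`. -/
def innerBoundary {n d : ℕ} (Λ : Set (Config n d)) : Set (Config n d) :=
  {u | u ∈ Λ ∧ ∃ v, v ∉ Λ ∧ ∑ i, ∑ j, |u i j - v i j| = 1}

/-! ### Finite-volume operators and suitable boxes -/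

/-- The restriction of `χ_Θ H χ_Θ` to `ℓ²(Θ)`, written as `R H R*`, where `R` restricts functions
to `Θ` and its adjoint `R*` extends them by zero. -/
def restrictOp {ι : Type*} (H : L2 ι →L[ℂ] L2 ι) (Θ : Set ι) : L2 Θ →L[ℂ] L2 Θ :=
  (compOp ((↑) : Θ → ι) Subtype.val_injective).comp
    (H.comp (ContinuousLinearMap.adjoint (compOp ((↑) : Θ → ι) Subtype.val_injective)))

/-- The Green function `⟨δ_u, (A - z)⁻¹ δ_v⟩` (meaningful for `z` outside the spectrum of `A`). -/
def green {ι : Type*} (A : L2 ι →L[ℂ] L2 ι) (z : ℂ) (u v : ι) : ℂ :=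
  inner ℂ (delta u) (Ring.inverse (A - z • (1 : L2 ι →L[ℂ] L2 ι)) (delta v))

/-- The `⋆`-box of side `L` centered at `y` is `(θ, E)`-suitable for the operator `H`. -/
def IsSuitable {n d : ℕ} (k : DistKind) (H : L2 (Config n d) →L[ℂ] L2 (Config n d))
    (L : ℝ) (y : RConfig n d) (θ E : ℝ) : Prop :=
  (E : ℂ) ∉ spectrum ℂ (restrictOp H (box k L y)) ∧
    ∀ u v : box k L y, (u : Config n d) ∈ box k (L / 3) y →
      (v : Config n d) ∈ innerBoundary (box k L y) →
        ‖green (restrictOp H (box k L y)) (E : ℂ) u v‖ ≤ L ^ (-θ)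

/-! ### Moments

All quantities below are sums and integrals of nonnegative terms and take values in `[0, ∞]`. -/

/-- The operator `e^{-itH} g(H)` for a bounded self-adjoint operator `H` on a complex Hilbert space,
with `g(H)` given by the continuous functional calculus. -/
def evolve {E : Type*} [NormedAddCommGroup E] [InnerProductSpace ℂ E] [CompleteSpace E]
    (g : ℝ → ℝ) (H : E →L[ℂ] E) (t : ℝ) : E →L[ℂ] E :=
  NormedSpace.exp ((-(Complex.I * (t : ℂ))) • H) * cfc g H

/-- `⟨t⟩ = √(1 + t²)`. -/
def bracket (t : ℝ) : ℝ := Real.sqrt (1 + t ^ 2)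

/-- The moment `∑_u ⟨dist_⋆(y, u)⟩^p |⟨δ_u, e^{-itH} g(H) δ_y⟩|²` of order `p` at time `t`. -/
def moment {n d : ℕ} (k : DistKind) (p : ℝ) (g : ℝ → ℝ)
    (H : L2 (Config n d) →L[ℂ] L2 (Config n d)) (t : ℝ) (y : Config n d) : ℝ≥0∞ :=
  ∑' u : Config n d, ENNReal.ofReal
    (bracket (starDist k (toReal y) (toReal u)) ^ p *
      ‖inner ℂ (delta u) (evolve g H t (delta y))‖ ^ 2)

/-- The time-averaged expectation `(2/T) ∫₀^∞ e^{-2t/T} 𝔼[M_ω(p, g, t, y)] dt` of the random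
moments. -/
def avgMoment {Ω : Type*} [MeasurableSpace Ω] {n d : ℕ} (P : Measure Ω)
    (ω : (Fin d → ℤ) → Ω → ℝ) (Ut : (Fin d → ℤ) → ℝ) (k : DistKind) (p : ℝ) (g : ℝ → ℝ)
    (T : ℝ) (y : Config n d) : ℝ≥0∞ :=
  ENNReal.ofReal (2 / T) * ∫⁻ t in Set.Ioi (0 : ℝ), ENNReal.ofReal (Real.exp (-(2 * t / T))) *
    ∫⁻ a, moment k p g (hamiltonian n Ut (fun x => ω x a)) t y ∂P

end

end AndersonTransport

open AndersonTransport

namespace AndersonTransport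

/-! ### Polynomial approximation of smooth functions -/

/-! Slow transport says that a wave packet filtered to energies in `I` rarely gets far by time `T`.
The resolvent at `E + iε` with `ε = 2/T` is a Laplace transform of the evolution, so its matrix
elements are small at large distance, and this smallness is passed to a box of side `L`, where `L ^
κ = T` for a suitable `κ`.

Write `R` for the resolvent of the full Hamiltonian at `E + iε` and split `R = R g(H) + R (1 -
g(H))`. The first part is bounded by the moments: Cauchy–Schwarz in time
(`norm_sq_inner_resolvent_le`) bounds its squared mass beyond distance `r` by `r ^ (-p) / ε` times
the time-integrated moment, which Markov's inequality controls in probability. The second part is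
deterministic. As `1 - g` vanishes near `E`, it is up to `O(ε²)` a smooth function of `H`, hence
close to a polynomial in `H` of degree below `L / 4`; since `H` only connects nearest neighbours,
that polynomial moves nothing that far (`exists_norm_restr_resolvent_sub_le`).

To reach the box (`norm_inner_restrictOp_le`), extend the finite-volume vector `(H_Λ - z̄)⁻¹ δ_v` by
zero, with `z = E + iε`, and apply `H - z̄`. The result is `δ_v` inside the box and unknown outside
it, so it lives far from the core point `u`; pairing it with `R δ_u` costs only a factor of order `1
/ ε`.

There remains the passage from `E - iε` to `E` in the box. The Wegner estimate keeps `E` at distance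
`η` from the finite-volume spectrum with high probability, and then the two resolvents differ by at
most `ε / η²`. The Wegner estimate is proved by spectral averaging: `tr (A + tN)⁻¹ N` is the
logarithmic derivative of a determinant in `t` of degree at most `rank N` with all its zeros in the
upper half plane, and each zero contributes at most `π` to the integral of the imaginary part.

With `D = nd`, the choices `κ = θ + 2D + δ` and `η = L ^ (-(D + δ/4))` put every error below `L ^
(-θ)`. The failure probability is of order `L ^ (-δ/4)` from Wegner, plus `L ^ (κ(α+4) + 2θ + D -
p)` from Markov and a union bound over the box; the hypothesis on `p` makes this last exponent at
most `-1`. -/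

/-- Bernstein's polynomials approximate a Lipschitz function on `[0, 1]` at the rate `n^(-1/2)`. -/
theorem exists_polynomial_near_of_lipschitz (f : ℝ → ℝ) (K : ℝ) (hK : 0 ≤ K)
    (hf : ∀ x ∈ Set.Icc (0 : ℝ) 1, ∀ y ∈ Set.Icc (0 : ℝ) 1, |f x - f y| ≤ K * |x - y|)
    (n : ℕ) (hn : n ≠ 0) :
    ∃ p : Polynomial ℝ, p.natDegree ≤ n ∧
      ∀ x ∈ Set.Icc (0 : ℝ) 1, |f x - p.eval x| ≤ K / Real.sqrt n := by
  refine ⟨∑ k : Fin (n + 1), Polynomial.C (f ((k : ℝ) / n)) * bernsteinPolynomial ℝ n k, ?_, ?_⟩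
  · refine Polynomial.natDegree_sum_le_of_forall_le _ _ fun k _ => ?_
    refine (Polynomial.natDegree_C_mul_le _ _).trans ?_
    unfold bernsteinPolynomial
    have hk : (k : ℕ) ≤ n := Nat.lt_succ_iff.mp k.is_lt
    compute_degree
    omega
  · intro x hx
    have hb : ∀ k : ℕ, bernstein n k ⟨x, hx⟩ = (bernsteinPolynomial ℝ n k).eval x := fun k => rfl
    have h1 : ∑ k : Fin (n + 1), (bernsteinPolynomial ℝ n k).eval x = 1 :=
      bernstein.probability n ⟨x, hx⟩
    have h2 : ∑ k : Fin (n + 1), (x - (k : ℝ) / n) ^ 2 * (bernsteinPolynomial ℝ n k).eval x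
        = x * (1 - x) / n := bernstein.variance hn ⟨x, hx⟩
    have h0 : ∀ k : ℕ, 0 ≤ (bernsteinPolynomial ℝ n k).eval x := fun k => by
      rw [← hb]; exact bernstein_nonneg
    have hnpos : (0 : ℝ) < n := by positivity
    have hz : ∀ k : Fin (n + 1), (k : ℝ) / n ∈ Set.Icc (0 : ℝ) 1 := fun k =>
      ⟨by positivity, (div_le_one hnpos).2 (by exact_mod_cast Nat.lt_succ_iff.mp k.is_lt)⟩
    have e1 : f x - (∑ k : Fin (n + 1), Polynomial.C (f ((k : ℝ) / n)) *
        bernsteinPolynomial ℝ n k).eval x =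
        ∑ k : Fin (n + 1), (f x - f ((k : ℝ) / n)) * (bernsteinPolynomial ℝ n k).eval x := by
      simp only [Polynomial.eval_finsetSum, Polynomial.eval_mul, Polynomial.eval_C, sub_mul,
        Finset.sum_sub_distrib, ← Finset.mul_sum, h1, mul_one]
    rw [e1]
    -- Cauchy–Schwarz with respect to the Bernstein weights, which are a probability distribution of
    -- variance `x(1-x)/n ≤ 1/n`.
    have e2 : (∑ k : Fin (n + 1), |x - (k : ℝ) / n| * (bernsteinPolynomial ℝ n k).eval x) ^ 2
        ≤ 1 / n := by
      have hcs := Finset.sum_mul_sq_le_sq_mul_sq (Finset.univ : Finset (Fin (n + 1)))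
        (fun k => |x - (k : ℝ) / n| * Real.sqrt ((bernsteinPolynomial ℝ n k).eval x))
        (fun k => Real.sqrt ((bernsteinPolynomial ℝ n k).eval x))
      simp only [mul_pow, Real.sq_sqrt (h0 _), sq_abs, mul_assoc, Real.mul_self_sqrt (h0 _), h1,
        h2, mul_one] at hcs
      refine hcs.trans ?_
      have := hx.1
      have := hx.2
      gcongr
      nlinarith
    have e3 : ∑ k : Fin (n + 1), |x - (k : ℝ) / n| * (bernsteinPolynomial ℝ n k).eval x
        ≤ 1 / Real.sqrt n := by
      refine (Real.le_sqrt_of_sq_le e2).trans (le_of_eq ?_)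
      rw [Real.sqrt_div zero_le_one, Real.sqrt_one]
    calc |∑ k : Fin (n + 1), (f x - f ((k : ℝ) / n)) * (bernsteinPolynomial ℝ n k).eval x|
        ≤ ∑ k : Fin (n + 1), K * (|x - (k : ℝ) / n| * (bernsteinPolynomial ℝ n k).eval x) := by
          refine (Finset.abs_sum_le_sum_abs _ _).trans (Finset.sum_le_sum fun k _ => ?_)
          rw [abs_mul, abs_of_nonneg (h0 k), ← mul_assoc]
          exact mul_le_mul_of_nonneg_right (hf x hx _ (hz k)) (h0 k)
      _ ≤ K * (1 / Real.sqrt n) := by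
          rw [← Finset.mul_sum]; exact mul_le_mul_of_nonneg_left e3 hK
      _ = K / Real.sqrt n := by ring

theorem exists_polynomial_antiderivative (p : Polynomial ℝ) :
    ∃ q : Polynomial ℝ, Polynomial.derivative q = p ∧ q.natDegree ≤ p.natDegree + 1 := by
  refine ⟨∑ i ∈ Finset.range (p.natDegree + 1),
    Polynomial.C (p.coeff i / ((i : ℝ) + 1)) * Polynomial.X ^ (i + 1), ?_, ?_⟩
  · rw [Polynomial.derivative_sum]
    conv_rhs => rw [p.as_sum_range_C_mul_X_pow]
    refine Finset.sum_congr rfl fun i _ => ?_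
    rw [Polynomial.derivative_C_mul_X_pow, Nat.add_sub_cancel]
    congr 2
    push_cast
    field_simp
  · refine Polynomial.natDegree_sum_le_of_forall_le _ _ fun i hi => ?_
    refine (Polynomial.natDegree_C_mul_X_pow_le _ _).trans ?_
    have := Finset.mem_range.1 hi
    omega

/-- Each derivative buys a factor `n^(-1/2)`. Approximate `f'` by `p` and let `q` be an
antiderivative of `p`; then `f - q` is Lipschitz with the error for `f'` as its constant, and
Bernstein's estimate applies to it. The rate is not optimal, but `N` is arbitrary. -/
theorem exists_polynomial_near_of_contDiff (N : ℕ) : ∀ (f : ℝ → ℝ) (K : ℝ),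
    ContDiff ℝ N f → 0 ≤ K → (∀ x ∈ Set.Icc (0 : ℝ) 1, |iteratedDeriv N f x| ≤ K) →
    ∀ n : ℕ, n ≠ 0 → ∃ p : Polynomial ℝ, p.natDegree ≤ n + N ∧
      ∀ x ∈ Set.Icc (0 : ℝ) 1, |f x - p.eval x| ≤ K / Real.sqrt n ^ N := by
  induction N with
  | zero =>
    intro f K _ _ hb n _
    refine ⟨0, by simp, fun x hx => ?_⟩
    simpa using hb x hx
  | succ N ih =>
    intro f K hf hK hb n hn
    have hf' : ContDiff ℝ (N + 1) f := by exact_mod_cast hf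
    obtain ⟨hd, -, hf1⟩ := contDiff_succ_iff_deriv.1 hf'
    obtain ⟨p, hpd, hp⟩ := ih (deriv f) K hf1 hK
      (fun x hx => by rw [← iteratedDeriv_succ']; exact hb x hx) n hn
    obtain ⟨q, hq, hqd⟩ := exists_polynomial_antiderivative p
    have hdg : ∀ x, HasDerivAt (fun x => f x - q.eval x) (deriv f x - p.eval x) x := fun x => by
      have := (hd x).hasDerivAt.sub (q.hasDerivAt x)
      rwa [hq] at this
    obtain ⟨s, hsd, hs⟩ := exists_polynomial_near_of_lipschitz (fun x => f x - q.eval x)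
      (K / Real.sqrt n ^ N) (by positivity) (fun x hx y hy => by
        have := (convex_Icc (0 : ℝ) 1).norm_image_sub_le_of_norm_hasDerivWithin_le
          (fun z _ => (hdg z).hasDerivWithinAt) (fun z hz => hp z hz) hy hx
        simpa [Real.norm_eq_abs] using this) n hn
    refine ⟨q + s, ?_, fun x hx => ?_⟩
    · refine (Polynomial.natDegree_add_le _ _).trans ?_
      omega
    · have := hs x hx
      rw [Polynomial.eval_add, ← sub_sub]
      refine this.trans (le_of_eq ?_)
      rw [pow_succ, div_div]

/-- A function of class `C^N` is approximated on `[-B, B]` by polynomials of degree at most `n + N`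
with an error of order `n^(-N/2)`. -/
theorem exists_polynomial_near_on_Icc (N : ℕ) (f : ℝ → ℝ) (hf : ContDiff ℝ N f) (B : ℝ)
    (hB : 0 < B) : ∃ C : ℝ, 0 ≤ C ∧ ∀ n : ℕ, n ≠ 0 → ∃ p : Polynomial ℝ, p.natDegree ≤ n + N ∧
      ∀ x, |x| ≤ B → |f x - p.eval x| ≤ C / Real.sqrt n ^ N := by
  have hg : ContDiff ℝ N (fun t : ℝ => f (2 * B * t - B)) :=
    hf.comp ((contDiff_const.mul contDiff_id).sub contDiff_const)
  obtain ⟨C, hC⟩ := isCompact_Icc.exists_bound_of_continuousOn (s := Set.Icc (0 : ℝ) 1)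
    (hg.continuous_iteratedDeriv N le_rfl).continuousOn
  refine ⟨max C 0, le_max_right _ _, fun n hn => ?_⟩
  obtain ⟨p, hpd, hp⟩ := exists_polynomial_near_of_contDiff N _ (max C 0) hg (le_max_right _ _)
    (fun x hx => (hC x hx).trans (le_max_left _ _)) n hn
  -- Affine change of variable from `[-B, B]` to `[0, 1]`; it does not raise the degree.
  refine ⟨p.comp (Polynomial.C (1 / (2 * B)) * Polynomial.X + Polynomial.C (1 / 2)), ?_, ?_⟩
  · refine (Polynomial.natDegree_comp_le).trans ?_
    have : (Polynomial.C (1 / (2 * B)) * Polynomial.X + Polynomial.C (1 / 2) :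
      Polynomial ℝ).natDegree ≤ 1 := Polynomial.natDegree_linear_le
    calc _ ≤ p.natDegree * 1 := Nat.mul_le_mul_left _ this
      _ ≤ _ := by omega
  · intro x hx
    obtain ⟨h1, h2⟩ := abs_le.1 hx
    have hmem : 1 / (2 * B) * x + 1 / 2 ∈ Set.Icc (0 : ℝ) 1 := by
      constructor
      · have : 1 / (2 * B) * x + 1 / 2 = (x + B) / (2 * B) := by field_simp
        rw [this]; exact div_nonneg (by linarith) (by linarith)
      · have : 1 / (2 * B) * x + 1 / 2 = (x + B) / (2 * B) := by field_simp
        rw [this]; exact (div_le_one (by linarith)).2 (by linarith)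
    have h3 := hp _ hmem
    have h4 : 2 * B * (1 / (2 * B) * x + 1 / 2) - B = x := by field_simp; ring
    simp only [h4] at h3
    simpa [Polynomial.eval_comp] using h3

/-! ### Resolvents of bounded self-adjoint operators -/

section Resolvent

variable {E : Type*} [NormedAddCommGroup E] [InnerProductSpace ℂ E]

theorem sub_smul_one_apply (A : E →L[ℂ] E) (z : ℂ) (ψ : E) :
    (A - z • (1 : E →L[ℂ] E)) ψ = A ψ - z • ψ := by
  simp

theorem apply_ringInverse {A : E →L[ℂ] E} (hA : IsUnit A) (ψ : E) : A (Ring.inverse A ψ) = ψ := by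
  rw [← mul_apply_eq_comp, Ring.mul_inverse_cancel _ hA, one_apply_eq_self]

theorem norm_ringInverse_le {A : E →L[ℂ] E} (hA : IsUnit A) {c : ℝ} (hc : 0 < c)
    (h : ∀ ψ, c * ‖ψ‖ ≤ ‖A ψ‖) : ‖Ring.inverse A‖ ≤ 1 / c := by
  refine ContinuousLinearMap.opNorm_le_bound _ (by positivity) fun ψ => ?_
  have := h (Ring.inverse A ψ)
  rw [apply_ringInverse hA] at this
  rw [div_mul_eq_mul_div, one_mul, le_div_iff₀ hc]
  linarith

variable [CompleteSpace E]

/-- Pythagoras: `⟨(A - e)ψ, ψ⟩` is real, so the cross term with `iεψ` has no real part. -/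
theorem norm_sub_smul_sq {A : E →L[ℂ] E} (hA : IsSelfAdjoint A) (e ε : ℝ) (ψ : E) :
    ‖A ψ - ((e : ℂ) + ε * Complex.I) • ψ‖ ^ 2 = ‖A ψ - (e : ℂ) • ψ‖ ^ 2 + (ε * ‖ψ‖) ^ 2 := by
  have h1 : A ψ - ((e : ℂ) + ε * Complex.I) • ψ
      = (A ψ - (e : ℂ) • ψ) - ((ε : ℂ) * Complex.I) • ψ := by rw [add_smul]; abel
  have hs : ((A - (e : ℂ) • (1 : E →L[ℂ] E) : E →L[ℂ] E) : E →ₗ[ℂ] E).IsSymmetric := by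
    refine ContinuousLinearMap.isSelfAdjoint_iff_isSymmetric.1 (hA.sub ?_)
    have : IsSelfAdjoint (e : ℂ) := Complex.conj_ofReal e
    exact this.smul (.one _)
  have h2 : (inner ℂ (A ψ - (e : ℂ) • ψ) ψ : ℂ).im = 0 := by
    have := hs.im_inner_apply_self ψ
    rwa [ContinuousLinearMap.coe_coe, sub_smul_one_apply] at this
  rw [h1, @norm_sub_sq ℂ, inner_smul_right, norm_smul, norm_mul, Complex.norm_I, mul_one,
    Complex.norm_real, mul_pow, mul_pow, Real.norm_eq_abs, sq_abs]
  have h3 : RCLike.re ((ε : ℂ) * Complex.I * inner ℂ (A ψ - (e : ℂ) • ψ) ψ) = 0 := by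
    simp only [RCLike.re_eq_complex_re, Complex.mul_re, Complex.ofReal_re, Complex.I_re, mul_zero,
      Complex.ofReal_im, Complex.I_im, mul_one, sub_self, zero_mul, Complex.mul_im, h2]
  rw [h3]; ring

theorem norm_sub_smul_ge {A : E →L[ℂ] E} (hA : IsSelfAdjoint A) (e ε : ℝ) (ψ : E) :
    ‖A ψ - (e : ℂ) • ψ‖ ≤ ‖A ψ - ((e : ℂ) + ε * Complex.I) • ψ‖ := by
  refine le_of_sq_le_sq ?_ (norm_nonneg _)
  rw [norm_sub_smul_sq hA e ε ψ]
  nlinarith [sq_nonneg (ε * ‖ψ‖)]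

theorem abs_mul_norm_le {A : E →L[ℂ] E} (hA : IsSelfAdjoint A) (e ε : ℝ) (ψ : E) :
    |ε| * ‖ψ‖ ≤ ‖(A - ((e : ℂ) + ε * Complex.I) • (1 : E →L[ℂ] E)) ψ‖ := by
  rw [sub_smul_one_apply]
  refine le_of_sq_le_sq ?_ (norm_nonneg _)
  rw [norm_sub_smul_sq hA e ε ψ, mul_pow, mul_pow, sq_abs]
  nlinarith [sq_nonneg ‖A ψ - (e : ℂ) • ψ‖]

theorem isUnit_sub_of_ne_zero {A : E →L[ℂ] E} (hA : IsSelfAdjoint A) (e : ℝ) {ε : ℝ} (hε : ε ≠ 0) :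
    IsUnit (A - ((e : ℂ) + ε * Complex.I) • (1 : E →L[ℂ] E)) := by
  have h : ((e : ℂ) + ε * Complex.I) ∉ spectrum ℂ A := fun h => by
    have := hA.im_eq_zero_of_mem_spectrum h
    simp at this
    exact hε this
  rw [spectrum.notMem_iff, ← IsUnit.neg_iff] at h
  simpa [Algebra.algebraMap_eq_smul_one] using h

theorem norm_resolvent_le {A : E →L[ℂ] E} (hA : IsSelfAdjoint A) (e : ℝ) {ε : ℝ} (hε : ε ≠ 0) :
    ‖Ring.inverse (A - ((e : ℂ) + ε * Complex.I) • (1 : E →L[ℂ] E))‖ ≤ 1 / |ε| :=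
  norm_ringInverse_le (isUnit_sub_of_ne_zero hA e hε) (abs_pos.2 hε) (abs_mul_norm_le hA e ε)

/-- The point `e + iη/2` is off the real axis, so the operator there is invertible, and the lower
bound makes its inverse at most `1/η` in norm. Moving by `η/2` back to `e` is then a Neumann series
with ratio at most `1/2`. -/
theorem isUnit_sub_of_bounded_below {A : E →L[ℂ] E} (hA : IsSelfAdjoint A) (e : ℝ) {η : ℝ}
    (hη : 0 < η) (h : ∀ ψ, η * ‖ψ‖ ≤ ‖A ψ - (e : ℂ) • ψ‖) :
    IsUnit (A - (e : ℂ) • (1 : E →L[ℂ] E)) := by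
  have hη2 : η / 2 ≠ 0 := by positivity
  set Z := A - ((e : ℂ) + (η / 2 : ℝ) * Complex.I) • (1 : E →L[ℂ] E) with hZ
  have hu : IsUnit Z := isUnit_sub_of_ne_zero hA e hη2
  have hn : ‖Ring.inverse Z‖ ≤ 1 / η := norm_ringInverse_le hu hη fun ψ => by
    rw [hZ, sub_smul_one_apply]
    exact (h ψ).trans (norm_sub_smul_ge hA e _ ψ)
  have hprod : A - (e : ℂ) • (1 : E →L[ℂ] E)
      = Z * (1 - (-((η / 2 : ℝ) * Complex.I : ℂ)) • Ring.inverse Z) := by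
    rw [mul_sub, mul_smul_comm, Ring.mul_inverse_cancel _ hu, hZ, mul_one, add_smul, neg_smul]
    abel
  rw [hprod]
  refine hu.mul (isUnit_one_sub_of_norm_lt_one ?_)
  rw [norm_smul, norm_neg, norm_mul, Complex.norm_I, mul_one, Complex.norm_real, Real.norm_eq_abs,
    abs_of_pos (by positivity)]
  calc η / 2 * ‖Ring.inverse Z‖ ≤ η / 2 * (1 / η) := by gcongr
    _ = 1 / 2 := by field_simp
    _ < 1 := by norm_num

/-- The resolvent at `e` is close to the resolvent at `e + iε` if `e` is far from the spectrum. -/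
theorem norm_resolvent_sub_le {A : E →L[ℂ] E} (hA : IsSelfAdjoint A) (e : ℝ) {η ε : ℝ}
    (hη : 0 < η) (hε : ε ≠ 0) (h : ∀ ψ, η * ‖ψ‖ ≤ ‖A ψ - (e : ℂ) • ψ‖) :
    ‖Ring.inverse (A - (e : ℂ) • (1 : E →L[ℂ] E)) -
      Ring.inverse (A - ((e : ℂ) + ε * Complex.I) • (1 : E →L[ℂ] E))‖ ≤ |ε| / η ^ 2 := by
  set Z := A - ((e : ℂ) + ε * Complex.I) • (1 : E →L[ℂ] E) with hZ
  set Y := A - (e : ℂ) • (1 : E →L[ℂ] E) with hY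
  have hu : IsUnit Z := isUnit_sub_of_ne_zero hA e hε
  have hv : IsUnit Y := isUnit_sub_of_bounded_below hA e hη h
  have hnZ : ‖Ring.inverse Z‖ ≤ 1 / η := norm_ringInverse_le hu hη fun ψ => by
    rw [hZ, sub_smul_one_apply]
    exact (h ψ).trans (norm_sub_smul_ge hA e _ ψ)
  have hnY : ‖Ring.inverse Y‖ ≤ 1 / η := norm_ringInverse_le hv hη fun ψ => by
    rw [hY, sub_smul_one_apply]; exact h ψ
  have hd : Z - Y = (-(ε * Complex.I : ℂ)) • (1 : E →L[ℂ] E) := by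
    rw [hZ, hY, add_smul, neg_smul]; abel
  -- The resolvent identity; both factors have norm at most `1/η`, which gives `η²` in the
  -- denominator.
  have key : Ring.inverse Y - Ring.inverse Z = Ring.inverse Y * (Z - Y) * Ring.inverse Z := by
    rw [mul_sub, Ring.inverse_mul_cancel _ hv, sub_mul, one_mul, mul_assoc,
      Ring.mul_inverse_cancel _ hu, mul_one]
  rw [key, hd, mul_smul_comm, mul_one, smul_mul_assoc, norm_smul, norm_neg, norm_mul,
    Complex.norm_I, mul_one, Complex.norm_real, Real.norm_eq_abs, div_eq_mul_one_div]
  gcongr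
  calc ‖Ring.inverse Y * Ring.inverse Z‖ ≤ ‖Ring.inverse Y‖ * ‖Ring.inverse Z‖ :=
        _root_.norm_mul_le _ _
    _ ≤ 1 / η * (1 / η) := by gcongr
    _ = 1 / η ^ 2 := by field_simp

/-! ### The resolvent as a time integral of the unitary group -/

theorem norm_exp_smul_le {H : E →L[ℂ] E} (hH : IsSelfAdjoint H) (t : ℝ) :
    ‖NormedSpace.exp ((-(Complex.I * (t : ℂ))) • H)‖ ≤ 1 := by
  have hsk : (-(Complex.I * (t : ℂ))) • H ∈ skewAdjoint (E →L[ℂ] E) :=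
    hH.smul_mem_skewAdjoint (by simp [skewAdjoint.mem_iff])
  let : NormedAlgebra ℚ (E →L[ℂ] E) := NormedAlgebra.restrictScalars ℚ ℂ _
  have hu := NormedSpace.exp_mem_unitary_of_mem_skewAdjoint hsk
  refine ContinuousLinearMap.opNorm_le_bound _ zero_le_one fun ψ => ?_
  rw [ContinuousLinearMap.norm_map_of_mem_unitary hu, one_mul]

/-- The function `e^{izt} ⟨χ, e^{-itH} R φ⟩` equals `⟨χ, R φ⟩` at `t = 0`, tends to `0` at infinity
because `Im z = ε > 0`, and has derivative `-i e^{izt} ⟨χ, e^{-itH} φ⟩`. Integrating this scalar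
derivative avoids operator-valued integrals. -/
theorem norm_inner_resolvent_le {H : E →L[ℂ] E} (hH : IsSelfAdjoint H) (e : ℝ) {ε : ℝ} (hε : 0 < ε)
    (χ φ : E) :
    ENNReal.ofReal (‖inner ℂ χ (Ring.inverse (H - ((e : ℂ) + ε * Complex.I) •
      (1 : E →L[ℂ] E)) φ)‖) ≤ ∫⁻ t in Set.Ioi (0 : ℝ), ENNReal.ofReal (Real.exp (-(ε * t)) *
        ‖inner ℂ χ (NormedSpace.exp ((-(Complex.I * (t : ℂ))) • H) φ)‖) := by
  set z : ℂ := (e : ℂ) + ε * Complex.I with hz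
  set R := Ring.inverse (H - z • (1 : E →L[ℂ] E)) with hR
  have hu : IsUnit (H - z • (1 : E →L[ℂ] E)) := isUnit_sub_of_ne_zero hH e hε.ne'
  set x : E →L[ℂ] E := (-Complex.I) • H with hx
  have hxt : ∀ t : ℝ, (-(Complex.I * (t : ℂ))) • H = t • x := fun t => by
    rw [hx, ← Complex.coe_smul, smul_smul]; congr 1; ring
  have hnorm : ∀ t : ℝ, ‖NormedSpace.exp (t • x)‖ ≤ 1 := fun t => by
    rw [← hxt]; exact norm_exp_smul_le hH t
  simp only [hxt]
  have hre : ∀ t : ℝ, ‖Complex.exp (Complex.I * z * t)‖ = Real.exp (-(ε * t)) := fun t => by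
    rw [Complex.norm_exp]; congr 1; simp [hz]
  set b : ℝ → ℂ := fun t => Complex.exp (Complex.I * z * t) *
    inner ℂ χ (NormedSpace.exp (t • x) (R φ)) with hb
  set b' : ℝ → ℂ := fun t => -Complex.I * (Complex.exp (Complex.I * z * t) *
    inner ℂ χ (NormedSpace.exp (t • x) φ)) with hb'
  have hexpd : ∀ (ψ : E) (t : ℝ),
      HasDerivAt (fun s : ℝ => (inner ℂ χ (NormedSpace.exp (s • x) ψ) : ℂ))
      (inner ℂ χ (NormedSpace.exp (t • x) (x ψ))) t := fun ψ t => by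
    have h1 := hasDerivAt_exp_smul_const (𝕂 := ℝ) x t
    have h2 : HasDerivAt (fun s : ℝ => NormedSpace.exp (s • x) ψ)
        ((NormedSpace.exp (t • x) * x) ψ) t := by
      exact ((ContinuousLinearMap.apply ℂ E ψ).restrictScalars ℝ).hasFDerivAt.comp_hasDerivAt t h1
    exact ((innerSL ℂ χ).restrictScalars ℝ).hasFDerivAt.comp_hasDerivAt t h2
  have hder : ∀ t : ℝ, HasDerivAt b (b' t) t := fun t => by
    have h1 : HasDerivAt (fun s : ℝ => Complex.exp (Complex.I * z * s))
        (Complex.exp (Complex.I * z * t) * (Complex.I * z)) t := by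
      have h0 : HasDerivAt (fun s : ℝ => Complex.I * z * (s : ℂ)) (Complex.I * z) t := by
        simpa using (Complex.ofRealCLM.hasDerivAt (x := t)).const_mul (Complex.I * z)
      exact h0.cexp
    have h2 := h1.mul (hexpd (R φ) t)
    convert! h2 using 1
    -- From `H R φ = φ + z R φ`: the `z` term cancels the derivative of the scalar exponential.
    have h3 : x (R φ) = (-Complex.I) • φ - (Complex.I * z) • R φ := by
      have h4 : H (R φ) - z • R φ = φ := by
        rw [← sub_smul_one_apply]; exact apply_ringInverse hu φ
      have h5 : H (R φ) = φ + z • R φ := by rwa [sub_eq_iff_eq_add] at h4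
      have h6 : x (R φ) = (-Complex.I) • H (R φ) := rfl
      rw [h6, h5, smul_add, smul_smul, neg_mul, neg_smul (Complex.I * z), sub_eq_add_neg]
    rw [h3, map_sub, map_smul, map_smul, inner_sub_right, inner_smul_right, inner_smul_right, hb']
    ring
  have hb'n : ∀ t, ‖b' t‖ = Real.exp (-(ε * t)) * ‖inner ℂ χ (NormedSpace.exp (t • x) φ)‖ :=
    fun t => by rw [hb', norm_mul, norm_neg, Complex.norm_I, one_mul, norm_mul, hre]
  have hb'c : Continuous b' := by
    have : Continuous fun s : ℝ => (inner ℂ χ (NormedSpace.exp (s • x) φ) : ℂ) :=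
      continuous_iff_continuousAt.2 fun t => (hexpd φ t).continuousAt
    rw [hb']; fun_prop
  have hbound : ∀ (ψ : E) (t : ℝ), ‖(inner ℂ χ (NormedSpace.exp (t • x) ψ) : ℂ)‖ ≤ ‖χ‖ * ‖ψ‖ :=
    fun ψ t => (norm_inner_le_norm _ _).trans (mul_le_mul_of_nonneg_left
      (((NormedSpace.exp (t • x)).le_opNorm ψ).trans
        (by simpa using mul_le_mul_of_nonneg_right (hnorm t) (norm_nonneg ψ))) (norm_nonneg _))
  have hexpi : IntegrableOn (fun t : ℝ => Real.exp (-(ε * t))) (Set.Ioi 0) := by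
    simpa [neg_mul] using exp_neg_integrableOn_Ioi 0 hε
  have hint : IntegrableOn b' (Set.Ioi 0) := by
    refine Integrable.mono' (hexpi.mul_const (‖χ‖ * ‖φ‖)) hb'c.aestronglyMeasurable ?_
    refine Eventually.of_forall fun t => ?_
    rw [hb'n]
    exact mul_le_mul_of_nonneg_left (hbound φ t) (Real.exp_pos _).le
  have hlim : Tendsto b atTop (𝓝 0) := by
    have h0 : Tendsto (fun t : ℝ => Real.exp (-(ε * t)) * (‖χ‖ * ‖R φ‖)) atTop (𝓝 0) := by
      have : Tendsto (fun t : ℝ => -(ε * t)) atTop atBot :=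
        tendsto_neg_atTop_atBot.comp (tendsto_id.const_mul_atTop hε)
      simpa using (Real.tendsto_exp_atBot.comp this).mul_const (‖χ‖ * ‖R φ‖)
    refine squeeze_zero_norm (fun t => ?_) h0
    rw [hb, norm_mul, hre]
    exact mul_le_mul_of_nonneg_left (hbound _ t) (Real.exp_pos _).le
  have hftc := integral_Ioi_of_hasDerivAt_of_tendsto' (fun t _ => hder t) hint hlim
  have hb0 : b 0 = inner ℂ χ (R φ) := by simp [hb]
  have : ‖inner ℂ χ (R φ)‖ = ‖∫ t in Set.Ioi (0 : ℝ), b' t‖ := by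
    rw [hftc, zero_sub, norm_neg, hb0]
  rw [this]
  refine (ENNReal.ofReal_le_ofReal (norm_integral_le_integral_norm _)).trans ?_
  rw [ofReal_integral_eq_lintegral_ofReal hint.norm (Eventually.of_forall fun _ => norm_nonneg _)]
  simp only [hb'n]
  exact le_rfl

theorem lintegral_exp_neg_mul {ε : ℝ} (hε : 0 < ε) :
    ∫⁻ t in Set.Ioi (0 : ℝ), ENNReal.ofReal (Real.exp (-(ε * t))) = ENNReal.ofReal (1 / ε) := by
  have hexpi : IntegrableOn (fun t : ℝ => Real.exp (-(ε * t))) (Set.Ioi 0) := by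
    simpa [neg_mul] using exp_neg_integrableOn_Ioi 0 hε
  rw [← ofReal_integral_eq_lintegral_ofReal hexpi
    (Eventually.of_forall fun _ => (Real.exp_pos _).le)]
  congr 1
  have := integral_exp_mul_Ioi (neg_lt_zero.2 hε) 0
  simpa [neg_mul, neg_div_neg_eq] using this

/-- A matrix element of the resolvent is controlled by a time average of the matrix elements of
the unitary group. -/
theorem norm_sq_inner_resolvent_le {H : E →L[ℂ] E} (hH : IsSelfAdjoint H) (e : ℝ) {ε : ℝ}
    (hε : 0 < ε) (χ φ : E) :
    ENNReal.ofReal (‖inner ℂ χ (Ring.inverse (H - ((e : ℂ) + ε * Complex.I) •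
      (1 : E →L[ℂ] E)) φ)‖ ^ 2) ≤ ENNReal.ofReal (1 / ε) * ∫⁻ t in Set.Ioi (0 : ℝ),
        ENNReal.ofReal (Real.exp (-(ε * t))) * ENNReal.ofReal
        (‖inner ℂ χ (NormedSpace.exp ((-(Complex.I * (t : ℂ))) • H) φ)‖ ^ 2) := by
  have hc : Continuous fun t : ℝ =>
      ‖(inner ℂ χ (NormedSpace.exp ((-(Complex.I * (t : ℂ))) • H) φ) : ℂ)‖ := by
    let : NormedAlgebra ℚ (E →L[ℂ] E) := NormedAlgebra.restrictScalars ℚ ℂ _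
    have h1 : Continuous fun t : ℝ => NormedSpace.exp ((-(Complex.I * (t : ℂ))) • H) :=
      NormedSpace.exp_continuous.comp (by fun_prop)
    exact ((innerSL ℂ χ).continuous.comp (h1.clm_apply continuous_const)).norm
  set c : ℝ → ℝ := fun t => ‖(inner ℂ χ (NormedSpace.exp ((-(Complex.I * (t : ℂ))) • H) φ) : ℂ)‖
  have hcn : ∀ t, 0 ≤ c t := fun t => norm_nonneg _
  -- Square root of the weight `e^{-εt}`: Cauchy–Schwarz is applied to `h` and `h * c`, and the
  -- integral of `h²` is `1/ε`.
  set h : ℝ → ℝ := fun t => Real.exp (-(ε * t) / 2)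
  have hh : ∀ t, h t * h t = Real.exp (-(ε * t)) := fun t => by
    rw [← Real.exp_add]; congr 1; ring
  have hhc : Continuous h := by fun_prop
  have hhp : ∀ t, 0 < h t := fun t => Real.exp_pos _
  have key := norm_inner_resolvent_le hH e hε χ φ
  have hcs := ENNReal.lintegral_mul_le_Lp_mul_Lq (volume.restrict (Set.Ioi (0 : ℝ)))
    Real.HolderConjugate.two_two (f := fun t => ENNReal.ofReal (h t))
    (g := fun t => ENNReal.ofReal (h t * c t)) (by fun_prop) (by fun_prop)
  rw [ENNReal.ofReal_pow (norm_nonneg _)]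
  have e1 : ∀ t, ENNReal.ofReal (h t) * ENNReal.ofReal (h t * c t)
      = ENNReal.ofReal (Real.exp (-(ε * t)) * c t) := fun t => by
    rw [← ENNReal.ofReal_mul (hhp t).le, ← mul_assoc, hh]
  simp only [Pi.mul_apply, e1] at hcs
  have key2 := pow_le_pow_left' (key.trans hcs) 2
  refine key2.trans (le_of_eq ?_)
  have hr : ∀ s : ℝ≥0∞, (s ^ (1 / 2 : ℝ)) ^ 2 = s := fun s => by
    rw [← ENNReal.rpow_natCast, ← ENNReal.rpow_mul]
    norm_num
  simp only [mul_pow, hr, ENNReal.rpow_ofNat]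
  congr 1
  · rw [← lintegral_exp_neg_mul hε]
    refine lintegral_congr fun t => ?_
    rw [← hh, ENNReal.ofReal_mul (hhp t).le, sq]
  · refine lintegral_congr fun t => ?_
    rw [← ENNReal.ofReal_pow (mul_nonneg (hhp t).le (hcn t)),
      ← ENNReal.ofReal_mul (Real.exp_pos _).le, mul_pow, sq (h t), hh]

end Resolvent

/-! ### Approximation of functions of an operator by polynomials -/

section FunctionalCalculus

variable {E : Type*} [NormedAddCommGroup E] [InnerProductSpace ℂ E] [CompleteSpace E]

/-- The function `g(A)` of a self-adjoint operator. -/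
noncomputable def operatorFunction (g : ℝ → ℝ) (A : E →L[ℂ] E) : E →L[ℂ] E := cfc g A

theorem evolve_eq (g : ℝ → ℝ) (A : E →L[ℂ] E) (t : ℝ) : evolve g A t =
    NormedSpace.exp ((-(Complex.I * (t : ℂ))) • A) * operatorFunction g A := rfl

theorem abs_le_of_mem_spectrum {A : E →L[ℂ] E} {B : ℝ} (hB : ‖A‖ ≤ B) {x : ℝ}
    (hx : x ∈ spectrum ℝ A) : |x| ≤ B := by
  have h1 : ‖(1 : E →L[ℂ] E)‖ ≤ 1 := ContinuousLinearMap.norm_id_le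
  have h2 := spectrum.norm_le_norm_mul_of_mem hx
  rw [Real.norm_eq_abs] at h2
  nlinarith [norm_nonneg A]

theorem norm_cfc_le_of_abs_le {A : E →L[ℂ] E} {B : ℝ} (hB : ‖A‖ ≤ B) {f : ℝ → ℝ} {c : ℝ}
    (hc : 0 ≤ c) (h : ∀ x, |x| ≤ B → |f x| ≤ c) : ‖cfc f A‖ ≤ c :=
  norm_cfc_le hc fun x hx => h x (abs_le_of_mem_spectrum hB hx)

theorem norm_cfc_sub_aeval_le {A : E →L[ℂ] E} (hA : IsSelfAdjoint A) {B : ℝ} (hB : ‖A‖ ≤ B)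
    {f : ℝ → ℝ} (hf : Continuous f) {p : Polynomial ℝ} {c : ℝ} (hc : 0 ≤ c)
    (h : ∀ x, |x| ≤ B → |f x - p.eval x| ≤ c) : ‖cfc f A - Polynomial.aeval A p‖ ≤ c := by
  rw [← cfc_polynomial p A, ← cfc_sub f p.eval A hf.continuousOn p.continuous.continuousOn]
  exact norm_cfc_le_of_abs_le hB hc h

/-- The numerator vanishes in a whole neighbourhood of `e`, so the quotient does too, including at
`e` where division by zero gives `0`. -/
theorem contDiff_div_pow_of_eventually_eq_zero {h : ℝ → ℝ} {k : WithTop ℕ∞} (hh : ContDiff ℝ k h)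
    {e : ℝ} (he : ∀ᶠ s in 𝓝 e, h s = 0) (m : ℕ) : ContDiff ℝ k fun x => h x / (x - e) ^ m := by
  refine contDiff_iff_contDiffAt.2 fun x => ?_
  by_cases hx : x = e
  · subst hx
    refine (contDiffAt_const (c := (0 : ℝ))).congr_of_eventuallyEq ?_
    filter_upwards [he] with s hs
    rw [hs, zero_div]
  · exact hh.contDiffAt.div ((contDiffAt_id.sub contDiffAt_const).pow m)
      (pow_ne_zero _ (sub_ne_zero.2 hx))

/-- If `g = 1` near `e`, then `(A - e - iε)⁻¹ (1 - g(A))` is approximated by polynomials in `A`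
at an arbitrary polynomial rate, up to an error `O(ε²)`. -/
theorem exists_polynomial_near_resolvent {g : ℝ → ℝ}
    (hg : ContDiff ℝ ((⊤ : ℕ∞) : WithTop ℕ∞) g) {e : ℝ} (he : ∀ᶠ s in 𝓝 e, g s = 1)
    {B : ℝ} (hB : 0 < B) (N : ℕ) :
    ∃ C : ℝ, 0 ≤ C ∧ ∀ A : E →L[ℂ] E, IsSelfAdjoint A → ‖A‖ ≤ B → ∀ ε : ℝ, 0 < ε → ε ≤ 1 →
      ∀ n : ℕ, n ≠ 0 → ∃ q : Polynomial ℂ, q.natDegree ≤ n + N + 2 ∧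
        ‖Ring.inverse (A - ((e : ℂ) + ε * Complex.I) • (1 : E →L[ℂ] E)) * (1 - operatorFunction g A) -
          Polynomial.aeval A q‖ ≤ C * (1 / Real.sqrt n ^ N + ε ^ 2) := by
  -- The cube leaves a remainder `w³ Z⁻¹ F` of size `ε²`, which stays small after the later loss of
  -- `1/ε`; a square would leave only `O(ε)`. Also `f` does not involve `ε`, so the approximation is
  -- uniform in `ε`.
  set f : ℝ → ℝ := fun x => (1 - g x) / (x - e) ^ 3 with hf
  have he' : ∀ᶠ s in 𝓝 e, (fun s => 1 - g s) s = 0 := by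
    filter_upwards [he] with s hs
    simp [hs]
  have hfs : ContDiff ℝ ((⊤ : ℕ∞) : WithTop ℕ∞) f :=
    contDiff_div_pow_of_eventually_eq_zero (contDiff_const.sub hg) he' 3
  have hfN : ContDiff ℝ N f := hfs.of_le (by exact_mod_cast le_top)
  obtain ⟨C₁, hC₁, happ⟩ := exists_polynomial_near_on_Icc N f hfN B hB
  obtain ⟨C₂, hC₂⟩ := isCompact_Icc.exists_bound_of_continuousOn (s := Set.Icc (-B) B)
    hfs.continuous.continuousOn
  have hC₂' : ∀ x, |x| ≤ B → |f x| ≤ max C₂ 0 := fun x hx =>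
    (hC₂ x (abs_le.1 hx)).trans (le_max_left _ _)
  set b := B + |e|
  refine ⟨(b ^ 2 + b + 1) * C₁ + max C₂ 0, by positivity, fun A hA hAB ε hε hε1 n hn => ?_⟩
  obtain ⟨p, hpd, hp⟩ := happ n hn
  set F := cfc f A with hF
  set Y : E →L[ℂ] E := A - (e : ℂ) • (1 : E →L[ℂ] E) with hY
  set w : ℂ := ε * Complex.I with hw
  set Z := A - ((e : ℂ) + w) • (1 : E →L[ℂ] E) with hZ
  have hZY : Z = Y - w • (1 : E →L[ℂ] E) := by rw [hZ, hY, add_smul]; abel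
  have hu : IsUnit Z := isUnit_sub_of_ne_zero hA e hε.ne'
  have hFn : ‖F‖ ≤ max C₂ 0 := norm_cfc_le_of_abs_le hAB (le_max_right _ _) hC₂'
  have hFp : ‖F - Polynomial.aeval A p‖ ≤ C₁ / Real.sqrt n ^ N :=
    norm_cfc_sub_aeval_le hA hAB hfs.continuous (by positivity) hp
  have hYF : 1 - operatorFunction g A = Y ^ 3 * F := by
    rw [operatorFunction]
    have h1 : Y ^ 3 = cfc ((Polynomial.X - Polynomial.C e : Polynomial ℝ) ^ 3).eval A := by
      rw [cfc_polynomial _ A]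
      simp only [map_pow, map_sub, Polynomial.aeval_X, Polynomial.aeval_C, hY]
      rw [Algebra.algebraMap_eq_smul_one, Complex.coe_smul]
    have h2 : (1 : E →L[ℂ] E) = cfc (fun _ : ℝ => (1 : ℝ)) A := by rw [cfc_const_one ℝ A]
    rw [h1, hF, ← cfc_mul _ _ A (Polynomial.continuous _).continuousOn
      hfs.continuous.continuousOn, h2, ← cfc_sub _ _ A continuousOn_const
      hg.continuous.continuousOn]
    refine cfc_congr fun x _ => ?_
    simp only [Polynomial.eval_pow, Polynomial.eval_sub, Polynomial.eval_X, Polynomial.eval_C, hf]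
    by_cases hx : x = e
    · subst hx
      rw [he.self_of_nhds]; simp
    · have : x - e ≠ 0 := sub_ne_zero.2 hx
      field_simp
  -- The quadratic factor is `(y³ - w³) / (y - w)` with `y = x - e`, the polynomial part of `y³ / (y
  -- - w)`.
  set q : Polynomial ℂ := ((Polynomial.X - Polynomial.C (e : ℂ)) ^ 2 +
    Polynomial.C w * (Polynomial.X - Polynomial.C (e : ℂ)) + Polynomial.C (w ^ 2)) *
    p.map (algebraMap ℝ ℂ) with hq
  have hqA : Polynomial.aeval A q
      = (Y ^ 2 + w • Y + (w ^ 2) • (1 : E →L[ℂ] E)) * Polynomial.aeval A p := by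
    rw [hq, map_mul, Polynomial.aeval_map_algebraMap]
    congr 1
    simp only [map_add, map_mul, map_pow, map_sub, Polynomial.aeval_X, Polynomial.aeval_C,
      Algebra.algebraMap_eq_smul_one, smul_mul_assoc, one_mul, hY, smul_pow, one_pow]
  refine ⟨q, ?_, ?_⟩
  · refine Polynomial.natDegree_mul_le.trans ?_
    have h1 : ((Polynomial.X - Polynomial.C (e : ℂ)) ^ 2 +
      Polynomial.C w * (Polynomial.X - Polynomial.C (e : ℂ)) + Polynomial.C (w ^ 2)).natDegree
      ≤ 2 := by compute_degree
    have h2 : (p.map (algebraMap ℝ ℂ)).natDegree ≤ p.natDegree := Polynomial.natDegree_map_le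
    omega
  · have hid : Ring.inverse Z * (1 - operatorFunction g A) - Polynomial.aeval A q
        = (Y ^ 2 + w • Y + (w ^ 2) • (1 : E →L[ℂ] E)) * (F - Polynomial.aeval A p)
          + (w ^ 3) • (Ring.inverse Z * F) := by
      have h3 : Y ^ 3 = Z * (Y ^ 2 + w • Y + (w ^ 2) • (1 : E →L[ℂ] E))
          + (w ^ 3) • (1 : E →L[ℂ] E) := by
        rw [hZY]
        simp only [sub_mul, mul_add, smul_mul_assoc, mul_smul_comm, one_mul, mul_one, pow_succ,
          pow_zero, mul_assoc, smul_sub, smul_smul]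
        abel
      rw [hYF, h3, hqA, add_mul, mul_add, mul_assoc, Ring.inverse_mul_cancel_left _ _ hu,
        smul_mul_assoc, mul_smul_comm, one_mul, mul_sub]
      abel
    rw [hid]
    have hwn : ‖w‖ = ε := by
      rw [hw, norm_mul, Complex.norm_I, mul_one, Complex.norm_real, Real.norm_eq_abs,
        abs_of_pos hε]
    have h1n : ‖(1 : E →L[ℂ] E)‖ ≤ 1 := ContinuousLinearMap.norm_id_le
    have hYn : ‖Y‖ ≤ b := by
      refine (norm_sub_le _ _).trans (add_le_add hAB ?_)
      rw [norm_smul, Complex.norm_real, Real.norm_eq_abs]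
      nlinarith [abs_nonneg e]
    have hpoly : ‖Y ^ 2 + w • Y + (w ^ 2) • (1 : E →L[ℂ] E)‖ ≤ b ^ 2 + b + 1 := by
      refine (norm_add₃_le).trans ?_
      have t1 : ‖Y ^ 2‖ ≤ b ^ 2 := by
        rw [sq, sq]
        exact (_root_.norm_mul_le _ _).trans (mul_le_mul hYn hYn (norm_nonneg _) (by positivity))
      have t2 : ‖w • Y‖ ≤ b := by
        rw [norm_smul, hwn]
        nlinarith [norm_nonneg Y]
      have t3 : ‖(w ^ 2) • (1 : E →L[ℂ] E)‖ ≤ 1 := by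
        rw [norm_smul, norm_pow, hwn]
        have : ε ^ 2 ≤ 1 := pow_le_one₀ hε.le hε1
        nlinarith [norm_nonneg (1 : E →L[ℂ] E)]
      linarith
    have hlast : ‖(w ^ 3) • (Ring.inverse Z * F)‖ ≤ max C₂ 0 * ε ^ 2 := by
      rw [norm_smul, norm_pow, hwn]
      have hR : ‖Ring.inverse Z‖ ≤ 1 / ε := by
        have := norm_resolvent_le hA e hε.ne'
        rwa [abs_of_pos hε] at this
      calc ε ^ 3 * ‖Ring.inverse Z * F‖ ≤ ε ^ 3 * (1 / ε * max C₂ 0) := by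
            gcongr
            exact (_root_.norm_mul_le _ _).trans
              (mul_le_mul hR hFn (norm_nonneg _) (by positivity))
        _ = max C₂ 0 * ε ^ 2 := by field_simp
    have hfirst : ‖(Y ^ 2 + w • Y + (w ^ 2) • (1 : E →L[ℂ] E)) * (F - Polynomial.aeval A p)‖
        ≤ (b ^ 2 + b + 1) * (C₁ / Real.sqrt n ^ N) :=
      (_root_.norm_mul_le _ _).trans (mul_le_mul hpoly hFp (norm_nonneg _) (by positivity))
    refine (norm_add_le _ _).trans ((add_le_add hfirst hlast).trans ?_)
    have hb : 0 ≤ (b ^ 2 + b + 1) * C₁ := by positivity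
    have hM : 0 ≤ max C₂ 0 := le_max_right _ _
    have hS : 0 ≤ 1 / Real.sqrt n ^ N := by positivity
    have hε2 : 0 ≤ ε ^ 2 := by positivity
    have e1 : (b ^ 2 + b + 1) * (C₁ / Real.sqrt n ^ N)
        = ((b ^ 2 + b + 1) * C₁) * (1 / Real.sqrt n ^ N) := by ring
    rw [e1]
    nlinarith [mul_nonneg hb hε2, mul_nonneg hM hS]

end FunctionalCalculus

/-! ### Spectral averaging for finite matrices -/

section SpectralAveraging

variable {ι : Type*} [Fintype ι] [DecidableEq ι]

/-- `A - (e + iη)` for a matrix `A`. -/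
def shiftedMatrix (A : Matrix ι ι ℂ) (e η : ℝ) : Matrix ι ι ℂ :=
  A - Matrix.scalar ι ((e : ℂ) + η * Complex.I)

/-- Test a kernel vector `v` against itself and take imaginary parts: `A - e` contributes nothing,
so `η ‖v‖² = Im τ · ⟨v, N v⟩`. With `N ≥ 0` this forces `Im τ > 0`; in particular there are no real
zeros. -/
theorem im_nonneg_of_det_eq_zero {A : Matrix ι ι ℂ} (hA : A.IsHermitian) (e : ℝ) {η : ℝ}
    (hη : 0 < η) {N : ι → ℝ} (hN : ∀ u, 0 ≤ N u) {τ : ℂ}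
    (h : (shiftedMatrix A e η + τ • Matrix.diagonal (fun u => (N u : ℂ))).det = 0) : 0 < τ.im := by
  obtain ⟨v, hv0, hv⟩ := Matrix.exists_mulVec_eq_zero_iff.2 h
  have h1 : star v ⬝ᵥ ((shiftedMatrix A e η + τ • Matrix.diagonal (fun u => (N u : ℂ))).mulVec v)
      = 0 := by rw [hv, dotProduct_zero]
  have hreal : (star v ⬝ᵥ A.mulVec v).im = 0 := by
    exact hA.im_star_dotProduct_mulVec_self v
  have hsq : ∀ u, star v u * v u = ((Complex.normSq (v u) : ℝ) : ℂ) := fun u => by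
    rw [Complex.normSq_eq_conj_mul_self]; rfl
  have h2 : star v ⬝ᵥ (Matrix.scalar ι ((e : ℂ) + η * Complex.I)).mulVec v
      = ((e : ℂ) + η * Complex.I) * ((∑ u, Complex.normSq (v u) : ℝ) : ℂ) := by
    rw [Matrix.scalar_apply, dotProduct, Complex.ofReal_sum, Finset.mul_sum]
    refine Finset.sum_congr rfl fun u _ => ?_
    rw [Matrix.mulVec_diagonal, ← hsq]; ring
  have h3 : star v ⬝ᵥ (τ • Matrix.diagonal (fun u => (N u : ℂ))).mulVec v
      = τ * ((∑ u, N u * Complex.normSq (v u) : ℝ) : ℂ) := by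
    rw [Matrix.smul_mulVec, dotProduct_smul, smul_eq_mul, dotProduct, Complex.ofReal_sum]
    congr 1
    refine Finset.sum_congr rfl fun u _ => ?_
    rw [Matrix.mulVec_diagonal, Complex.ofReal_mul, ← hsq]; ring
  rw [shiftedMatrix, Matrix.add_mulVec, Matrix.sub_mulVec, dotProduct_add, dotProduct_sub, h2,
    h3] at h1
  have h4 := congrArg Complex.im h1
  have hpos : 0 < ∑ u, Complex.normSq (v u) := by
    obtain ⟨u, hu⟩ := Function.ne_iff.1 hv0
    exact Finset.sum_pos' (fun _ _ => Complex.normSq_nonneg _)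
      ⟨u, Finset.mem_univ _, Complex.normSq_pos.2 hu⟩
  have hnn : 0 ≤ ∑ u, N u * Complex.normSq (v u) :=
    Finset.sum_nonneg fun u _ => mul_nonneg (hN u) (Complex.normSq_nonneg _)
  simp [hreal] at h4
  by_contra hneg
  push Not at hneg
  have : η * ∑ u, Complex.normSq (v u) = τ.im * ∑ u, N u * Complex.normSq (v u) := by linarith
  have h5 : 0 < η * ∑ u, Complex.normSq (v u) := by positivity
  nlinarith

theorem det_shiftedMatrix_ne_zero {A : Matrix ι ι ℂ} (hA : A.IsHermitian) (e : ℝ) {η : ℝ}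
    (hη : 0 < η) : (shiftedMatrix A e η).det ≠ 0 := fun h => by
  have := im_nonneg_of_det_eq_zero hA e hη (N := fun _ => 0) (fun _ => le_rfl) (τ := 0)
    (by simpa using h)
  simp at this

open Polynomial in
-- In the permutation expansion a factor contains `X` only if it is a diagonal entry with `N u ≠ 0`.
theorem natDegree_det_le (A : Matrix ι ι ℂ) (N : ι → ℂ) :
    (A.map C + (X : ℂ[X]) • (Matrix.diagonal N).map C).det.natDegree
      ≤ (Finset.univ.filter fun u => N u ≠ 0).card := by
  rw [Matrix.det_apply]
  refine natDegree_sum_le_of_forall_le _ _ fun σ _ => ?_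
  refine (natDegree_smul_le _ _).trans ((natDegree_prod_le _ _).trans ?_)
  rw [Finset.card_filter]
  refine Finset.sum_le_sum fun u _ => ?_
  simp only [Matrix.add_apply, Matrix.map_apply, Matrix.smul_apply, smul_eq_mul,
    Matrix.diagonal_apply]
  split_ifs with h1 h2 h2
  · rw [mul_comm]; exact (natDegree_add_le _ _).trans (by
      rw [natDegree_C]
      exact max_le (Nat.zero_le _) (natDegree_C_mul_le _ _ |>.trans natDegree_X_le))
  · push Not at h2
    rw [h1, h2]
    simp
  · simp
  · simp

open Polynomial in
-- Jacobi's formula. Translate the variable to `t`, factor out the invertible `A + tN`, and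
-- differentiate `det (1 + X M)` at `0`.
theorem eval_derivative_det (A N : Matrix ι ι ℂ) (t : ℂ) (h : (A + t • N).det ≠ 0) :
    (derivative (A.map C + (X : ℂ[X]) • N.map C).det).eval t
      = (A + t • N).det * ((A + t • N)⁻¹ * N).trace := by
  have hu : IsUnit (A + t • N).det := isUnit_iff_ne_zero.2 h
  have h1 : ((A.map C + (X : ℂ[X]) • N.map C).det).comp (X + C t)
      = C (A + t • N).det * (1 + (X : ℂ[X]) • (((A + t • N)⁻¹ * N).map C)).det := by
    have e1 : ((A.map C + (X : ℂ[X]) • N.map C).det).comp (X + C t)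
        = ((A + t • N).map C + (X : ℂ[X]) • N.map C).det := by
      have := RingHom.map_det (compRingHom (X + C t : ℂ[X])) (A.map C + (X : ℂ[X]) • N.map C)
      rw [coe_compRingHom_apply] at this
      rw [this]
      congr 1
      ext i j : 1
      simp [Matrix.map_apply]
      ring
    have e2 : (A + t • N).map C + (X : ℂ[X]) • N.map C
        = (A + t • N).map C * (1 + (X : ℂ[X]) • (((A + t • N)⁻¹ * N).map C)) := by
      rw [mul_add, mul_one, mul_smul_comm, ← Matrix.map_mul,
        Matrix.mul_nonsing_inv_cancel_left _ _ hu]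
    rw [e1, e2, Matrix.det_mul]
    congr 1
    exact (RingHom.map_det C (A + t • N)).symm
  have h2 := congrArg (fun p => (derivative p).eval 0) h1
  simp only [derivative_comp, derivative_C_mul, eval_mul, eval_C,
    Matrix.derivative_det_one_add_X_smul] at h2
  simpa using h2

/-- The integrand is `π` times the Cauchy density with location `Re τ` and scale `Im τ`. -/
theorem lintegral_im_inv_le (τ : ℂ) (hτ : 0 < τ.im) :
    ∫⁻ t : ℝ, ENNReal.ofReal ((1 / ((t : ℂ) - τ)).im) ≤ ENNReal.ofReal Real.pi := by
  have hne : τ.im.toNNReal ≠ 0 := (Real.toNNReal_pos.2 hτ).ne'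
  have h1 := lintegral_cauchyPDF_eq_one τ.re hne
  have h2 : ∀ t : ℝ, ENNReal.ofReal ((1 / ((t : ℂ) - τ)).im)
      = ENNReal.ofReal Real.pi * cauchyPDF τ.re τ.im.toNNReal t := fun t => by
    rw [cauchyPDF_def, ← ENNReal.ofReal_mul Real.pi_pos.le]
    congr 1
    rw [one_div, Complex.inv_im, Complex.normSq_apply, cauchyPDFReal_def, Real.coe_toNNReal _ hτ.le]
    simp only [Complex.sub_im, Complex.ofReal_im, Complex.sub_re, Complex.ofReal_re]
    have hden : (t - τ.re) * (t - τ.re) + (0 - τ.im) * (0 - τ.im) = (t - τ.re) ^ 2 + τ.im ^ 2 := by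
      ring
    rw [hden, zero_sub, neg_neg, ← mul_assoc, ← mul_assoc, mul_inv_cancel₀ Real.pi_pos.ne', one_mul,
      div_eq_mul_inv]
  simp only [h2]
  rw [lintegral_const_mul _ (measurable_cauchyPDF _ _), h1, mul_one]

theorem lintegral_multiset_im_inv_le (s : Multiset ℂ) (hs : ∀ τ ∈ s, 0 < τ.im) :
    ∫⁻ t : ℝ, ENNReal.ofReal ((s.map fun τ => 1 / ((t : ℂ) - τ)).sum.im)
      ≤ s.card * ENNReal.ofReal Real.pi := by
  induction s using Multiset.induction_on with
  | empty => simp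
  | cons τ s ih =>
    have h1 := ih fun τ' hτ' => hs τ' (Multiset.mem_cons_of_mem hτ')
    have h2 := lintegral_im_inv_le τ (hs τ (Multiset.mem_cons_self τ s))
    have hmeas : Measurable fun t : ℝ => ENNReal.ofReal ((1 / ((t : ℂ) - τ)).im) := by
      fun_prop
    calc _ ≤ ∫⁻ t : ℝ, (ENNReal.ofReal ((1 / ((t : ℂ) - τ)).im) +
          ENNReal.ofReal ((s.map fun τ => 1 / ((t : ℂ) - τ)).sum.im)) := by
          refine lintegral_mono fun t => ?_
          simp only [Multiset.map_cons, Multiset.sum_cons, Complex.add_im]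
          exact ENNReal.ofReal_add_le
      _ ≤ _ := by
          rw [lintegral_add_left hmeas, Multiset.card_cons]
          refine (add_le_add h2 h1).trans (le_of_eq ?_)
          push_cast
          ring

/-- The imaginary part of `tr (A + tN - e - iη)⁻¹ N`, integrated over `t`, is at most `π rank N`. -/
theorem lintegral_im_trace_le {A : Matrix ι ι ℂ} (hA : A.IsHermitian) (e : ℝ) {η : ℝ}
    (hη : 0 < η) {N : ι → ℝ} (hN : ∀ u, 0 ≤ N u) :
    ∫⁻ t : ℝ, ENNReal.ofReal (((shiftedMatrix A e η + (t : ℂ) •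
      Matrix.diagonal (fun u => (N u : ℂ)))⁻¹ * Matrix.diagonal (fun u => (N u : ℂ))).trace.im)
      ≤ (Finset.univ.filter fun u => N u ≠ 0).card * ENNReal.ofReal Real.pi := by
  set Z := shiftedMatrix A e η
  set D := Matrix.diagonal (fun u => (N u : ℂ)) with hD
  set p : Polynomial ℂ := (Z.map Polynomial.C + (Polynomial.X : Polynomial ℂ) •
    D.map Polynomial.C).det with hp
  have hev : ∀ t : ℂ, p.eval t = (Z + t • D).det := fun t => by
    have := RingHom.map_det (Polynomial.evalRingHom t) (Z.map Polynomial.C +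
      (Polynomial.X : Polynomial ℂ) • D.map Polynomial.C)
    rw [Polynomial.coe_evalRingHom] at this
    rw [hp, this]
    congr 1
    ext i j : 1
    simp only [RingHom.mapMatrix_apply, Matrix.map_apply, Matrix.add_apply, Matrix.smul_apply,
      smul_eq_mul, Polynomial.coe_evalRingHom, Polynomial.eval_add, Polynomial.eval_mul,
      Polynomial.eval_C, Polynomial.eval_X]
  have hne : ∀ t : ℝ, (Z + (t : ℂ) • D).det ≠ 0 := fun t h => by
    have := im_nonneg_of_det_eq_zero hA e hη hN h
    simp at this
  -- The trace is the logarithmic derivative `p'/p`, that is, the sum of `1/(t - τ)` over the roots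
  -- of `p`.
  have htr : ∀ t : ℝ, ((Z + (t : ℂ) • D)⁻¹ * D).trace
      = (p.roots.map fun τ => 1 / ((t : ℂ) - τ)).sum := fun t => by
    have h0 : p.eval (t : ℂ) ≠ 0 := by rw [hev]; exact hne t
    rw [← (IsAlgClosed.splits p).eval_derivative_div_eval_of_ne_zero h0, hev, hp,
      eval_derivative_det Z D t (hne t), mul_div_cancel_left₀ _ (hne t)]
  simp only [htr]
  refine (lintegral_multiset_im_inv_le p.roots fun τ hτ => ?_).trans ?_
  · have := (Polynomial.mem_roots'.1 hτ).2
    rw [Polynomial.IsRoot.def, hev] at this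
    exact im_nonneg_of_det_eq_zero hA e hη hN this
  · gcongr
    refine (Polynomial.card_roots' p).trans ((natDegree_det_le _ _).trans (le_of_eq ?_))
    congr 1
    ext u
    simp

/-- The Hilbert–Schmidt norm of the resolvent in terms of its diagonal. -/
theorem im_inv_diag_eq {A : Matrix ι ι ℂ} (hA : A.IsHermitian) (e : ℝ) {η : ℝ} (hη : 0 < η)
    (u : ι) : ((shiftedMatrix A e η)⁻¹ u u).im
      = η * ∑ v, Complex.normSq ((shiftedMatrix A e η)⁻¹ v u) := by
  set Z := shiftedMatrix A e η with hZ
  have hu : IsUnit Z.det := isUnit_iff_ne_zero.2 (det_shiftedMatrix_ne_zero hA e hη)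
  have hsub : Z.conjTranspose - Z = Matrix.scalar ι (2 * η * Complex.I) := by
    rw [hZ, shiftedMatrix, Matrix.conjTranspose_sub, hA.eq, Matrix.scalar_apply,
      Matrix.diagonal_conjTranspose, sub_sub_sub_cancel_left, Matrix.scalar_apply,
      Matrix.diagonal_sub]
    congr 1
    ext1 i
    simp
    ring
  have hH : Z⁻¹.conjTranspose * Z.conjTranspose = 1 := by
    rw [← Matrix.conjTranspose_mul, Matrix.mul_nonsing_inv _ hu, Matrix.conjTranspose_one]
  -- With `G = Z⁻¹`, this is `G - G* = G* (Z* - Z) G` with `Z* - Z = 2iη`; its diagonal entries give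
  -- the claim.
  have key : Z⁻¹ - Z⁻¹.conjTranspose
      = Z⁻¹.conjTranspose * Matrix.scalar ι (2 * η * Complex.I) * Z⁻¹ := by
    rw [← hsub, mul_sub, sub_mul, hH, one_mul, mul_assoc, Matrix.mul_nonsing_inv _ hu, mul_one]
  have h1 := congrFun (congrFun key u) u
  rw [Matrix.sub_apply, Matrix.conjTranspose_apply, Matrix.mul_apply] at h1
  have h2 : ∑ j, (Z⁻¹.conjTranspose * Matrix.scalar ι (2 * η * Complex.I)) u j * Z⁻¹ j u
      = 2 * η * Complex.I * ((∑ v, Complex.normSq (Z⁻¹ v u) : ℝ) : ℂ) := by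
    rw [Complex.ofReal_sum, Finset.mul_sum]
    refine Finset.sum_congr rfl fun j _ => ?_
    rw [Matrix.scalar_apply, Matrix.mul_diagonal, Matrix.conjTranspose_apply,
      Complex.normSq_eq_conj_mul_self]
    simp only [RCLike.star_def]
    ring
  rw [h2] at h1
  have h3 := congrArg Complex.im h1
  simp at h3
  linarith

end SpectralAveraging

/-! ### A Wegner estimate for finite matrices -/

section Wegner

variable {Ω : Type*} [MeasurableSpace Ω] {σ : Type*} [Fintype σ] [DecidableEq σ]

/-- If integrating out a single variable over the line gives at most `K`, then the expectation is
at most `K` times a bound for the density. -/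
theorem lintegral_le_of_forall_update_le {P : Measure Ω} [IsProbabilityMeasure P] {μ : Measure ℝ}
    {c : ℝ≥0∞} (hμ : μ ≤ c • volume) {X : σ → Ω → ℝ} (hX : ∀ x, Measurable (X x))
    (hind : iIndepFun X P) (hlaw : ∀ x, P.map (X x) = μ) {f : (σ → ℝ) → ℝ≥0∞} (hf : Measurable f)
    {K : ℝ≥0∞} (x : σ) (h : ∀ ω : σ → ℝ, ∫⁻ t, f (Function.update ω x t) ≤ K) :
    ∫⁻ a, f (fun s => X s a) ∂P ≤ c * K := by
  have hprob : IsProbabilityMeasure μ := by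
    rw [← hlaw x]; exact Measure.isProbabilityMeasure_map (hX x).aemeasurable
  have hmap := (iIndepFun_iff_map_fun_eq_pi_map fun s => (hX s).aemeasurable).1 hind
  simp only [hlaw] at hmap
  have h1 : ∫⁻ a, f (fun s => X s a) ∂P = ∫⁻ ω, f ω ∂(Measure.pi fun _ : σ => μ) := by
    rw [← hmap, lintegral_map hf (measurable_pi_lambda _ hX)]
  -- Fubini with the variable `x` integrated innermost; the other coordinates carry probability
  -- measures, so the constant bound survives.
  rw [h1, lintegral_eq_lmarginal_univ (fun _ => 0), lmarginal_erase' f hf (Finset.mem_univ x)]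
  refine (lmarginal_mono (g := fun _ => c * K) (fun ω => ?_) _).trans ?_
  · calc ∫⁻ t, f (Function.update ω x t) ∂μ ≤ ∫⁻ t, f (Function.update ω x t) ∂(c • volume) :=
        lintegral_mono' hμ le_rfl
      _ = c * ∫⁻ t, f (Function.update ω x t) := by rw [lintegral_smul_measure, smul_eq_mul]
      _ ≤ c * K := by gcongr; exact h ω
  · rw [lmarginal]
    simp

variable {ι : Type*} [Fintype ι] [DecidableEq ι]

/-- The matrix `A + ∑ₓ ωₓ Nₓ` with diagonal `Nₓ`. -/
noncomputable def potentialMatrix (A : Matrix ι ι ℂ) (N : σ → ι → ℕ) (ω : σ → ℝ) : Matrix ι ι ℂ :=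
  A + Matrix.diagonal fun u => ((∑ x, ω x * N x u : ℝ) : ℂ)

theorem potentialMatrix_isHermitian {A : Matrix ι ι ℂ} (hA : A.IsHermitian) (N : σ → ι → ℕ)
    (ω : σ → ℝ) : (potentialMatrix A N ω).IsHermitian := by
  refine hA.add (Matrix.isHermitian_diagonal_of_self_adjoint _ ?_)
  ext u
  simp only [Pi.star_apply]
  exact Complex.conj_ofReal _

theorem potentialMatrix_update (A : Matrix ι ι ℂ) (N : σ → ι → ℕ) (ω : σ → ℝ) (x : σ) (t : ℝ) :
    potentialMatrix A N (Function.update ω x t) = potentialMatrix A N (Function.update ω x 0) +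
      (t : ℂ) • Matrix.diagonal (fun u => ((N x u : ℝ) : ℂ)) := by
  have h : ∀ (s : ℝ) (u : ι), ∑ y, Function.update ω x s y * (N y u : ℝ)
      = s * N x u + ∑ y ∈ Finset.univ.erase x, ω y * N y u := fun s u => by
    rw [← Finset.add_sum_erase _ _ (Finset.mem_univ x), Function.update_self]
    congr 1
    refine Finset.sum_congr rfl fun y hy => ?_
    rw [Function.update_of_ne (Finset.ne_of_mem_erase hy)]
  rw [potentialMatrix, potentialMatrix, add_assoc, Matrix.smul_eq_diagonal_mul,
    Matrix.diagonal_mul_diagonal, Matrix.diagonal_add]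
  congr 2
  ext1 u
  rw [h t u, h 0 u]
  push_cast
  ring

theorem shiftedMatrix_add (A D : Matrix ι ι ℂ) (e η : ℝ) :
    shiftedMatrix (A + D) e η = shiftedMatrix A e η + D := by
  rw [shiftedMatrix, shiftedMatrix]; abel

/-- By the adjugate formula the entries are even continuous, since the determinant never vanishes
for `η > 0`. -/
theorem measurable_inv_potentialMatrix {A : Matrix ι ι ℂ} (hA : A.IsHermitian) (N : σ → ι → ℕ)
    (e : ℝ) {η : ℝ} (hη : 0 < η) (u v : ι) :
    Measurable fun ω : σ → ℝ => (shiftedMatrix (potentialMatrix A N ω) e η)⁻¹ u v := by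
  have hc : Continuous fun ω : σ → ℝ => shiftedMatrix (potentialMatrix A N ω) e η := by
    unfold shiftedMatrix potentialMatrix
    refine (continuous_const.add (Continuous.matrix_diagonal ?_)).sub continuous_const
    fun_prop
  have h1 : Continuous fun ω : σ → ℝ => (shiftedMatrix (potentialMatrix A N ω) e η).det⁻¹ :=
    hc.matrix_det.inv₀ fun ω => det_shiftedMatrix_ne_zero (potentialMatrix_isHermitian hA N ω) e hη
  have h2 : Continuous fun ω : σ → ℝ =>
      (shiftedMatrix (potentialMatrix A N ω) e η).adjugate u v :=
    hc.matrix_adjugate.matrix_elem u v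
  have h3 := (h1.mul h2).measurable
  convert! h3 using 1
  ext1 ω
  rw [Matrix.inv_def, Matrix.smul_apply, smul_eq_mul, Ring.inverse_eq_inv']
  rfl

/-- The squared Hilbert–Schmidt norm of `(A + ∑ₓ ωₓ Nₓ - e - iη)⁻¹`. -/
noncomputable def resolventHS (A : Matrix ι ι ℂ) (N : σ → ι → ℕ) (e η : ℝ) (ω : σ → ℝ) : ℝ :=
  ∑ u, ∑ v, Complex.normSq ((shiftedMatrix (potentialMatrix A N ω) e η)⁻¹ v u)

/-- `η` times the squared Hilbert–Schmidt norm is `Im tr G`, where `G` is the resolvent. As the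
occupation numbers add up to `m ≥ 1` at every `u`, this is at most the sum over `x` of `Im tr G Nₓ`.
Spectral averaging in the single variable `x` bounds each term by the rank of `Nₓ`, and the ranks
add up to at most `m` times the dimension. -/
theorem lintegral_resolventHS_le {P : Measure Ω} [IsProbabilityMeasure P] {μ : Measure ℝ}
    {c : ℝ≥0∞} (hμ : μ ≤ c • volume) {X : σ → Ω → ℝ} (hX : ∀ x, Measurable (X x))
    (hind : iIndepFun X P) (hlaw : ∀ x, P.map (X x) = μ) {A : Matrix ι ι ℂ} (hA : A.IsHermitian)
    {N : σ → ι → ℕ} {m : ℕ} (hm : 1 ≤ m) (hN : ∀ u, ∑ x, N x u = m) (e : ℝ) {η : ℝ}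
    (hη : 0 < η) :
    ∫⁻ a, ENNReal.ofReal (η * resolventHS A N e η (fun s => X s a)) ∂P
      ≤ c * ENNReal.ofReal Real.pi * m * Fintype.card ι := by
  set R : (σ → ℝ) → Matrix ι ι ℂ := fun ω => (shiftedMatrix (potentialMatrix A N ω) e η)⁻¹ with hR
  set f : σ → (σ → ℝ) → ℝ := fun x ω =>
    (R ω * Matrix.diagonal (fun u => ((N x u : ℝ) : ℂ))).trace.im with hf
  have hRm : ∀ u v, Measurable fun ω => R ω u v :=
    measurable_inv_potentialMatrix hA N e hη
  have hfe : ∀ x ω, f x ω = ∑ u, (R ω u u).im * N x u := fun x ω => by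
    simp only [hf, Matrix.trace, Complex.im_sum]
    refine Finset.sum_congr rfl fun u _ => ?_
    rw [Matrix.diag_apply, Matrix.mul_diagonal, Complex.im_mul_ofReal]
  have hfm : ∀ x, Measurable (f x) := fun x => by
    have : f x = fun ω => ∑ u, (R ω u u).im * N x u := funext (hfe x)
    rw [this]
    exact Finset.measurable_sum _ fun u _ =>
      (Complex.measurable_im.comp (hRm u u)).mul_const _
  have hRnn : ∀ ω u, 0 ≤ (R ω u u).im := fun ω u => by
    rw [hR, im_inv_diag_eq (potentialMatrix_isHermitian hA N ω) e hη u]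
    exact mul_nonneg hη.le (Finset.sum_nonneg fun v _ => Complex.normSq_nonneg _)
  have hfnn : ∀ x ω, 0 ≤ f x ω := fun x ω => by
    rw [hfe]; exact Finset.sum_nonneg fun u _ => mul_nonneg (hRnn ω u) (Nat.cast_nonneg _)
  have hle : ∀ ω, η * resolventHS A N e η ω ≤ ∑ x, f x ω := fun ω => by
    simp only [hfe]
    rw [Finset.sum_comm, resolventHS, Finset.mul_sum]
    refine Finset.sum_le_sum fun u _ => ?_
    rw [← im_inv_diag_eq (potentialMatrix_isHermitian hA N ω) e hη u, ← Finset.mul_sum,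
      ← Nat.cast_sum, hN]
    exact le_mul_of_one_le_right (hRnn ω u) (by exact_mod_cast hm)
  have hone : ∀ x, ∫⁻ a, ENNReal.ofReal (f x (fun s => X s a)) ∂P
      ≤ c * ((Finset.univ.filter fun u => (N x u : ℝ) ≠ 0).card * ENNReal.ofReal Real.pi) :=
    fun x => by
      refine lintegral_le_of_forall_update_le (f := fun ω => ENNReal.ofReal (f x ω)) hμ hX hind
        hlaw (hfm x).ennreal_ofReal x fun ω => ?_
      have := lintegral_im_trace_le (potentialMatrix_isHermitian hA N (Function.update ω x 0)) e hη
        (N := fun u => (N x u : ℝ)) (fun u => Nat.cast_nonneg _)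
      refine (lintegral_congr fun t => ?_).trans_le this
      simp only [hf, hR]
      rw [potentialMatrix_update A N ω x t, shiftedMatrix_add]
  have hcard : ∑ x, (Finset.univ.filter fun u => (N x u : ℝ) ≠ 0).card ≤ m * Fintype.card ι := by
    calc ∑ x, (Finset.univ.filter fun u => (N x u : ℝ) ≠ 0).card ≤ ∑ x, ∑ u, N x u := by
          refine Finset.sum_le_sum fun x _ => ?_
          rw [Finset.card_filter]
          refine Finset.sum_le_sum fun u _ => ?_
          split_ifs with h
          · exact Nat.one_le_iff_ne_zero.2 (by exact_mod_cast h)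
          · exact Nat.zero_le _
      _ = m * Fintype.card ι := by
          rw [Finset.sum_comm, Finset.sum_congr rfl fun u _ => hN u, Finset.sum_const,
            Finset.card_univ, smul_eq_mul, mul_comm]
  calc ∫⁻ a, ENNReal.ofReal (η * resolventHS A N e η (fun s => X s a)) ∂P
      ≤ ∫⁻ a, ∑ x, ENNReal.ofReal (f x (fun s => X s a)) ∂P := by
        refine lintegral_mono fun a => ?_
        rw [← ENNReal.ofReal_sum_of_nonneg fun x _ => hfnn x _]
        exact ENNReal.ofReal_le_ofReal (hle _)
    _ = ∑ x, ∫⁻ a, ENNReal.ofReal (f x (fun s => X s a)) ∂P :=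
        lintegral_finsetSum _ fun x _ =>
          ((hfm x).comp (measurable_pi_lambda _ hX)).ennreal_ofReal
    _ ≤ ∑ x, c * ((Finset.univ.filter fun u => (N x u : ℝ) ≠ 0).card * ENNReal.ofReal Real.pi) :=
        Finset.sum_le_sum fun x _ => hone x
    _ = c * ENNReal.ofReal Real.pi *
        ((∑ x, (Finset.univ.filter fun u => (N x u : ℝ) ≠ 0).card : ℕ) : ℝ≥0∞) := by
        rw [← Finset.mul_sum, ← Finset.sum_mul, Nat.cast_sum]; ring
    _ ≤ c * ENNReal.ofReal Real.pi * ((m * Fintype.card ι : ℕ) : ℝ≥0∞) := by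
        gcongr
    _ = _ := by push_cast; ring

/-- Markov's inequality. The threshold `1/(4η²)` is chosen so that a lower bound `2η` at `e + iη`
leaves a bound at `e` once the imaginary part is removed. -/
theorem measure_resolventHS_ge_le {P : Measure Ω} [IsProbabilityMeasure P] {μ : Measure ℝ}
    {c : ℝ≥0∞} (hμ : μ ≤ c • volume) {X : σ → Ω → ℝ} (hX : ∀ x, Measurable (X x))
    (hind : iIndepFun X P) (hlaw : ∀ x, P.map (X x) = μ) {A : Matrix ι ι ℂ} (hA : A.IsHermitian)
    {N : σ → ι → ℕ} {m : ℕ} (hm : 1 ≤ m) (hN : ∀ u, ∑ x, N x u = m) (e : ℝ) {η : ℝ}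
    (hη : 0 < η) :
    P {a | 1 / (4 * η ^ 2) ≤ resolventHS A N e η (fun s => X s a)}
      ≤ c * ENNReal.ofReal Real.pi * m * Fintype.card ι * ENNReal.ofReal (4 * η) := by
  have hmeas : Measurable fun ω : σ → ℝ => resolventHS A N e η ω := by
    refine Finset.measurable_sum _ fun u _ => Finset.measurable_sum _ fun v _ => ?_
    exact Complex.continuous_normSq.measurable.comp (measurable_inv_potentialMatrix hA N e hη v u)
  have hmeas' : Measurable fun a =>
      ENNReal.ofReal (η * resolventHS A N e η (fun s => X s a)) :=
    ((hmeas.comp (measurable_pi_lambda _ hX)).const_mul η).ennreal_ofReal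
  have hp : (0 : ℝ) < 1 / (4 * η) := by positivity
  have h1 := meas_ge_le_lintegral_div (μ := P) hmeas'.aemeasurable
    (ε := ENNReal.ofReal (1 / (4 * η))) (by simpa using hη) ENNReal.ofReal_ne_top
  refine (measure_mono fun a ha => ?_).trans (h1.trans ?_)
  · refine ENNReal.ofReal_le_ofReal ?_
    have ha' : 1 / (4 * η ^ 2) ≤ resolventHS A N e η (fun s => X s a) := ha
    calc 1 / (4 * η) = η * (1 / (4 * η ^ 2)) := by field_simp
      _ ≤ _ := mul_le_mul_of_nonneg_left ha' hη.le
  · rw [ENNReal.div_eq_inv_mul, ← ENNReal.ofReal_inv_of_pos hp, mul_comm]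
    have h2 : (1 / (4 * η))⁻¹ = 4 * η := by rw [one_div, inv_inv]
    rw [h2]
    gcongr
    exact lintegral_resolventHS_le hμ hX hind hlaw hA hm hN e hη

/-- A bound on the Hilbert–Schmidt norm of the resolvent gives a lower bound on the operator. -/
theorem sum_normSq_le_of_resolventHS_lt {A : Matrix ι ι ℂ} (hA : A.IsHermitian) (N : σ → ι → ℕ)
    (e : ℝ) {η : ℝ} (hη : 0 < η) (ω : σ → ℝ) (h : resolventHS A N e η ω < 1 / (4 * η ^ 2))
    (ψ : ι → ℂ) : 4 * η ^ 2 * ∑ u, ‖ψ u‖ ^ 2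
      ≤ ∑ u, ‖((shiftedMatrix (potentialMatrix A N ω) e η).mulVec ψ) u‖ ^ 2 := by
  set Z := shiftedMatrix (potentialMatrix A N ω) e η with hZ
  have hu : IsUnit Z.det :=
    isUnit_iff_ne_zero.2 (det_shiftedMatrix_ne_zero (potentialMatrix_isHermitian hA N ω) e hη)
  set φ := Z.mulVec ψ with hφ
  have hψ : ψ = Z⁻¹.mulVec φ := by
    rw [hφ, Matrix.mulVec_mulVec, Matrix.nonsing_inv_mul _ hu, Matrix.one_mulVec]
  have hcoord : ∀ v, ‖ψ v‖ ^ 2 ≤ (∑ u, Complex.normSq (Z⁻¹ v u)) * ∑ u, ‖φ u‖ ^ 2 := fun v => by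
    have h1 : ‖ψ v‖ ≤ ∑ u, ‖Z⁻¹ v u‖ * ‖φ u‖ := by
      conv_lhs => rw [hψ]
      rw [Matrix.mulVec, dotProduct]
      exact (norm_sum_le _ _).trans (le_of_eq (by simp only [norm_mul]))
    calc ‖ψ v‖ ^ 2 ≤ (∑ u, ‖Z⁻¹ v u‖ * ‖φ u‖) ^ 2 := by gcongr
      _ ≤ (∑ u, ‖Z⁻¹ v u‖ ^ 2) * ∑ u, ‖φ u‖ ^ 2 := Finset.sum_mul_sq_le_sq_mul_sq _ _ _
      _ = _ := by simp only [Complex.normSq_eq_norm_sq]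
  have hsum : ∑ v, ‖ψ v‖ ^ 2 ≤ resolventHS A N e η ω * ∑ u, ‖φ u‖ ^ 2 := by
    rw [resolventHS, Finset.sum_comm, Finset.sum_mul]
    exact Finset.sum_le_sum fun v _ => hcoord v
  have hnn : 0 ≤ ∑ u, ‖φ u‖ ^ 2 := Finset.sum_nonneg fun u _ => by positivity
  have h4 : 0 < 4 * η ^ 2 := by positivity
  calc 4 * η ^ 2 * ∑ u, ‖ψ u‖ ^ 2
      ≤ 4 * η ^ 2 * ((1 / (4 * η ^ 2)) * ∑ u, ‖φ u‖ ^ 2) := by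
        gcongr
        exact hsum.trans (mul_le_mul_of_nonneg_right h.le hnn)
    _ = ∑ u, ‖φ u‖ ^ 2 := by field_simp

end Wegner

/-! ### Elementary facts on `ℓ²` -/

section L2

variable {ι : Type*}

theorem inner_delta_left (x : ι) (ψ : L2 ι) : inner ℂ (delta x) ψ = (ψ : ι → ℂ) x := by
  classical
  -- `delta` is built with the classical decidability instance; replace it by the one that
  -- unification finds.
  rw [delta, Subsingleton.elim (fun a b => Classical.propDecidable (a = b)) (fun a b => _),
    lp.inner_single_left]
  simp

theorem delta_apply_self (x : ι) : (delta x : ι → ℂ) x = 1 := by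
  classical
  rw [delta, lp.coeFn_single, Pi.single_eq_same]

theorem delta_apply_of_ne {x y : ι} (h : y ≠ x) : (delta x : ι → ℂ) y = 0 := by
  classical
  rw [delta, lp.coeFn_single, Pi.single_eq_of_ne h]

theorem norm_delta (x : ι) : ‖delta x‖ = 1 := by
  classical
  rw [delta, lp.norm_single (by norm_num), norm_one]

theorem hasSum_norm_sq (ψ : L2 ι) : HasSum (fun x => ‖(ψ : ι → ℂ) x‖ ^ 2) (‖ψ‖ ^ 2) := by
  have := lp.hasSum_norm (p := 2) (by norm_num) ψ
  simpa using this

theorem norm_compOp_le {κ : Type*} (f : ι → κ) (hf : Function.Injective f) :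
    ‖compOp f hf‖ ≤ 1 := LinearMap.mkContinuous_norm_le _ zero_le_one _

/-- Restriction of functions to a set. -/
noncomputable abbrev restr (S : Set ι) : L2 ι →L[ℂ] L2 S :=
  compOp ((↑) : S → ι) Subtype.val_injective

theorem restr_apply (S : Set ι) (ψ : L2 ι) (x : S) : (restr S ψ : S → ℂ) x = (ψ : ι → ℂ) x := rfl

theorem norm_restr_le (S : Set ι) (ψ : L2 ι) : ‖restr S ψ‖ ≤ ‖ψ‖ := by
  simpa using (restr S).le_of_opNorm_le (norm_compOp_le _ _) ψ

theorem restr_eq_zero {S : Set ι} {ψ : L2 ι} (h : ∀ x ∈ S, (ψ : ι → ℂ) x = 0) :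
    restr S ψ = 0 := by
  ext x
  exact h x x.2

theorem restr_delta {S : Set ι} {x : ι} (hx : x ∈ S) : restr S (delta x) = delta ⟨x, hx⟩ := by
  ext y
  rw [restr_apply]
  by_cases h : y = ⟨x, hx⟩
  · subst h; rw [delta_apply_self, delta_apply_self]
  · rw [delta_apply_of_ne h, delta_apply_of_ne fun h' => h (Subtype.ext h')]

theorem adjoint_restr_apply_mem (S : Set ι) (φ : L2 S) {x : ι} (hx : x ∈ S) :
    (ContinuousLinearMap.adjoint (restr S) φ : ι → ℂ) x = (φ : S → ℂ) ⟨x, hx⟩ := by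
  rw [← inner_delta_left, ContinuousLinearMap.adjoint_inner_right, restr_delta hx,
    inner_delta_left]

theorem adjoint_restr_apply_notMem (S : Set ι) (φ : L2 S) {x : ι} (hx : x ∉ S) :
    (ContinuousLinearMap.adjoint (restr S) φ : ι → ℂ) x = 0 := by
  rw [← inner_delta_left, ContinuousLinearMap.adjoint_inner_right, restr_eq_zero, inner_zero_left]
  exact fun y hy => delta_apply_of_ne fun h => hx (h ▸ hy)

theorem restr_adjoint_restr (S : Set ι) (φ : L2 S) :
    restr S (ContinuousLinearMap.adjoint (restr S) φ) = φ := by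
  ext x
  rw [restr_apply, adjoint_restr_apply_mem S φ x.2]

theorem norm_inner_le_of_support {S : Set ι} {ρ φ : L2 ι} (h : ∀ x ∉ S, (φ : ι → ℂ) x = 0) :
    ‖inner ℂ ρ φ‖ ≤ ‖restr S ρ‖ * ‖φ‖ := by
  have h1 : φ = ContinuousLinearMap.adjoint (restr S) (restr S φ) := by
    ext x
    by_cases hx : x ∈ S
    · rw [adjoint_restr_apply_mem S _ hx, restr_apply]
    · rw [adjoint_restr_apply_notMem S _ hx, h x hx]
  conv_lhs => rw [h1, ContinuousLinearMap.adjoint_inner_right]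
  exact (norm_inner_le_norm _ _).trans
    (mul_le_mul_of_nonneg_left (norm_restr_le S φ) (norm_nonneg _))

theorem isSelfAdjoint_restrictOp {H : L2 ι →L[ℂ] L2 ι} (hH : IsSelfAdjoint H) (Θ : Set ι) :
    IsSelfAdjoint (restrictOp H Θ) := by
  rw [ContinuousLinearMap.isSelfAdjoint_iff', restrictOp, ContinuousLinearMap.adjoint_comp,
    ContinuousLinearMap.adjoint_comp, ContinuousLinearMap.adjoint_adjoint, hH.adjoint_eq]
  rfl

/-- The finite-volume Green function is controlled by the decay of the resolvent on the whole
lattice. -/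
theorem norm_inner_restrictOp_le {H : L2 ι →L[ℂ] L2 ι} (hH : IsSelfAdjoint H) {B : ℝ}
    (hB : ‖H‖ ≤ B) {Λ S : Set ι} (hS : ∀ x ∉ Λ, x ∈ S) {u v : Λ} (hv : (v : ι) ∈ S) (e : ℝ)
    {ε : ℝ} (hε : 0 < ε) (hε1 : ε ≤ 1) :
    ‖green (restrictOp H Λ) ((e : ℂ) + (-ε : ℝ) * Complex.I) u v‖ ≤
      ‖restr S (Ring.inverse (H - ((e : ℂ) + ε * Complex.I) • (1 : L2 ι →L[ℂ] L2 ι)) (delta (u : ι)))‖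
        * ((B + |e| + 1) / ε) := by
  set z : ℂ := (e : ℂ) + ε * Complex.I with hz
  set z' : ℂ := (e : ℂ) + (-ε : ℝ) * Complex.I with hz'
  set A := restrictOp H Λ
  have hA : IsSelfAdjoint A := isSelfAdjoint_restrictOp hH Λ
  have hne : (-ε) ≠ 0 := neg_ne_zero.2 hε.ne'
  have huA : IsUnit (A - z' • (1 : L2 Λ →L[ℂ] L2 Λ)) := isUnit_sub_of_ne_zero hA e hne
  have huH : IsUnit (H - z • (1 : L2 ι →L[ℂ] L2 ι)) := isUnit_sub_of_ne_zero hH e hε.ne'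
  set χ := Ring.inverse (A - z' • (1 : L2 Λ →L[ℂ] L2 Λ)) (delta v) with hχ
  -- `ψ` is the finite-volume solution extended by zero; `φ` below measures how far it is from
  -- solving the equation on the whole lattice.
  set ψ := ContinuousLinearMap.adjoint (restr Λ) χ with hψ
  set ρ := Ring.inverse (H - z • (1 : L2 ι →L[ℂ] L2 ι)) (delta (u : ι)) with hρ
  set φ := H ψ - z' • ψ with hφ
  have hgreen : green A z' u v = inner ℂ (delta (u : ι)) ψ := by
    rw [green, hψ, ContinuousLinearMap.adjoint_inner_right, restr_delta u.2]
  have hconj : (starRingEnd ℂ) z = z' := by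
    rw [hz, hz', map_add, map_mul, Complex.conj_ofReal, Complex.conj_ofReal, Complex.conj_I]
    push_cast; ring
  have h1 : inner ℂ (delta (u : ι)) ψ = inner ℂ ρ φ := by
    have h2 : H ρ - z • ρ = delta (u : ι) := by
      rw [← sub_smul_one_apply]; exact apply_ringInverse huH _
    rw [← h2, hφ, inner_sub_left, inner_sub_right, inner_smul_left, inner_smul_right, hconj]
    congr 1
    exact (ContinuousLinearMap.isSelfAdjoint_iff_isSymmetric.1 hH) ρ ψ
  have hφv : restr Λ φ = delta v := by
    have h2 : A χ - z' • χ = delta v := by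
      rw [← sub_smul_one_apply]; exact apply_ringInverse huA _
    rw [hφ, map_sub, map_smul, hψ, restr_adjoint_restr, ← h2]
    rfl
  -- Inside `Λ` the vector `φ` is `δ_v` and `v ∈ S`; outside `Λ` every point is in `S`. No formula
  -- for the boundary terms is needed.
  have hsupp : ∀ x ∉ S, (φ : ι → ℂ) x = 0 := fun x hx => by
    have hxΛ : x ∈ Λ := by by_contra h; exact hx (hS x h)
    have h3 : (φ : ι → ℂ) x = (restr Λ φ : Λ → ℂ) ⟨x, hxΛ⟩ := rfl
    rw [h3, hφv]
    refine delta_apply_of_ne fun h => hx ?_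
    rw [← h] at hv
    exact hv
  have hψn : ‖ψ‖ ≤ 1 / ε := by
    have h4 : ‖χ‖ ≤ 1 / ε := by
      have h5 := norm_resolvent_le hA e hne
      rw [abs_neg, abs_of_pos hε] at h5
      have h6 := ContinuousLinearMap.le_of_opNorm_le _ h5 (delta v)
      rwa [norm_delta, mul_one] at h6
    have h5 : ‖ContinuousLinearMap.adjoint (restr Λ)‖ ≤ 1 := by
      rw [LinearIsometryEquiv.norm_map]; exact norm_compOp_le _ _
    have h6 := ContinuousLinearMap.le_of_opNorm_le _ h5 χ
    rw [one_mul] at h6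
    exact h6.trans h4
  have hzn : ‖z'‖ ≤ |e| + 1 := by
    refine (norm_add_le _ _).trans ?_
    rw [norm_mul, Complex.norm_I, mul_one, Complex.norm_real, Complex.norm_real, Real.norm_eq_abs,
      Real.norm_eq_abs, abs_neg, abs_of_pos hε]
    linarith
  have hφn : ‖φ‖ ≤ (B + |e| + 1) / ε := by
    calc ‖φ‖ ≤ ‖H ψ‖ + ‖z' • ψ‖ := norm_sub_le _ _
      _ ≤ B * ‖ψ‖ + (|e| + 1) * ‖ψ‖ := by
          rw [norm_smul]
          exact add_le_add (H.le_of_opNorm_le hB ψ) (mul_le_mul_of_nonneg_right hzn (norm_nonneg _))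
      _ = (B + |e| + 1) * ‖ψ‖ := by ring
      _ ≤ (B + |e| + 1) * (1 / ε) := by
          have : 0 ≤ B := (norm_nonneg H).trans hB
          gcongr
      _ = _ := by ring
  rw [hgreen, h1]
  exact (norm_inner_le_of_support hsupp).trans (mul_le_mul_of_nonneg_left hφn (norm_nonneg _))

end L2

/-! ### The Hamiltonian -/

section Hamiltonian

variable {n d : ℕ}

theorem shift_apply (e : Config n d) (ψ : L2 (Config n d)) (x : Config n d) :
    (shift e ψ : Config n d → ℂ) x = (ψ : Config n d → ℂ) (x + e) := rfl

theorem laplacian_apply (ψ : L2 (Config n d)) (x : Config n d) :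
    (laplacian n d ψ : Config n d → ℂ) x = ∑ i : Fin n, ∑ j : Fin d,
      (((ψ : Config n d → ℂ) (x + unitVec i j) - (ψ : Config n d → ℂ) x) +
        ((ψ : Config n d → ℂ) (x + -unitVec i j) - (ψ : Config n d → ℂ) x)) := by
  rw [← inner_delta_left, laplacian]
  simp only [sum_apply, inner_sum]
  refine Finset.sum_congr rfl fun i _ => Finset.sum_congr rfl fun j _ => ?_
  rw [inner_delta_left]
  rfl

theorem inner_shift_left (e : Config n d) (ψ φ : L2 (Config n d)) :
    (inner ℂ (shift e ψ) φ : ℂ) = inner ℂ ψ (shift (-e) φ) := by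
  rw [lp.inner_eq_tsum, lp.inner_eq_tsum]
  rw [← (Equiv.addRight (-e)).tsum_eq]
  refine tsum_congr fun x => ?_
  rw [shift_apply, shift_apply]
  simp

theorem adjoint_shift (e : Config n d) : star (shift e) = shift (-e) := by
  rw [ContinuousLinearMap.star_eq_adjoint]
  symm
  rw [ContinuousLinearMap.eq_adjoint_iff]
  intro ψ φ
  rw [inner_shift_left, neg_neg]

theorem isSelfAdjoint_laplacian : IsSelfAdjoint (laplacian n d) := by
  refine isSelfAdjoint_sum _ fun i _ => isSelfAdjoint_sum _ fun j _ => ?_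
  rw [IsSelfAdjoint, star_add, star_sub, star_sub, adjoint_shift, adjoint_shift, neg_neg, star_one,
    add_comm]

theorem norm_shift_le (e : Config n d) : ‖shift e‖ ≤ 1 := norm_compOp_le _ _

theorem norm_laplacian_le : ‖laplacian n d‖ ≤ n * (d * 4) := by
  rw [laplacian]
  have h1 : ‖(1 : L2 (Config n d) →L[ℂ] L2 (Config n d))‖ ≤ 1 := ContinuousLinearMap.norm_id_le
  refine (norm_sum_le _ _).trans
    ((Finset.sum_le_sum (g := fun _ => (d : ℝ) * 4) fun i _ => ?_).trans (by simp))
  refine (norm_sum_le _ _).trans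
    ((Finset.sum_le_sum (g := fun _ => (4 : ℝ)) fun j _ => ?_).trans (by simp))
  refine (norm_add_le _ _).trans ?_
  have := norm_sub_le (shift (unitVec i j)) (1 : L2 (Config n d) →L[ℂ] L2 (Config n d))
  have := norm_sub_le (shift (-unitVec i j)) (1 : L2 (Config n d) →L[ℂ] L2 (Config n d))
  have := norm_shift_le (unitVec i j : Config n d)
  have := norm_shift_le (-unitVec i j : Config n d)
  linarith

/-- No boundedness is assumed: for unbounded `W` the operator is `0` by convention. Hence the
Hamiltonian is self-adjoint for every realization. -/
theorem isSelfAdjoint_mulOp {ι : Type*} (W : ι → ℝ) : IsSelfAdjoint (mulOp W) := by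
  by_cases hW : ∃ C, ∀ x, |W x| ≤ C
  · rw [ContinuousLinearMap.isSelfAdjoint_iff_isSymmetric]
    intro ψ φ
    rw [ContinuousLinearMap.coe_coe, lp.inner_eq_tsum, lp.inner_eq_tsum]
    refine tsum_congr fun x => ?_
    rw [mulOp_apply hW, mulOp_apply hW]
    simp only [RCLike.inner_apply, map_mul, Complex.conj_ofReal]
    ring
  · rw [mulOp, dif_neg hW]
    exact .zero _

theorem norm_mulOp_le {ι : Type*} {W : ι → ℝ} {C : ℝ} (hC : 0 ≤ C) (hW : ∀ x, |W x| ≤ C) :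
    ‖mulOp W‖ ≤ C := by
  refine ContinuousLinearMap.opNorm_le_bound _ hC fun ψ => ?_
  have hn : ‖((C : ℂ) • ψ : L2 ι)‖ = C * ‖ψ‖ := by
    rw [norm_smul, Complex.norm_real, Real.norm_eq_abs, abs_of_nonneg hC]
  rw [← hn]
  refine lp.norm_mono (by norm_num) fun i => ?_
  rw [mulOp_apply ⟨C, hW⟩]
  change ‖(W i : ℂ) * (ψ : ι → ℂ) i‖ ≤ ‖(C : ℂ) * (ψ : ι → ℂ) i‖
  rw [norm_mul, norm_mul, Complex.norm_real, Complex.norm_real, Real.norm_eq_abs, Real.norm_eq_abs,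
    abs_of_nonneg hC]
  exact mul_le_mul_of_nonneg_right (hW i) (norm_nonneg _)

theorem isSelfAdjoint_hamiltonian (Ut v : (Fin d → ℤ) → ℝ) :
    IsSelfAdjoint (hamiltonian n Ut v) :=
  (isSelfAdjoint_laplacian.neg.add (isSelfAdjoint_mulOp _)).add (isSelfAdjoint_mulOp _)

theorem IsPairInteraction.exists_bound {Ut : (Fin d → ℤ) → ℝ} {r₀ : ℝ}
    (hU : IsPairInteraction Ut r₀) : ∃ K : ℝ, 0 ≤ K ∧ ∀ y, |Ut y| ≤ K := by
  have hfin : (Metric.closedBall (0 : Fin d → ℤ) r₀).Finite :=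
    (isCompact_closedBall _ _).finite_of_discrete
  obtain ⟨K, hK⟩ := (hfin.image fun y => |Ut y|).bddAbove
  refine ⟨max K 0, le_max_right _ _, fun y => ?_⟩
  by_cases hy : ‖y‖ ≤ r₀
  · exact (hK ⟨y, by simpa using hy, rfl⟩).trans (le_max_left _ _)
  · rw [hU.finite_range y (not_le.1 hy), abs_zero]; exact le_max_right _ _

theorem abs_interaction_le {Ut : (Fin d → ℤ) → ℝ} {K : ℝ} (hK : 0 ≤ K) (hUt : ∀ y, |Ut y| ≤ K)
    (x : Config n d) : |interaction Ut x| ≤ n * (n * K) := by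
  rw [interaction]
  refine (Finset.abs_sum_le_sum_abs _ _).trans ?_
  refine (Finset.sum_le_sum (g := fun _ => (n : ℝ) * K) fun i _ => ?_).trans (by simp)
  refine (Finset.abs_sum_le_sum_abs _ _).trans ?_
  refine (Finset.sum_le_sum (g := fun _ => K) fun j _ => hUt _).trans ?_
  rw [Finset.sum_const, nsmul_eq_mul]
  gcongr
  exact (Finset.card_le_univ _).trans (by simp)

theorem abs_randomPotential_le {v : (Fin d → ℤ) → ℝ} {M : ℝ} (hv : ∀ x, v x ∈ Set.Icc 0 M)
    (x : Config n d) : |randomPotential v x| ≤ n * M := by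
  rw [randomPotential]
  refine (Finset.abs_sum_le_sum_abs _ _).trans ?_
  refine (Finset.sum_le_sum (g := fun _ => M) fun i _ => ?_).trans (by simp)
  rw [abs_of_nonneg (hv _).1]
  exact (hv _).2

/-- The Hamiltonian is bounded, uniformly in the disorder. -/
theorem exists_norm_hamiltonian_le {Ut : (Fin d → ℤ) → ℝ} {r₀ : ℝ} (hU : IsPairInteraction Ut r₀)
    {M : ℝ} (hM : 0 < M) : ∃ B : ℝ, 0 < B ∧ ∀ v : (Fin d → ℤ) → ℝ, (∀ x, v x ∈ Set.Icc 0 M) →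
      ‖hamiltonian n Ut v‖ ≤ B := by
  obtain ⟨K, hK, hUt⟩ := hU.exists_bound
  refine ⟨n * (d * 4) + n * M + n * (n * K) + 1, by positivity, fun v hv => ?_⟩
  have h1 : ‖mulOp (randomPotential v : Config n d → ℝ)‖ ≤ n * M :=
    norm_mulOp_le (by positivity) (abs_randomPotential_le hv)
  have h2 : ‖mulOp (interaction Ut : Config n d → ℝ)‖ ≤ n * (n * K) :=
    norm_mulOp_le (by positivity) (abs_interaction_le hK hUt)
  have h3 := norm_laplacian_le (n := n) (d := d)
  refine (norm_add₃_le).trans ?_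
  rw [norm_neg]
  linarith

/-- The Hamiltonian in coordinates. -/
theorem hamiltonian_apply {Ut : (Fin d → ℤ) → ℝ} {r₀ : ℝ} (hU : IsPairInteraction Ut r₀)
    {M : ℝ} {v : (Fin d → ℤ) → ℝ} (hv : ∀ x, v x ∈ Set.Icc 0 M) (ψ : L2 (Config n d))
    (x : Config n d) : (hamiltonian n Ut v ψ : Config n d → ℂ) x =
      -(laplacian n d ψ : Config n d → ℂ) x + (randomPotential v x : ℂ) * (ψ : Config n d → ℂ) x
        + (interaction Ut x : ℂ) * (ψ : Config n d → ℂ) x := by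
  obtain ⟨K, hK, hUt⟩ := hU.exists_bound
  rw [← mulOp_apply ⟨_, abs_randomPotential_le hv⟩, ← mulOp_apply ⟨_, abs_interaction_le hK hUt⟩]
  rfl

theorem norm_unitVec_le (i : Fin n) (j : Fin d) : ‖(unitVec i j : Config n d)‖ ≤ 1 := by
  rw [unitVec, Pi.norm_single, Pi.norm_single, norm_one]

/-- The Hamiltonian only connects nearest neighbours. -/
theorem hamiltonian_apply_eq_zero {Ut : (Fin d → ℤ) → ℝ} {r₀ : ℝ} (hU : IsPairInteraction Ut r₀)
    {M : ℝ} {v : (Fin d → ℤ) → ℝ} (hv : ∀ x, v x ∈ Set.Icc 0 M) {ψ : L2 (Config n d)}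
    {x : Config n d} (h : ∀ y, ‖y - x‖ ≤ 1 → (ψ : Config n d → ℂ) y = 0) :
    (hamiltonian n Ut v ψ : Config n d → ℂ) x = 0 := by
  have h0 : (ψ : Config n d → ℂ) x = 0 := h x (by simp)
  rw [hamiltonian_apply hU hv, laplacian_apply, h0]
  simp only [mul_zero, add_zero, sub_zero, neg_eq_zero]
  refine Finset.sum_eq_zero fun i _ => Finset.sum_eq_zero fun j _ => ?_
  rw [h _ (by simpa using norm_unitVec_le i j), h _ (by simpa using norm_unitVec_le i j), add_zero]

/-- Finite propagation: each application of the Hamiltonian spreads the support by at most one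
lattice step. -/
theorem hamiltonian_pow_delta_apply {Ut : (Fin d → ℤ) → ℝ} {r₀ : ℝ} (hU : IsPairInteraction Ut r₀)
    {M : ℝ} {v : (Fin d → ℤ) → ℝ} (hv : ∀ x, v x ∈ Set.Icc 0 M) (u : Config n d) (m : ℕ) :
    ∀ w : Config n d, (m : ℝ) < ‖w - u‖ →
      ((hamiltonian n Ut v ^ m) (delta u) : Config n d → ℂ) w = 0 := by
  induction m with
  | zero =>
    intro w hw
    refine delta_apply_of_ne fun h => ?_
    simp [h] at hw
  | succ m ih =>
    intro w hw
    rw [pow_succ', mul_apply_eq_comp]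
    refine hamiltonian_apply_eq_zero hU hv fun y hy => ih y ?_
    have := norm_sub_le_norm_sub_add_norm_sub w y u
    rw [norm_sub_rev w y] at this
    push_cast at hw
    linarith

theorem hamiltonian_aeval_delta_apply {Ut : (Fin d → ℤ) → ℝ} {r₀ : ℝ}
    (hU : IsPairInteraction Ut r₀) {M : ℝ} {v : (Fin d → ℤ) → ℝ} (hv : ∀ x, v x ∈ Set.Icc 0 M)
    (u : Config n d) (q : Polynomial ℂ) (w : Config n d) (hw : (q.natDegree : ℝ) < ‖w - u‖) :
    (Polynomial.aeval (hamiltonian n Ut v) q (delta u) : Config n d → ℂ) w = 0 := by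
  rw [← inner_delta_left, Polynomial.aeval_eq_sum_range, sum_apply, inner_sum]
  refine Finset.sum_eq_zero fun m hm => ?_
  have hmq : (m : ℝ) ≤ q.natDegree := by
    exact_mod_cast Nat.lt_succ_iff.1 (Finset.mem_range.1 hm)
  change inner ℂ (delta w) (q.coeff m • (hamiltonian n Ut v ^ m) (delta u)) = 0
  rw [inner_smul_right, inner_delta_left,
    hamiltonian_pow_delta_apply hU hv u m w (hmq.trans_lt hw), mul_zero]

end Hamiltonian

/-! ### Geometry of boxes -/

section Geometry

variable {n d : ℕ}

theorem starDist_symm_le_iff {a b : RConfig n d} {r : ℝ} :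
    starDist .symm a b ≤ r ↔ ∃ π : Equiv.Perm (Fin n), ‖(fun i => a (π i)) - b‖ ≤ r := by
  constructor
  · intro h
    obtain ⟨π, hπ⟩ := exists_eq_ciInf_of_finite
      (f := fun π : Equiv.Perm (Fin n) => ‖(fun i => a (π i)) - b‖)
    exact ⟨π, hπ.trans_le h⟩
  · rintro ⟨π, hπ⟩
    exact (ciInf_le (Set.finite_range _).bddBelow π).trans hπ

/-- Over finitely many particles the infima are attained. At least one particle is needed, since
empty real infima and suprema have default values. -/
theorem starDist_hausdorff_le_iff (hn : 1 ≤ n) {a b : RConfig n d} {r : ℝ} :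
    starDist .hausdorff a b ≤ r ↔
      (∀ i, ∃ j, ‖a i - b j‖ ≤ r) ∧ ∀ j, ∃ i, ‖a i - b j‖ ≤ r := by
  have : Nonempty (Fin n) := ⟨⟨0, hn⟩⟩
  have h1 : ∀ f : Fin n → ℝ, (⨅ j, f j) ≤ r ↔ ∃ j, f j ≤ r := fun f => by
    constructor
    · intro h
      obtain ⟨j, hj⟩ := exists_eq_ciInf_of_finite (f := f)
      exact ⟨j, hj.trans_le h⟩
    · rintro ⟨j, hj⟩
      exact (ciInf_le (Set.finite_range _).bddBelow j).trans hj
  have h2 : ∀ f : Fin n → ℝ, (⨆ j, f j) ≤ r ↔ ∀ j, f j ≤ r := fun f =>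
    ciSup_le_iff (Set.finite_range _).bddAbove
  change max (⨆ i, ⨅ j, ‖a i - b j‖) (⨆ j, ⨅ i, ‖a i - b j‖) ≤ r ↔ _
  rw [max_le_iff, h2, h2]
  simp only [h1]

theorem starDist_triangle (hn : 1 ≤ n) (k : DistKind) (a b c : RConfig n d) :
    starDist k a c ≤ starDist k a b + starDist k b c := by
  cases k with
  | norm => exact norm_sub_le_norm_sub_add_norm_sub a b c
  | symm =>
    obtain ⟨π, hπ⟩ := starDist_symm_le_iff.1 (le_refl (starDist .symm a b))
    obtain ⟨ρ, hρ⟩ := starDist_symm_le_iff.1 (le_refl (starDist .symm b c))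
    refine starDist_symm_le_iff.2 ⟨ρ.trans π, ?_⟩
    refine (norm_sub_le_norm_sub_add_norm_sub _ (fun i => b (ρ i)) _).trans (add_le_add ?_ hρ)
    refine le_trans ?_ hπ
    refine (pi_norm_le_iff_of_nonneg (norm_nonneg _)).2 fun i => ?_
    exact norm_le_pi_norm ((fun i => a (π i)) - b) (ρ i)
  | hausdorff =>
    obtain ⟨h1, h2⟩ := (starDist_hausdorff_le_iff hn).1 (le_refl (starDist .hausdorff a b))
    obtain ⟨h3, h4⟩ := (starDist_hausdorff_le_iff hn).1 (le_refl (starDist .hausdorff b c))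
    refine (starDist_hausdorff_le_iff hn).2 ⟨fun i => ?_, fun j => ?_⟩
    · obtain ⟨j, hj⟩ := h1 i
      obtain ⟨l, hl⟩ := h3 j
      exact ⟨l, (norm_sub_le_norm_sub_add_norm_sub _ (b j) _).trans (add_le_add hj hl)⟩
    · obtain ⟨l, hl⟩ := h4 j
      obtain ⟨i, hi⟩ := h2 l
      exact ⟨i, (norm_sub_le_norm_sub_add_norm_sub _ (b l) _).trans (add_le_add hi hl)⟩

theorem starDist_le_norm_sub (hn : 1 ≤ n) (k : DistKind) (a b : RConfig n d) :
    starDist k a b ≤ ‖a - b‖ := by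
  cases k with
  | norm => exact le_rfl
  | symm => exact starDist_symm_le_iff.2 ⟨1, le_rfl⟩
  | hausdorff =>
    exact (starDist_hausdorff_le_iff hn).2
      ⟨fun i => ⟨i, norm_le_pi_norm (a - b) i⟩, fun i => ⟨i, norm_le_pi_norm (a - b) i⟩⟩

/-- The one consequence common to all three distances that counting points in boxes requires: each
particle of `b` is near some particle of `a`. -/
theorem exists_norm_sub_le_of_starDist_le (hn : 1 ≤ n) (k : DistKind) {a b : RConfig n d} {r : ℝ}
    (h : starDist k a b ≤ r) (j : Fin n) : ∃ i, ‖a i - b j‖ ≤ r := by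
  cases k with
  | norm => exact ⟨j, (norm_le_pi_norm (a - b) j).trans h⟩
  | symm =>
    obtain ⟨π, hπ⟩ := starDist_symm_le_iff.1 h
    exact ⟨π j, (norm_le_pi_norm ((fun i => a (π i)) - b) j).trans hπ⟩
  | hausdorff => exact ((starDist_hausdorff_le_iff hn).1 h).2 j

theorem norm_toReal_sub_le (u w : Config n d) : ‖toReal u - toReal w‖ ≤ ‖u - w‖ := by
  refine (pi_norm_le_iff_of_nonneg (norm_nonneg _)).2 fun i =>
    (pi_norm_le_iff_of_nonneg (norm_nonneg _)).2 fun j => ?_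
  have h1 : ‖(toReal u - toReal w) i j‖ = ‖(u - w) i j‖ := by
    simp [toReal, Int.norm_eq_abs]
  rw [h1]
  exact (norm_le_pi_norm ((u - w) i) j).trans (norm_le_pi_norm (u - w) i)

theorem starDist_toReal_le (hn : 1 ≤ n) (k : DistKind) (u w : Config n d) :
    starDist k (toReal u) (toReal w) ≤ ‖w - u‖ := by
  rw [norm_sub_rev]
  exact (starDist_le_norm_sub hn k _ _).trans (norm_toReal_sub_le u w)

theorem norm_sub_le_one_of_sum_eq_one {u w : Config n d} (h : ∑ i, ∑ j, |u i j - w i j| = 1) :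
    ‖w - u‖ ≤ 1 := by
  refine (pi_norm_le_iff_of_nonneg zero_le_one).2 fun i =>
    (pi_norm_le_iff_of_nonneg zero_le_one).2 fun j => ?_
  have h1 : |u i j - w i j| ≤ 1 := by
    rw [← h]
    refine le_trans ?_ (Finset.single_le_sum (f := fun i => ∑ j, |u i j - w i j|)
      (fun i _ => Finset.sum_nonneg fun j _ => abs_nonneg _) (Finset.mem_univ i))
    exact Finset.single_le_sum (f := fun j => |u i j - w i j|) (fun j _ => abs_nonneg _)
      (Finset.mem_univ j)
  rw [abs_sub_comm] at h1
  change ‖w i j - u i j‖ ≤ 1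
  rw [Int.norm_eq_abs]
  exact_mod_cast h1

/-- The points of `ℤ^{nd}` at `⋆`-distance more than `r` from `u`. -/
def farSet (k : DistKind) (r : ℝ) (u : Config n d) : Set (Config n d) :=
  {w | r < starDist k (toReal u) (toReal w)}

/-- The triangle inequality gives distance more than `L/2 - L/6 = L/3`. -/
theorem mem_farSet_of_notMem_box (hn : 1 ≤ n) (k : DistKind) {L : ℝ} (hL : 0 < L)
    {y : RConfig n d} {u w : Config n d} (hu : u ∈ box k (L / 3) y) (hw : w ∉ box k L y) :
    w ∈ farSet k (L / 4) u := by
  have h1 : starDist k y (toReal u) ≤ L / 3 / 2 := hu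
  have h2 : L / 2 < starDist k y (toReal w) := not_le.1 hw
  have h3 := starDist_triangle hn k y (toReal u) (toReal w)
  change L / 4 < _
  linarith

/-- As for points outside the box, minus one for the step to an outer neighbour: `L/3 - 1 ≥ L/4`
once `L ≥ 12`. -/
theorem mem_farSet_of_mem_innerBoundary (hn : 1 ≤ n) (k : DistKind) {L : ℝ} (hL : 12 < L)
    {y : RConfig n d} {u v : Config n d} (hu : u ∈ box k (L / 3) y)
    (hv : v ∈ innerBoundary (box k L y)) : v ∈ farSet k (L / 4) u := by
  obtain ⟨-, w, hw, hvw⟩ := hv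
  have h1 : starDist k y (toReal u) ≤ L / 3 / 2 := hu
  have h2 : L / 2 < starDist k y (toReal w) := not_le.1 hw
  have h3 := starDist_triangle hn k y (toReal u) (toReal w)
  have h4 := starDist_triangle hn k (toReal u) (toReal v) (toReal w)
  have h5 := (starDist_toReal_le hn k v w).trans (norm_sub_le_one_of_sum_eq_one hvw)
  change L / 4 < _
  linarith

theorem card_Icc_ceil_floor_le (a : ℝ) {L : ℝ} (hL : 0 ≤ L) :
    ((Finset.Icc ⌈a - L / 2⌉ ⌊a + L / 2⌋).card : ℝ) ≤ L + 1 := by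
  rw [Int.card_Icc]
  have h1 := Int.floor_le (a + L / 2)
  have h2 := Int.le_ceil (a - L / 2)
  have h3 : (((⌊a + L / 2⌋ + 1 - ⌈a - L / 2⌉).toNat : ℤ) : ℝ)
      = ((max (⌊a + L / 2⌋ + 1 - ⌈a - L / 2⌉) 0 : ℤ) : ℝ) := by
    rw [Int.toNat_eq_max]
  rw [Int.cast_natCast] at h3
  rw [h3]
  push_cast
  exact max_le (by linarith) (by linarith)

/-- Boxes are finite, with at most `C L^{nd}` points. -/
theorem exists_finset_box_subset (hn : 1 ≤ n) (k : DistKind) {L : ℝ} (hL : 1 ≤ L)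
    (y : RConfig n d) : ∃ F : Finset (Config n d), box k L y ⊆ F ∧
      (F.card : ℝ) ≤ (n * 2 ^ d) ^ n * L ^ (n * d) := by
  classical
  -- `G j` is the cube around the `j`-th center. For the symmetrized and Hausdorff distances a
  -- particle may lie in any of these cubes, so every coordinate ranges over their union.
  set G : Fin n → Finset (Fin d → ℤ) := fun j =>
    Fintype.piFinset fun c => Finset.Icc ⌈y j c - L / 2⌉ ⌊y j c + L / 2⌋
  set G' := Finset.univ.biUnion G
  have hG : ∀ j, ((G j).card : ℝ) ≤ (2 * L) ^ d := fun j => by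
    rw [Fintype.card_piFinset]
    push_cast
    calc ∏ c, ((Finset.Icc ⌈y j c - L / 2⌉ ⌊y j c + L / 2⌋).card : ℝ) ≤ ∏ _c : Fin d, (2 * L) :=
          Finset.prod_le_prod (fun _ _ => Nat.cast_nonneg _) fun c _ =>
            (card_Icc_ceil_floor_le _ (by linarith)).trans (by linarith)
      _ = _ := by simp
  have hG' : (G'.card : ℝ) ≤ n * (2 * L) ^ d := by
    calc (G'.card : ℝ) ≤ ((∑ j, (G j).card : ℕ) : ℝ) := by
          exact_mod_cast Finset.card_biUnion_le
      _ ≤ ∑ _j : Fin n, (2 * L) ^ d := by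
          push_cast
          exact Finset.sum_le_sum fun j _ => hG j
      _ = _ := by simp
  refine ⟨Fintype.piFinset fun _ => G', fun u hu => ?_, ?_⟩
  · rw [Finset.mem_coe, Fintype.mem_piFinset]
    intro i
    obtain ⟨j, hj⟩ := exists_norm_sub_le_of_starDist_le hn k hu i
    refine Finset.mem_biUnion.2 ⟨j, Finset.mem_univ _, Fintype.mem_piFinset.2 fun c => ?_⟩
    have h1 := (norm_le_pi_norm (y j - toReal u i) c).trans hj
    have h2 : |y j c - (u i c : ℝ)| ≤ L / 2 := h1
    obtain ⟨h3, h4⟩ := abs_le.1 h2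
    exact Finset.mem_Icc.2 ⟨Int.ceil_le.2 (by linarith), Int.le_floor.2 (by linarith)⟩
  · rw [Fintype.card_piFinset]
    simp only [Finset.prod_const, Finset.card_univ, Fintype.card_fin]
    push_cast
    calc (G'.card : ℝ) ^ n ≤ (n * (2 * L) ^ d) ^ n := by gcongr
      _ = _ := by
        rw [mul_pow, mul_pow 2 L, mul_pow, mul_pow, ← pow_mul, ← pow_mul L, mul_comm d n]
        ring

theorem box_finite (hn : 1 ≤ n) (k : DistKind) {L : ℝ} (hL : 1 ≤ L) (y : RConfig n d) :
    (box k L y).Finite := by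
  obtain ⟨F, hF, -⟩ := exists_finset_box_subset hn k hL y
  exact F.finite_toSet.subset hF

end Geometry

/-! ### The Wegner estimate -/

section WegnerHamiltonian

variable {n d : ℕ}

/-- The matrix of `-Δ + U` on a set of configurations. -/
noncomputable def freeMatrix (Ut : (Fin d → ℤ) → ℝ) (Λ : Set (Config n d)) : Matrix Λ Λ ℂ :=
  Matrix.of fun u v => inner ℂ (delta (u : Config n d))
    ((-laplacian n d + mulOp (interaction Ut) : L2 (Config n d) →L[ℂ] L2 (Config n d))
      (delta (v : Config n d)))

theorem freeMatrix_isHermitian (Ut : (Fin d → ℤ) → ℝ) (Λ : Set (Config n d)) :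
    (freeMatrix Ut Λ).IsHermitian := by
  have hs : IsSelfAdjoint (-laplacian n d + mulOp (interaction Ut)) :=
    isSelfAdjoint_laplacian.neg.add (isSelfAdjoint_mulOp _)
  refine Matrix.IsHermitian.ext fun u v => ?_
  change (starRingEnd ℂ) (inner ℂ (delta (v : Config n d)) _) = inner ℂ (delta (u : Config n d)) _
  rw [inner_conj_symm]
  exact (ContinuousLinearMap.isSelfAdjoint_iff_isSymmetric.1 hs) _ _

/-- The sites occupied by some configuration in a finite set. -/
def occupiedSites (Λ : Set (Config n d)) [Fintype Λ] : Finset (Fin d → ℤ) :=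
  Finset.univ.biUnion fun u : Λ => Finset.univ.image (u : Config n d)

/-- The number of particles at a site. -/
def occupation (Λ : Set (Config n d)) [Fintype Λ] (x : occupiedSites Λ) (u : Λ) : ℕ :=
  (Finset.univ.filter fun i => (u : Config n d) i = x).card

theorem mem_occupiedSites (Λ : Set (Config n d)) [Fintype Λ] (u : Λ) (i : Fin n) :
    (u : Config n d) i ∈ occupiedSites Λ :=
  Finset.mem_biUnion.2 ⟨u, Finset.mem_univ _, Finset.mem_image_of_mem _ (Finset.mem_univ i)⟩

/-- Grouping the particles by the site they occupy writes the potential as a linear combination of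
finitely many independent variables, the form the matrix estimate needs. -/
theorem sum_occupation_mul (Λ : Set (Config n d)) [Fintype Λ] (u : Λ) (v : (Fin d → ℤ) → ℝ) :
    ∑ x : occupiedSites Λ, v x * occupation Λ x u = randomPotential v (u : Config n d) := by
  have h1 : ∑ x ∈ occupiedSites Λ, v x *
      ((Finset.univ.filter fun i => (u : Config n d) i = x).card : ℝ)
      = randomPotential v (u : Config n d) := by
    rw [randomPotential, ← Finset.sum_fiberwise_of_maps_to
      (g := (u : Config n d)) (t := occupiedSites Λ) fun i _ => mem_occupiedSites Λ u i]
    refine Finset.sum_congr rfl fun x _ => ?_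
    rw [Finset.sum_congr rfl fun i hi => by rw [(Finset.mem_filter.1 hi).2], Finset.sum_const,
      nsmul_eq_mul, mul_comm]
  rw [← h1]
  exact Finset.sum_coe_sort (occupiedSites Λ) fun x => v x *
    ((Finset.univ.filter fun i => (u : Config n d) i = x).card : ℝ)

theorem sum_occupation (Λ : Set (Config n d)) [Fintype Λ] (u : Λ) :
    ∑ x : occupiedSites Λ, occupation Λ x u = n := by
  have := sum_occupation_mul Λ u fun _ => 1
  simp only [one_mul, randomPotential, Finset.sum_const, Finset.card_univ, Fintype.card_fin,
    nsmul_eq_mul, mul_one] at this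
  exact_mod_cast this

theorem adjoint_restr_eq_sum {ι : Type*} (Λ : Set ι) [Fintype Λ] (ψ : L2 Λ) :
    ContinuousLinearMap.adjoint (restr Λ) ψ = ∑ u : Λ, (ψ : Λ → ℂ) u • delta (u : ι) := by
  classical
  ext x
  rw [← inner_delta_left x (∑ u : Λ, _), inner_sum]
  simp only [inner_smul_right, inner_delta_left]
  by_cases hx : x ∈ Λ
  · rw [adjoint_restr_apply_mem Λ ψ hx, Finset.sum_eq_single ⟨x, hx⟩, delta_apply_self, mul_one]
    · intro u _ hu
      rw [delta_apply_of_ne fun h => hu (Subtype.ext h.symm), mul_zero]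
    · exact fun h => absurd (Finset.mem_univ _) h
  · rw [adjoint_restr_apply_notMem Λ ψ hx]
    refine (Finset.sum_eq_zero fun u _ => ?_).symm
    rw [delta_apply_of_ne (by rintro rfl; exact hx u.2), mul_zero]

theorem restrictOp_hamiltonian_apply {Ut : (Fin d → ℤ) → ℝ} {M : ℝ} {v : (Fin d → ℤ) → ℝ}
    (hv : ∀ x, v x ∈ Set.Icc 0 M) (Λ : Set (Config n d)) [Fintype Λ] [DecidableEq Λ] (ψ : L2 Λ)
    (u : Λ) : (restrictOp (hamiltonian n Ut v) Λ ψ : Λ → ℂ) u =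
      (potentialMatrix (freeMatrix Ut Λ) (occupation Λ) fun x => v x).mulVec (ψ : Λ → ℂ) u := by
  have h1 : (restrictOp (hamiltonian n Ut v) Λ ψ : Λ → ℂ) u
      = ((-laplacian n d + mulOp (interaction Ut) : L2 (Config n d) →L[ℂ] L2 (Config n d))
          (ContinuousLinearMap.adjoint (restr Λ) ψ) :
          Config n d → ℂ) u + (mulOp (randomPotential v)
            (ContinuousLinearMap.adjoint (restr Λ) ψ) : Config n d → ℂ) u := by
    have : hamiltonian n Ut v = (-laplacian n d + mulOp (interaction Ut)) +
        mulOp (randomPotential v) := by rw [hamiltonian]; abel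
    rw [this]
    rfl
  rw [h1, mulOp_apply ⟨_, abs_randomPotential_le hv⟩, adjoint_restr_apply_mem Λ ψ u.2,
    potentialMatrix, Matrix.add_mulVec, Pi.add_apply, Matrix.mulVec_diagonal,
    sum_occupation_mul Λ u v]
  congr 1
  rw [adjoint_restr_eq_sum, map_sum, ← inner_delta_left, inner_sum, Matrix.mulVec, dotProduct]
  refine Finset.sum_congr rfl fun w _ => ?_
  rw [map_smul, inner_smul_right, mul_comm]
  rfl

/-- The Wegner estimate: with high probability the distance from `e` to the spectrum of the
finite-volume Hamiltonian is at least `η`. -/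
theorem wegner_estimate (hn : 1 ≤ n) {Ω : Type*} [MeasurableSpace Ω] {P : Measure Ω}
    [IsProbabilityMeasure P] {μ : Measure ℝ} {c : ℝ≥0∞} (hμ : μ ≤ c • volume)
    {ω : (Fin d → ℤ) → Ω → ℝ} (hω : IsDisorder P ω μ) (Ut : (Fin d → ℤ) → ℝ) (M : ℝ)
    {Λ : Set (Config n d)} (hΛ : Λ.Finite) (e : ℝ) {η : ℝ} (hη : 0 < η) :
    P {a | (∀ x, ω x a ∈ Set.Icc 0 M) ∧ ¬ ∀ ψ : L2 Λ,
        η * ‖ψ‖ ≤ ‖restrictOp (hamiltonian n Ut fun x => ω x a) Λ ψ - (e : ℂ) • ψ‖}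
      ≤ c * ENNReal.ofReal Real.pi * n * Λ.ncard * ENNReal.ofReal (4 * η) := by
  classical
  have : Fintype Λ := hΛ.fintype
  have h1 := measure_resolventHS_ge_le (P := P) hμ (X := fun (x : occupiedSites Λ) => ω x)
    (fun x => hω.measurable x) (hω.indep.precomp Subtype.val_injective) (fun x => hω.law x)
    (freeMatrix_isHermitian Ut Λ) (N := occupation Λ) hn (sum_occupation Λ) e hη
  have h2 : Λ.ncard = Fintype.card Λ := by
    rw [← Nat.card_coe_set_eq, Nat.card_eq_fintype_card]
  rw [h2]
  refine (measure_mono fun a ha => ?_).trans h1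
  obtain ⟨hv, hbad⟩ := ha
  by_contra hcon
  refine hbad fun ψ => ?_
  have hlt : resolventHS (freeMatrix Ut Λ) (occupation Λ) e η (fun x => ω x a)
      < 1 / (4 * η ^ 2) := not_le.1 hcon
  have h3 := sum_normSq_le_of_resolventHS_lt (freeMatrix_isHermitian Ut Λ) (occupation Λ) e hη _
    hlt (ψ : Λ → ℂ)
  set A := restrictOp (hamiltonian n Ut fun x => ω x a) Λ
  have hA : IsSelfAdjoint A := isSelfAdjoint_restrictOp (isSelfAdjoint_hamiltonian _ _) Λ
  have h4 : ∑ u, ‖(ψ : Λ → ℂ) u‖ ^ 2 = ‖ψ‖ ^ 2 := (hasSum_fintype _).unique (hasSum_norm_sq ψ)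
  have h5 : ∑ u, ‖((shiftedMatrix (potentialMatrix (freeMatrix Ut Λ) (occupation Λ)
      fun x => ω x a) e η).mulVec (ψ : Λ → ℂ)) u‖ ^ 2
      = ‖A ψ - ((e : ℂ) + η * Complex.I) • ψ‖ ^ 2 := by
    rw [← (hasSum_fintype _).unique (hasSum_norm_sq (A ψ - ((e : ℂ) + η * Complex.I) • ψ))]
    refine Finset.sum_congr rfl fun u _ => ?_
    congr 2
    rw [shiftedMatrix, Matrix.sub_mulVec, Pi.sub_apply, ← restrictOp_hamiltonian_apply hv Λ ψ u,
      Matrix.scalar_apply, Matrix.mulVec_diagonal]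
    rfl
  -- The bound `4η²‖ψ‖²` at `e + iη` includes `η²‖ψ‖²` from the imaginary part; what is left at `e`
  -- is `3η²‖ψ‖²`.
  rw [h4, h5, norm_sub_smul_sq hA e η ψ] at h3
  refine le_of_sq_le_sq ?_ (norm_nonneg _)
  nlinarith [sq_nonneg (η * ‖ψ‖)]

end WegnerHamiltonian

/-! ### Measurability in the disorder and in time -/

section Measurability

variable {n d : ℕ} {α : Type*} [MeasurableSpace α]

theorem measurable_hamiltonian_apply {Ut : (Fin d → ℤ) → ℝ} {r₀ : ℝ}
    (hU : IsPairInteraction Ut r₀) {M : ℝ} {v : α → (Fin d → ℤ) → ℝ}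
    (hv : ∀ x, Measurable fun a => v a x) (hb : ∀ a x, v a x ∈ Set.Icc 0 M)
    {ψ : α → L2 (Config n d)} (hψ : ∀ w, Measurable fun a => (ψ a : Config n d → ℂ) w)
    (w : Config n d) :
    Measurable fun a => (hamiltonian n Ut (v a) (ψ a) : Config n d → ℂ) w := by
  simp only [hamiltonian_apply hU (hb _), laplacian_apply]
  have h1 : Measurable fun a => (randomPotential (v a) w : ℂ) :=
    Complex.measurable_ofReal.comp (Finset.measurable_sum _ fun i _ => hv (w i))
  refine ((Finset.measurable_sum _ fun i _ => Finset.measurable_sum _ fun j _ => ?_).neg.add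
    (h1.mul (hψ w))).add ((hψ w).const_mul _)
  exact Measurable.add (Measurable.sub (hψ (w + unitVec i j)) (hψ w))
    (Measurable.sub (hψ (w + -unitVec i j)) (hψ w))

theorem measurable_hamiltonian_pow_apply {Ut : (Fin d → ℤ) → ℝ} {r₀ : ℝ}
    (hU : IsPairInteraction Ut r₀) {M : ℝ} {v : α → (Fin d → ℤ) → ℝ}
    (hv : ∀ x, Measurable fun a => v a x) (hb : ∀ a x, v a x ∈ Set.Icc 0 M)
    {ψ : α → L2 (Config n d)} (hψ : ∀ w, Measurable fun a => (ψ a : Config n d → ℂ) w) (m : ℕ) :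
    ∀ w : Config n d,
      Measurable fun a => ((hamiltonian n Ut (v a) ^ m) (ψ a) : Config n d → ℂ) w := by
  induction m with
  | zero => simpa using hψ
  | succ m ih =>
    intro w
    simp only [pow_succ', mul_apply_eq_comp]
    exact measurable_hamiltonian_apply hU hv hb ih w

theorem sum_smul_apply {ι κ : Type*} (s : Finset κ) (c : κ → ℂ) (A : κ → L2 ι →L[ℂ] L2 ι)
    (ψ : L2 ι) (w : ι) : ((∑ m ∈ s, c m • A m) ψ : ι → ℂ) w
      = ∑ m ∈ s, c m * ((A m) ψ : ι → ℂ) w := by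
  rw [← inner_delta_left, sum_apply, inner_sum]
  refine Finset.sum_congr rfl fun m _ => ?_
  rw [inner_delta_left]
  rfl

/-- A bounded function of a self-adjoint operator is a norm limit of polynomials. -/
theorem tendsto_aeval_cfc {E : Type*} [NormedAddCommGroup E] [InnerProductSpace ℂ E]
    [CompleteSpace E] {g : ℝ → ℝ} (hg : ContDiff ℝ ((⊤ : ℕ∞) : WithTop ℕ∞) g) {B : ℝ}
    (hB : 0 < B) : ∃ q : ℕ → Polynomial ℂ, ∀ A : E →L[ℂ] E, IsSelfAdjoint A → ‖A‖ ≤ B →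
      Tendsto (fun m => Polynomial.aeval A (q m)) atTop (𝓝 (operatorFunction g A)) := by
  -- Two derivatives suffice for the error `C/(m+1)`. The polynomials do not depend on `A`, which is
  -- what measurability in the disorder requires.
  obtain ⟨C, hC, h⟩ := exists_polynomial_near_on_Icc 2 g  (contDiff_infty.1 hg 2) B hB
  choose p _ hp using fun m : ℕ => h (m + 1) (Nat.succ_ne_zero m)
  refine ⟨fun m => (p m).map (algebraMap ℝ ℂ), fun A hA hAB => ?_⟩
  rw [tendsto_iff_norm_sub_tendsto_zero, operatorFunction]
  have hlim : Tendsto (fun m : ℕ => C * (1 / ((m : ℝ) + 1))) atTop (𝓝 0) := by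
    simpa using tendsto_one_div_add_atTop_nhds_zero_nat.const_mul C
  refine squeeze_zero (fun _ => norm_nonneg _) (fun m => ?_) hlim
  rw [Polynomial.aeval_map_algebraMap, norm_sub_rev]
  have := norm_cfc_sub_aeval_le hA hAB hg.continuous (by positivity) (hp m)
  refine this.trans (le_of_eq ?_)
  rw [Real.sq_sqrt (by positivity)]
  push_cast
  ring

/-- The evolved vector is a limit of Taylor sums of the exponential times polynomials in the
Hamiltonian, and coordinates of such vectors are measurable because the Hamiltonian acts on
coordinates by finite sums. Time and disorder are treated jointly so that Tonelli applies later. -/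
theorem measurable_evolve_apply {Ut : (Fin d → ℤ) → ℝ} {r₀ : ℝ}
    (hU : IsPairInteraction Ut r₀) {M : ℝ} (hM : 0 < M) {v : α → (Fin d → ℤ) → ℝ}
    (hv : ∀ x, Measurable fun a => v a x) (hb : ∀ a x, v a x ∈ Set.Icc 0 M) {g : ℝ → ℝ}
    (hg : ContDiff ℝ ((⊤ : ℕ∞) : WithTop ℕ∞) g) {t : α → ℝ} (ht : Measurable t)
    (u w : Config n d) :
    Measurable fun a => (evolve g (hamiltonian n Ut (v a)) (t a) (delta u) : Config n d → ℂ) w := by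
  obtain ⟨B, hB, hH⟩ := exists_norm_hamiltonian_le (n := n) hU hM
  obtain ⟨q, hq⟩ := tendsto_aeval_cfc (E := L2 (Config n d)) hg hB
  set S : ℕ → α → L2 (Config n d) →L[ℂ] L2 (Config n d) := fun m a =>
    ∑ j ∈ Finset.range m, (((j.factorial : ℂ)⁻¹) * (-(Complex.I * (t a : ℂ))) ^ j) •
      hamiltonian n Ut (v a) ^ j with hS
  have hSlim : ∀ a, Tendsto (fun m => S m a) atTop
      (𝓝 (NormedSpace.exp ((-(Complex.I * (t a : ℂ))) • hamiltonian n Ut (v a)))) := fun a => by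
    have h1 := (NormedSpace.exp_series_hasSum_exp' (𝕂 := ℂ)
      ((-(Complex.I * (t a : ℂ))) • hamiltonian n Ut (v a))).tendsto_sum_nat
    simpa only [smul_pow, smul_smul, hS] using h1
  have hmeas : ∀ m, Measurable fun a => ((S m a * Polynomial.aeval (hamiltonian n Ut (v a)) (q m))
      (delta u) : Config n d → ℂ) w := fun m => by
    simp only [mul_apply_eq_comp, hS, sum_smul_apply]
    have hψ : ∀ x, Measurable fun a =>
        (Polynomial.aeval (hamiltonian n Ut (v a)) (q m) (delta u) : Config n d → ℂ) x :=
        fun x => by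
      simp only [Polynomial.aeval_eq_sum_range, sum_smul_apply]
      exact Finset.measurable_sum _ fun j _ => (measurable_hamiltonian_pow_apply hU hv hb
        (fun _ => measurable_const) j x).const_mul _
    refine Finset.measurable_sum _ fun j _ => Measurable.mul ?_
      (measurable_hamiltonian_pow_apply hU hv hb hψ j w)
    fun_prop
  refine measurable_of_tendsto_metrizable hmeas (tendsto_pi_nhds.2 fun a => ?_)
  have h1 := (hSlim a).mul (hq _ (isSelfAdjoint_hamiltonian Ut (v a)) (hH _ (hb a)))
  have h2 := ((ContinuousLinearMap.apply ℂ _ (delta u)).continuous.tendsto _).comp h1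
  have h3 := ((innerSL ℂ (delta w)).continuous.tendsto _).comp h2
  simpa only [Function.comp_def, ContinuousLinearMap.apply_apply, innerSL_apply_apply,
    inner_delta_left, evolve_eq] using h3

theorem measurable_moment {Ut : (Fin d → ℤ) → ℝ} {r₀ : ℝ}
    (hU : IsPairInteraction Ut r₀) {M : ℝ} (hM : 0 < M) {v : α → (Fin d → ℤ) → ℝ}
    (hv : ∀ x, Measurable fun a => v a x) (hb : ∀ a x, v a x ∈ Set.Icc 0 M) {g : ℝ → ℝ}
    (hg : ContDiff ℝ ((⊤ : ℕ∞) : WithTop ℕ∞) g) {t : α → ℝ} (ht : Measurable t) (k : DistKind)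
    (p : ℝ) (u : Config n d) :
    Measurable fun a => moment k p g (hamiltonian n Ut (v a)) (t a) u := by
  refine Measurable.tsum fun w => ?_
  simp only [inner_delta_left]
  exact (((measurable_evolve_apply hU hM hv hb hg ht u w).norm.pow_const 2).const_mul
    _).ennreal_ofReal

end Measurability

/-! ### Moments control the decay of the resolvent -/

section Moments

variable {n d : ℕ}

/-- The time integral of the moments for a fixed realization of the disorder. -/
noncomputable def timeMoment (k : DistKind) (p : ℝ) (g : ℝ → ℝ)
    (H : L2 (Config n d) →L[ℂ] L2 (Config n d)) (ε : ℝ) (u : Config n d) : ℝ≥0∞ :=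
  ∫⁻ t in Set.Ioi (0 : ℝ), ENNReal.ofReal (Real.exp (-(ε * t))) * moment k p g H t u

theorem ofReal_norm_restr_sq {ι : Type*} (S : Set ι) (ψ : L2 ι) :
    ENNReal.ofReal (‖restr S ψ‖ ^ 2) = ∑' w : S, ENNReal.ofReal (‖(ψ : ι → ℂ) w‖ ^ 2) := by
  have h := hasSum_norm_sq (restr S ψ)
  rw [← h.tsum_eq, ENNReal.ofReal_tsum_of_nonneg (fun _ => by positivity) h.summable]
  rfl

theorem le_bracket (s : ℝ) : s ≤ bracket s :=
  Real.le_sqrt_of_sq_le (by linarith)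

/-- On the far set the weight of the moment is at least `r ^ p`, so it can be inserted at the cost
`r ^ (-p)` after the time-averaged bound on each matrix element. Summing over the whole lattice then
produces the moment. -/
theorem ofReal_norm_restr_resolvent_sq_le {Ut : (Fin d → ℤ) → ℝ} {r₀ : ℝ}
    (hU : IsPairInteraction Ut r₀) {M : ℝ} (hM : 0 < M) {v : (Fin d → ℤ) → ℝ}
    (hb : ∀ x, v x ∈ Set.Icc 0 M) {g : ℝ → ℝ} (hg : ContDiff ℝ ((⊤ : ℕ∞) : WithTop ℕ∞) g)
    (k : DistKind) {p : ℝ} (hp : 0 ≤ p) {r : ℝ} (hr : 0 < r) (e : ℝ) {ε : ℝ} (hε : 0 < ε)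
    (u : Config n d) :
    ENNReal.ofReal (‖restr (farSet k r u) ((Ring.inverse (hamiltonian n Ut v -
      ((e : ℂ) + ε * Complex.I) • (1 : L2 (Config n d) →L[ℂ] L2 (Config n d))) *
        operatorFunction g (hamiltonian n Ut v)) (delta u))‖ ^ 2) ≤
      ENNReal.ofReal (r ^ (-p) / ε) * timeMoment k p g (hamiltonian n Ut v) ε u := by
  set H := hamiltonian n Ut v
  have hH : IsSelfAdjoint H := isSelfAdjoint_hamiltonian Ut v
  set F : Config n d → ℝ → ℝ := fun w t => ‖(evolve g H t (delta u) : Config n d → ℂ) w‖ ^ 2 with hF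
  have hFm : ∀ w, Measurable (F w) := fun w =>
    (measurable_evolve_apply hU hM (v := fun _ : ℝ => v) (fun _ => measurable_const) (fun _ => hb)
      hg measurable_id u w).norm.pow_const 2
  set D : Config n d → ℝ := fun w => bracket (starDist k (toReal u) (toReal w)) ^ p with hD
  have hDr : ∀ w ∈ farSet k r u, 1 ≤ r ^ (-p) * D w := fun w hw => by
    have h1 : r ≤ bracket (starDist k (toReal u) (toReal w)) := (le_of_lt hw).trans (le_bracket _)
    have h2 : r ^ p ≤ D w := Real.rpow_le_rpow hr.le h1 hp
    calc (1 : ℝ) = r ^ (-p) * r ^ p := by rw [← Real.rpow_add hr]; simp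
      _ ≤ _ := mul_le_mul_of_nonneg_left h2 (Real.rpow_nonneg hr.le _)
  rw [ofReal_norm_restr_sq]
  have hpt : ∀ w : farSet k r u, ENNReal.ofReal (‖((Ring.inverse (H -
      ((e : ℂ) + ε * Complex.I) • (1 : L2 (Config n d) →L[ℂ] L2 (Config n d))) *
        operatorFunction g H) (delta u) : Config n d → ℂ) w‖ ^ 2) ≤ ENNReal.ofReal (r ^ (-p) / ε) *
      ∫⁻ t in Set.Ioi (0 : ℝ), ENNReal.ofReal (Real.exp (-(ε * t))) *
        ENNReal.ofReal (D w * F w t) := fun w => by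
    have h1 := norm_sq_inner_resolvent_le hH e hε (delta (w : Config n d))
      (operatorFunction g H (delta u))
    simp only [inner_delta_left] at h1
    refine h1.trans ?_
    have h2 : ∀ t, ENNReal.ofReal (Real.exp (-(ε * t))) * ENNReal.ofReal
        (‖(NormedSpace.exp ((-(Complex.I * (t : ℂ))) • H) (operatorFunction g H (delta u)) :
          Config n d → ℂ) w‖ ^ 2)
        ≤ ENNReal.ofReal (r ^ (-p)) * (ENNReal.ofReal (Real.exp (-(ε * t))) *
          ENNReal.ofReal (D w * F w t)) := fun t => by
      rw [mul_left_comm, ← ENNReal.ofReal_mul (Real.rpow_nonneg hr.le _), ← mul_assoc (r ^ (-p))]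
      gcongr
      exact le_mul_of_one_le_left (sq_nonneg _) (hDr w w.2)
    calc _ ≤ ENNReal.ofReal (1 / ε) * ∫⁻ t in Set.Ioi (0 : ℝ), ENNReal.ofReal (r ^ (-p)) *
          (ENNReal.ofReal (Real.exp (-(ε * t))) * ENNReal.ofReal (D w * F w t)) := by
          exact mul_le_mul' le_rfl (lintegral_mono h2)
      _ = _ := by
          have hm : Measurable fun t => ENNReal.ofReal (Real.exp (-(ε * t))) *
              ENNReal.ofReal (D w * F w t) :=
            Measurable.mul (by fun_prop) ((hFm w).const_mul _).ennreal_ofReal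
          rw [lintegral_const_mul _ hm, ← mul_assoc, ← ENNReal.ofReal_mul (by positivity)]
          congr 2
          ring
  calc _ ≤ ∑' w : farSet k r u, ENNReal.ofReal (r ^ (-p) / ε) *
        ∫⁻ t in Set.Ioi (0 : ℝ), ENNReal.ofReal (Real.exp (-(ε * t))) *
          ENNReal.ofReal (D w * F w t) := ENNReal.tsum_le_tsum hpt
    _ ≤ ∑' w : Config n d, ENNReal.ofReal (r ^ (-p) / ε) *
        ∫⁻ t in Set.Ioi (0 : ℝ), ENNReal.ofReal (Real.exp (-(ε * t))) *
          ENNReal.ofReal (D w * F w t) :=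
        ENNReal.tsum_comp_le_tsum_of_injective Subtype.val_injective _
    _ = _ := by
        rw [ENNReal.tsum_mul_left, timeMoment, ← lintegral_tsum (f := fun w t =>
          ENNReal.ofReal (Real.exp (-(ε * t))) * ENNReal.ofReal (D w * F w t)) fun w =>
            (Measurable.mul (by fun_prop) ((hFm w).const_mul _).ennreal_ofReal).aemeasurable]
        congr 1
        refine lintegral_congr fun t => ?_
        rw [ENNReal.tsum_mul_left, moment]
        simp only [inner_delta_left, hD, hF]

variable {Ω : Type*} [MeasurableSpace Ω]

theorem measurable_timeMoment {Ut : (Fin d → ℤ) → ℝ} {r₀ : ℝ} (hU : IsPairInteraction Ut r₀)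
    {M : ℝ} (hM : 0 < M) {ω : (Fin d → ℤ) → Ω → ℝ} (hω : ∀ x, Measurable (ω x))
    (hb : ∀ x a, ω x a ∈ Set.Icc 0 M) {g : ℝ → ℝ} (hg : ContDiff ℝ ((⊤ : ℕ∞) : WithTop ℕ∞) g)
    (k : DistKind) (p ε : ℝ) (u : Config n d) :
    Measurable fun a => timeMoment k p g (hamiltonian n Ut fun x => ω x a) ε u := by
  refine Measurable.lintegral_prod_right' (f := fun q : Ω × ℝ =>
    ENNReal.ofReal (Real.exp (-(ε * q.2))) *
      moment k p g (hamiltonian n Ut fun x => ω x q.1) q.2 u) ?_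
  refine Measurable.mul (by fun_prop) ?_
  exact measurable_moment hU hM (v := fun (q : Ω × ℝ) x => ω x q.1)
    (fun x => (hω x).comp measurable_fst) (fun q x => hb x q.1) hg measurable_snd k p u

/-- Tonelli; with `ε = 2/T` the exponential weights agree and only the normalization `2/T` is left
to undo. -/
theorem lintegral_timeMoment {P : Measure Ω} [IsProbabilityMeasure P] {Ut : (Fin d → ℤ) → ℝ}
    {r₀ : ℝ} (hU : IsPairInteraction Ut r₀) {M : ℝ} (hM : 0 < M) {ω : (Fin d → ℤ) → Ω → ℝ}
    (hω : ∀ x, Measurable (ω x)) (hb : ∀ x a, ω x a ∈ Set.Icc 0 M) {g : ℝ → ℝ}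
    (hg : ContDiff ℝ ((⊤ : ℕ∞) : WithTop ℕ∞) g) (k : DistKind) (p : ℝ) {T : ℝ} (hT : 0 < T)
    (u : Config n d) :
    ∫⁻ a, timeMoment k p g (hamiltonian n Ut fun x => ω x a) (2 / T) u ∂P
      = ENNReal.ofReal (T / 2) * avgMoment P ω Ut k p g T u := by
  have hm : Measurable fun q : Ω × ℝ => moment k p g (hamiltonian n Ut fun x => ω x q.1) q.2 u :=
    measurable_moment hU hM (v := fun (q : Ω × ℝ) x => ω x q.1)
      (fun x => (hω x).comp measurable_fst) (fun q x => hb x q.1) hg measurable_snd k p u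
  have h1 : ENNReal.ofReal (T / 2) * ENNReal.ofReal (2 / T) = 1 := by
    have h2 : T / 2 * (2 / T) = 1 := by field_simp
    rw [← ENNReal.ofReal_mul (by positivity), h2, ENNReal.ofReal_one]
  rw [avgMoment, ← mul_assoc, h1, one_mul]
  simp only [timeMoment]
  rw [lintegral_lintegral_swap]
  · refine lintegral_congr fun t => ?_
    have hmt : Measurable fun a => moment k p g (hamiltonian n Ut fun x => ω x a) t u :=
      measurable_moment hU hM (v := fun a x => ω x a) hω (fun a x => hb x a) hg
        (t := fun _ => t) measurable_const k p u
    rw [lintegral_const_mul _ hmt, div_mul_eq_mul_div]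
  · refine Measurable.aemeasurable ?_
    exact Measurable.mul (by fun_prop) hm

/-- The disorder cut off to the interval `[0, M]`. -/
def clip (M : ℝ) (ω : (Fin d → ℤ) → Ω → ℝ) : (Fin d → ℤ) → Ω → ℝ :=
  fun x a => max 0 (min (ω x a) M)

theorem clip_mem {Ω : Type*} {M : ℝ} (hM : 0 < M) (ω : (Fin d → ℤ) → Ω → ℝ) (x : Fin d → ℤ)
    (a : Ω) : clip M ω x a ∈ Set.Icc 0 M :=
  ⟨le_max_left _ _, max_le hM.le (min_le_right _ _)⟩

theorem measurable_clip (M : ℝ) {ω : (Fin d → ℤ) → Ω → ℝ} (hω : ∀ x, Measurable (ω x))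
    (x : Fin d → ℤ) : Measurable (clip M ω x) :=
  measurable_const.max ((hω x).min measurable_const)

theorem clip_eq_of_mem {Ω : Type*} {M : ℝ} {ω : (Fin d → ℤ) → Ω → ℝ} {a : Ω}
    (h : ∀ x, ω x a ∈ Set.Icc 0 M) : (fun x => clip M ω x a) = fun x => ω x a := by
  ext x
  rw [clip, min_eq_left (h x).2, max_eq_right (h x).1]

theorem ae_mem_Icc {P : Measure Ω} {μ : Measure ℝ} {M : ℝ} (hμ : IsSingleSiteLaw μ M)
    {ω : (Fin d → ℤ) → Ω → ℝ} (hω : IsDisorder P ω μ) : ∀ᵐ a ∂P, ∀ x, ω x a ∈ Set.Icc 0 M := by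
  rw [ae_all_iff]
  intro x
  have h1 : ∀ᵐ s ∂(P.map (ω x)), s ∈ Set.Icc 0 M := by
    rw [hω.law x]
    filter_upwards [Measure.support_mem_ae (μ := μ)] with s hs
    exact hμ.support_subset hs
  exact ae_of_ae_map (hω.measurable x).aemeasurable h1

/-- The disorder lies in `[0, M]` almost surely, so clipping changes no average, while the
measurability lemmas need bounds at every point of the probability space. -/
theorem avgMoment_clip {P : Measure Ω} {μ : Measure ℝ} {M : ℝ} (hμ : IsSingleSiteLaw μ M)
    {ω : (Fin d → ℤ) → Ω → ℝ} (hω : IsDisorder P ω μ) (Ut : (Fin d → ℤ) → ℝ) (k : DistKind)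
    (p : ℝ) (g : ℝ → ℝ) (T : ℝ) (y : Config n d) :
    avgMoment P (clip M ω) Ut k p g T y = avgMoment P ω Ut k p g T y := by
  rw [avgMoment, avgMoment]
  congr 1
  refine lintegral_congr fun t => ?_
  congr 1
  refine lintegral_congr_ae ?_
  filter_upwards [ae_mem_Icc hμ hω] with a ha
  rw [clip_eq_of_mem ha]

end Moments

/-! ### Suitable boxes -/

section Suitable

variable {n d : ℕ}

/-- Here `η` bounds the distance from `e` to the box spectrum and `s` the far mass of the full
resolvent at `e + iε`. The Green function at `e - iε` is bounded by `s` times the loss `(B + |e| +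
1)/ε`, and moving to `e` adds `ε/η²`. -/
theorem isSuitable_of_bounds (hn : 1 ≤ n) (k : DistKind) {H : L2 (Config n d) →L[ℂ] L2 (Config n d)}
    (hH : IsSelfAdjoint H) {B : ℝ} (hB : ‖H‖ ≤ B) {L : ℝ} (hL : 12 < L) (y : RConfig n d) (θ e : ℝ)
    {ε η s : ℝ} (hε : 0 < ε) (hε1 : ε ≤ 1) (hη : 0 < η)
    (hW : ∀ ψ, η * ‖ψ‖ ≤ ‖restrictOp H (box k L y) ψ - (e : ℂ) • ψ‖)
    (hs : ∀ u ∈ box k (L / 3) y, ‖restr (farSet k (L / 4) u) (Ring.inverse (H -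
      ((e : ℂ) + ε * Complex.I) • (1 : L2 (Config n d) →L[ℂ] L2 (Config n d))) (delta u))‖ ≤ s)
    (hnum : s * ((B + |e| + 1) / ε) + ε / η ^ 2 ≤ L ^ (-θ)) : IsSuitable k H L y θ e := by
  set A := restrictOp H (box k L y) with hA
  have hAs : IsSelfAdjoint A := isSelfAdjoint_restrictOp hH _
  constructor
  · rw [spectrum.notMem_iff, ← IsUnit.neg_iff]
    simpa [Algebra.algebraMap_eq_smul_one] using isUnit_sub_of_bounded_below hAs e hη hW
  · intro u v hu hv
    have hB0 : 0 ≤ B := (norm_nonneg H).trans hB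
    have h1 := norm_inner_restrictOp_le hH hB (Λ := box k L y)
      (S := farSet k (L / 4) (u : Config n d))
      (fun w hw => mem_farSet_of_notMem_box hn k (by linarith) hu hw)
      (u := u) (v := v) (mem_farSet_of_mem_innerBoundary hn k hL hu hv) e hε hε1
    have h2 := norm_resolvent_sub_le hAs e (ε := -ε) hη (neg_ne_zero.2 hε.ne') hW
    rw [abs_neg, abs_of_pos hε] at h2
    have h3 : ‖green A (e : ℂ) u v - green A ((e : ℂ) + (-ε : ℝ) * Complex.I) u v‖ ≤ ε / η ^ 2 := by
      rw [green, green, ← inner_sub_right]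
      refine (norm_inner_le_norm _ _).trans ?_
      rw [norm_delta, one_mul]
      have h4 := ContinuousLinearMap.le_of_opNorm_le _ h2 (delta v)
      rwa [norm_delta, mul_one] at h4
    have h5 : ‖green A ((e : ℂ) + (-ε : ℝ) * Complex.I) u v‖ ≤ s * ((B + |e| + 1) / ε) :=
      h1.trans (mul_le_mul_of_nonneg_right (hs u hu) (by positivity))
    have h6 := norm_le_norm_add_norm_sub' (green A (e : ℂ) u v)
      (green A ((e : ℂ) + (-ε : ℝ) * Complex.I) u v)
    linarith

/-- The part of the resolvent away from the energy `e` decays faster than any power. -/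
theorem exists_norm_restr_resolvent_sub_le (hn : 1 ≤ n) (k : DistKind) {Ut : (Fin d → ℤ) → ℝ}
    {r₀ : ℝ} (hU : IsPairInteraction Ut r₀) {M : ℝ} (hM : 0 < M) {g : ℝ → ℝ}
    (hg : ContDiff ℝ ((⊤ : ℕ∞) : WithTop ℕ∞) g) {e : ℝ} (he : ∀ᶠ s in 𝓝 e, g s = 1) (N : ℕ) :
    ∃ C : ℝ, 0 ≤ C ∧ ∃ L₀ : ℝ, ∀ L : ℝ, L₀ ≤ L → ∀ ε : ℝ, 0 < ε → ε ≤ 1 →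
      ∀ v : (Fin d → ℤ) → ℝ, (∀ x, v x ∈ Set.Icc 0 M) → ∀ u : Config n d,
        ‖restr (farSet k (L / 4) u) ((Ring.inverse (hamiltonian n Ut v -
          ((e : ℂ) + ε * Complex.I) • (1 : L2 (Config n d) →L[ℂ] L2 (Config n d))) *
            (1 - operatorFunction g (hamiltonian n Ut v))) (delta u))‖
          ≤ C * (1 / L ^ N + ε ^ 2) := by
  obtain ⟨B, hB, hH⟩ := exists_norm_hamiltonian_le (n := n) hU hM
  obtain ⟨C, hC, happ⟩ :=
    exists_polynomial_near_resolvent (E := L2 (Config n d)) hg he hB (2 * N)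
  -- The degree is at most `L/8 + 2N + 2 ≤ L/4`, so the polynomial part vanishes on the far set,
  -- while `⌊L/8⌋ ≥ L/16` for `L ≥ 16` keeps the error of order `L ^ (-N)`. Smoothness `2N`
  -- compensates the rate `m^(-1/2)` per derivative.
  refine ⟨C * 16 ^ N, by positivity, max 16 (8 * (2 * N + 2)), fun L hL ε hε hε1 v hv u => ?_⟩
  have hL16 : 16 ≤ L := (le_max_left _ _).trans hL
  have hLN : 8 * (2 * N + 2) ≤ L := (le_max_right _ _).trans hL
  set m := ⌊L / 8⌋₊ with hm
  have hm1 : (m : ℝ) ≤ L / 8 := Nat.floor_le (by linarith)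
  have hm2 : L / 8 < m + 1 := Nat.lt_floor_add_one _
  have hm3 : L / 16 ≤ m := by linarith
  have hm0 : m ≠ 0 := by
    rintro h
    rw [h] at hm3
    norm_num at hm3
    linarith
  obtain ⟨q, hqd, hq⟩ := happ _ (isSelfAdjoint_hamiltonian Ut v) (hH v hv) ε hε hε1 m hm0
  set W := Ring.inverse (hamiltonian n Ut v -
    ((e : ℂ) + ε * Complex.I) • (1 : L2 (Config n d) →L[ℂ] L2 (Config n d))) *
      (1 - operatorFunction g (hamiltonian n Ut v))
  have hzero : restr (farSet k (L / 4) u) (Polynomial.aeval (hamiltonian n Ut v) q (delta u)) = 0 := by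
    refine restr_eq_zero fun w hw => hamiltonian_aeval_delta_apply hU hv u q w ?_
    have h1 : L / 4 < starDist k (toReal u) (toReal w) := hw
    have h2 := starDist_toReal_le hn k u w
    have h3 : (q.natDegree : ℝ) ≤ m + 2 * N + 2 := by exact_mod_cast hqd
    linarith
  have h1 : restr (farSet k (L / 4) u) (W (delta u))
      = restr (farSet k (L / 4) u)
        ((W - Polynomial.aeval (hamiltonian n Ut v) q) (delta u)) := by
    rw [sub_apply, map_sub, hzero, sub_zero]
  rw [h1]
  refine (norm_restr_le _ _).trans ?_
  have h2 := ContinuousLinearMap.le_of_opNorm_le _ hq (delta u)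
  rw [norm_delta, mul_one, pow_mul, Real.sq_sqrt (Nat.cast_nonneg _)] at h2
  refine h2.trans ?_
  rw [mul_assoc]
  refine mul_le_mul_of_nonneg_left ?_ hC
  rw [mul_add]
  refine add_le_add ?_ (le_mul_of_one_le_left (by positivity) (one_le_pow₀ (by norm_num)))
  have h3 : (L / 16) ^ N ≤ (m : ℝ) ^ N := by gcongr
  calc 1 / (m : ℝ) ^ N ≤ 1 / (L / 16) ^ N := by
        have : 0 < L / 16 := by linarith
        gcongr
    _ = 16 ^ N * (1 / L ^ N) := by rw [div_pow]; field_simp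

end Suitable

/-! ### The probability of nonsuitable boxes -/

section Probability

variable {n d : ℕ} {Ω : Type*} [MeasurableSpace Ω]

theorem IsSingleSiteLaw.exists_le_smul_volume {μ : Measure ℝ} {M : ℝ} (hμ : IsSingleSiteLaw μ M) :
    ∃ c : ℝ≥0, μ ≤ (c : ℝ≥0∞) • volume := by
  obtain ⟨ρ, -, ⟨c, hc⟩, hρ⟩ := hμ.bounded_density
  refine ⟨c, ?_⟩
  rw [hρ, ← withDensity_const]
  exact withDensity_mono (Eventually.of_forall fun x => ENNReal.coe_le_coe.2 (hc x))

/-- The probability that a box is nonsuitable, in terms of moments and of a Wegner estimate. -/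
theorem measure_not_isSuitable_le (hn : 1 ≤ n) (k : DistKind) {P : Measure Ω}
    [IsProbabilityMeasure P] {μ : Measure ℝ} {M : ℝ} (hμ : IsSingleSiteLaw μ M)
    {ω : (Fin d → ℤ) → Ω → ℝ} (hω : IsDisorder P ω μ) {Ut : (Fin d → ℤ) → ℝ} {r₀ : ℝ}
    (hU : IsPairInteraction Ut r₀) {g : ℝ → ℝ} (hg : ContDiff ℝ ((⊤ : ℕ∞) : WithTop ℕ∞) g)
    {c : ℝ≥0} (hc : μ ≤ (c : ℝ≥0∞) • volume) {B : ℝ}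
    (hB : ∀ v : (Fin d → ℤ) → ℝ, (∀ x, v x ∈ Set.Icc 0 M) → ‖hamiltonian n Ut v‖ ≤ B)
    {L : ℝ} (hL : 12 < L) (y : RConfig n d) (θ e p : ℝ) (hp : 0 ≤ p) {T η s₁ s₂ Q : ℝ} (hT : 2 ≤ T)
    (hη : 0 < η) (hs₁ : 0 < s₁) (hQ : 0 ≤ Q)
    (hs₂ : ∀ v : (Fin d → ℤ) → ℝ, (∀ x, v x ∈ Set.Icc 0 M) → ∀ u : Config n d,
      ‖restr (farSet k (L / 4) u) ((Ring.inverse (hamiltonian n Ut v - ((e : ℂ) + (2 / T : ℝ) *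
        Complex.I) • (1 : L2 (Config n d) →L[ℂ] L2 (Config n d))) *
            (1 - operatorFunction g (hamiltonian n Ut v))) (delta u))‖ ≤ s₂)
    (hnum : (s₁ + s₂) * ((B + |e| + 1) / (2 / T)) + (2 / T) / η ^ 2 ≤ L ^ (-θ))
    (hmom : ∀ u : Config n d, avgMoment P ω Ut k p g T u ≤ ENNReal.ofReal Q) :
    P {a | ¬ IsSuitable k (hamiltonian n Ut fun x => ω x a) L y θ e} ≤
      ENNReal.ofReal ((n * 2 ^ d) ^ n * L ^ (n * d) *
        (c * Real.pi * n * (4 * η) + T / 2 * Q / (s₁ ^ 2 * (2 / T) * (L / 4) ^ p))) := by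
  set ε := 2 / T with hεdef
  have hT0 : 0 < T := by linarith
  have hε : 0 < ε := by positivity
  have hε1 : ε ≤ 1 := (div_le_one hT0).2 hT
  have hM := hμ.pos
  have hL4 : 0 < L / 4 := by linarith
  obtain ⟨F, hF, hFc⟩ := exists_finset_box_subset hn k (by linarith : 1 ≤ L) y
  have hΛ := box_finite hn k (by linarith : 1 ≤ L) y
  set X : Config n d → Ω → ℝ≥0∞ := fun u a =>
    timeMoment k p g (hamiltonian n Ut fun x => clip M ω x a) ε u with hX
  have hXm : ∀ u, Measurable (X u) := fun u =>
    measurable_timeMoment hU hM (measurable_clip M hω.measurable) (fun x a => clip_mem hM ω x a)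
      hg k p ε u
  -- The threshold for which a time moment at most `lam` makes the far mass of `R g(H) δ_u` at most
  -- `s₁`.
  set lam : ℝ := s₁ ^ 2 * ε * (L / 4) ^ p with hlam
  have hlam0 : 0 < lam := by have := Real.rpow_pos_of_pos hL4 p; positivity
  have hXP : ∀ u, P {a | ENNReal.ofReal lam ≤ X u a} ≤ ENNReal.ofReal (T / 2 * Q / lam) :=
      fun u => by
    refine (meas_ge_le_lintegral_div (hXm u).aemeasurable
      (ENNReal.ofReal_pos.2 hlam0).ne' ENNReal.ofReal_ne_top).trans ?_
    rw [ENNReal.ofReal_div_of_pos hlam0,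
      ENNReal.ofReal_mul (p := T / 2) (q := Q) (by positivity), hX, hεdef,
      lintegral_timeMoment hU hM (measurable_clip M hω.measurable) (fun x a => clip_mem hM ω x a)
      hg k p hT0 u, avgMoment_clip hμ hω]
    gcongr
    exact hmom u
  -- Three ways to fail: disorder outside `[0, M]` (a null set), the box spectrum too close to `e`
  -- (Wegner), a large moment at some point of the box (Markov and a union bound).
  set bad₁ : Set Ω := {a | ¬ ∀ x, ω x a ∈ Set.Icc 0 M}
  set bad₂ : Set Ω := {a | (∀ x, ω x a ∈ Set.Icc 0 M) ∧ ¬ ∀ ψ : L2 (box k L y), η * ‖ψ‖ ≤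
    ‖restrictOp (hamiltonian n Ut fun x => ω x a) (box k L y) ψ - (e : ℂ) • ψ‖}
  set bad₃ : Set Ω := ⋃ u ∈ F, {a | ENNReal.ofReal lam ≤ X u a}
  have hsub : {a | ¬ IsSuitable k (hamiltonian n Ut fun x => ω x a) L y θ e} ⊆
      bad₁ ∪ (bad₂ ∪ bad₃) := by
    intro a ha
    by_contra hcon
    simp only [Set.mem_union, not_or] at hcon
    obtain ⟨h1, h2, h3⟩ := hcon
    have hv : ∀ x, ω x a ∈ Set.Icc 0 M := not_not.1 h1
    have hW : ∀ ψ : L2 (box k L y), η * ‖ψ‖ ≤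
        ‖restrictOp (hamiltonian n Ut fun x => ω x a) (box k L y) ψ - (e : ℂ) • ψ‖ := by
      by_contra h
      exact h2 ⟨hv, h⟩
    refine ha (isSuitable_of_bounds hn k (isSelfAdjoint_hamiltonian _ _) (hB _ hv) hL y θ e hε hε1
      hη hW (fun u hu => ?_) hnum)
    have huF : u ∈ F := hF (show starDist k y (toReal u) ≤ L / 2 by
      have h4 : starDist k y (toReal u) ≤ L / 3 / 2 := hu
      linarith)
    have hXu : X u a < ENNReal.ofReal lam := by
      by_contra h
      exact h3 (Set.mem_biUnion huF (not_lt.1 h))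
    have h5 := ofReal_norm_restr_resolvent_sq_le hU hM hv hg k hp hL4 e hε u
    have h6 : timeMoment k p g (hamiltonian n Ut fun x => ω x a) ε u ≤ ENNReal.ofReal lam := by
      rw [← clip_eq_of_mem hv]; exact hXu.le
    set R := Ring.inverse (hamiltonian n Ut (fun x => ω x a) -
      ((e : ℂ) + ε * Complex.I) • (1 : L2 (Config n d) →L[ℂ] L2 (Config n d)))
    set G := operatorFunction g (hamiltonian n Ut fun x => ω x a)
    have h7 : ‖restr (farSet k (L / 4) u) ((R * G) (delta u))‖ ≤ s₁ := by
      have h8 : ENNReal.ofReal (‖restr (farSet k (L / 4) u) ((R * G) (delta u))‖ ^ 2)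
          ≤ ENNReal.ofReal (s₁ ^ 2) := by
        refine h5.trans ((mul_le_mul' le_rfl h6).trans (le_of_eq ?_))
        rw [← ENNReal.ofReal_mul (by positivity)]
        congr 1
        rw [hlam, Real.rpow_neg hL4.le]
        have := Real.rpow_pos_of_pos hL4 p
        field_simp
      exact le_of_sq_le_sq ((ENNReal.ofReal_le_ofReal_iff (by positivity)).1 h8) hs₁.le
    have h9 := hs₂ _ hv u
    have h10 : R (delta u) = (R * G) (delta u) + (R * (1 - G)) (delta u) := by
      rw [← add_apply, ← mul_add, add_sub_cancel, mul_one]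
    rw [h10, map_add]
    exact (norm_add_le _ _).trans (add_le_add h7 h9)
  have hb₁ : P bad₁ = 0 := ae_iff.1 (ae_mem_Icc hμ hω)
  have hcard : ((box k L y).ncard : ℝ) ≤ F.card := by
    exact_mod_cast (Set.ncard_le_ncard hF F.finite_toSet).trans (Set.ncard_coe_finset F).le
  set V : ℝ := (n * 2 ^ d) ^ n * L ^ (n * d) with hV
  have hV0 : 0 ≤ V := by have : 0 ≤ L := by linarith
                         positivity
  have hb₂ : P bad₂ ≤ ENNReal.ofReal (V * (c * Real.pi * n * (4 * η))) := by
    refine (wegner_estimate hn hc hω Ut M hΛ e hη).trans ?_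
    have hpi := Real.pi_pos
    rw [← ENNReal.ofReal_coe_nnreal, ← ENNReal.ofReal_natCast n, ← ENNReal.ofReal_natCast,
      ← ENNReal.ofReal_mul (by positivity), ← ENNReal.ofReal_mul (by positivity),
      ← ENNReal.ofReal_mul (by positivity), ← ENNReal.ofReal_mul (by positivity)]
    refine ENNReal.ofReal_le_ofReal ?_
    calc (c : ℝ) * Real.pi * n * (box k L y).ncard * (4 * η)
        ≤ (c : ℝ) * Real.pi * n * V * (4 * η) := by
          gcongr
          exact hcard.trans hFc
      _ = _ := by ring
  have hb₃ : P bad₃ ≤ ENNReal.ofReal (V * (T / 2 * Q / lam)) := by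
    refine (measure_biUnion_finset_le _ _).trans ((Finset.sum_le_sum fun u _ => hXP u).trans ?_)
    rw [Finset.sum_const, nsmul_eq_mul, ← ENNReal.ofReal_natCast,
      ← ENNReal.ofReal_mul (Nat.cast_nonneg _)]
    refine ENNReal.ofReal_le_ofReal ?_
    gcongr
  refine (measure_mono hsub).trans ((measure_union_le _ _).trans ?_)
  rw [hb₁, zero_add]
  refine (measure_union_le _ _).trans ((add_le_add hb₂ hb₃).trans (le_of_eq ?_))
  rw [← ENNReal.ofReal_add (by have := Real.pi_pos; positivity) (by positivity), mul_add]

end Probability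

/-! ### Choice of scales -/

section Scales

theorem tendsto_const_mul_rpow_neg (c : ℝ) {x : ℝ} (hx : 0 < x) :
    Tendsto (fun L : ℝ => c * L ^ (-x)) atTop (𝓝 0) := by
  simpa using (tendsto_rpow_neg_atTop hx).const_mul c

/-- With `T = L ^ κ`, the moment part uses exactly `1/4` of `L ^ (-θ)`, by the choice of `s₁`. The
two errors of the polynomial approximation, of order `T / L ^ N` and `1/T`, get `1/8` each, and the
shift to the real axis, `2 L ^ (-θ - δ/2)`, gets `1/2`. -/
theorem eventually_scale_bound {θ κ δ : ℝ} (hδ : 0 < δ) (D N : ℕ) (hκ : κ = θ + 2 * D + δ)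
    (hN : κ + θ + 1 ≤ N) {b C : ℝ} (hb : 0 < b) (hC : 0 ≤ C) :
    ∀ᶠ L : ℝ in atTop, (L ^ (-θ) * (2 / L ^ κ) / (4 * b) + C * (1 / L ^ N + (2 / L ^ κ) ^ 2)) *
      (b / (2 / L ^ κ)) + 2 / L ^ κ / (L ^ (-(D + δ / 4))) ^ 2 ≤ L ^ (-θ) := by
  filter_upwards [eventually_ge_atTop (1 : ℝ),
    (tendsto_const_mul_rpow_neg (C * b / 2) one_pos).eventually_lt_const
      (by norm_num : (0 : ℝ) < 1 / 8),
    (tendsto_const_mul_rpow_neg (2 * (C * b)) hδ).eventually_lt_const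
      (by norm_num : (0 : ℝ) < 1 / 8),
    (tendsto_const_mul_rpow_neg 2 (half_pos hδ)).eventually_lt_const
      (by norm_num : (0 : ℝ) < 1 / 2)] with L hL h1 h2 h3
  have hL0 : 0 < L := by linarith
  set T := L ^ κ with hT
  have hT0 : 0 < T := Real.rpow_pos_of_pos hL0 _
  set a := L ^ (-θ) with ha
  have ha0 : 0 < a := Real.rpow_pos_of_pos hL0 _
  have e1 : T / L ^ N ≤ a * L ^ (-1 : ℝ) := by
    rw [ha, hT, ← Real.rpow_add hL0, ← Real.rpow_natCast, ← Real.rpow_sub hL0]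
    exact Real.rpow_le_rpow_of_exponent_le hL (by linarith)
  have e2 : 1 / T ≤ a * L ^ (-δ) := by
    rw [ha, hT, ← Real.rpow_add hL0, one_div, ← Real.rpow_neg hL0.le]
    refine Real.rpow_le_rpow_of_exponent_le hL ?_
    have : (0 : ℝ) ≤ D := Nat.cast_nonneg D
    linarith
  have e3 : 2 / T / (L ^ (-(D + δ / 4))) ^ 2 = a * (2 * L ^ (-(δ / 2))) := by
    have h4 : (L ^ (-(D + δ / 4))) ^ 2 = L ^ (-(2 * D + δ / 2)) := by
      rw [← Real.rpow_natCast, ← Real.rpow_mul hL0.le]; congr 1; push_cast; ring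
    rw [h4, ha, hT, div_div, ← Real.rpow_add hL0, div_eq_mul_inv, ← Real.rpow_neg hL0.le,
      mul_left_comm, ← Real.rpow_add hL0]
    congr 2
    rw [hκ]; ring
  have e4 : (a * (2 / T) / (4 * b) + C * (1 / L ^ N + (2 / T) ^ 2)) * (b / (2 / T))
      = a / 4 + C * b / 2 * (T / L ^ N) + 2 * (C * b) * (1 / T) := by
    have : 0 < L ^ N := by positivity
    field_simp
    ring
  rw [e3, e4]
  have hCb : 0 ≤ C * b := by positivity
  have f1 : C * b / 2 * (T / L ^ N) ≤ a * (1 / 8) := by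
    calc C * b / 2 * (T / L ^ N) ≤ C * b / 2 * (a * L ^ (-1 : ℝ)) := by gcongr
      _ = a * (C * b / 2 * L ^ (-1 : ℝ)) := by ring
      _ ≤ a * (1 / 8) := by gcongr
  have f2 : 2 * (C * b) * (1 / T) ≤ a * (1 / 8) := by
    calc 2 * (C * b) * (1 / T) ≤ 2 * (C * b) * (a * L ^ (-δ)) := by gcongr
      _ = a * (2 * (C * b) * L ^ (-δ)) := by ring
      _ ≤ a * (1 / 8) := by gcongr
  have f3 : a * (2 * L ^ (-(δ / 2))) ≤ a * (1 / 2) := by gcongr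
  linarith

/-- The volume `L ^ D` cancels against `η`, leaving `L ^ (-δ/4)`. In the Markov term the powers of
`T` are `α` from the moment, one from the time integral and three from `s₁² ε`, hence the `α + 4` in
the exponent. -/
theorem probability_scale_bound {θ κ δ α p : ℝ} (D : ℕ)
    (hexp : κ * (α + 4) + 2 * θ + D - p ≤ -1) {b c₁ c₂ : ℝ} (hb : 0 < b) (hc₂ : 0 ≤ c₂)
    {v m : ℝ} (hv : 0 ≤ v) {L : ℝ} (hL : 1 ≤ L) :
    v * L ^ D * (c₁ * m * (4 * L ^ (-(D + δ / 4))) + L ^ κ / 2 * (c₂ * (L ^ κ) ^ α) /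
      ((L ^ (-θ) * (2 / L ^ κ) / (4 * b)) ^ 2 * (2 / L ^ κ) * (L / 4) ^ p)) ≤
    v * (4 * (c₁ * m)) * L ^ (-(δ / 4)) + v * (c₂ * b ^ 2 * 4 ^ p) * L ^ (-1 : ℝ) := by
  have hL0 : 0 < L := by linarith
  have h1 : L ^ D * L ^ (-(D + δ / 4)) = L ^ (-(δ / 4)) := by
    rw [← Real.rpow_natCast, ← Real.rpow_add hL0]; congr 1; ring
  have h2 : L ^ D * (((L ^ κ) ^ α) * (L ^ κ) ^ 4 / ((L ^ (-θ)) ^ 2 * L ^ p)) ≤ L ^ (-1 : ℝ) := by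
    rw [← Real.rpow_natCast, ← Real.rpow_natCast (L ^ κ), ← Real.rpow_natCast (L ^ (-θ)),
      ← Real.rpow_mul hL0.le, ← Real.rpow_mul hL0.le, ← Real.rpow_mul hL0.le, ← Real.rpow_add hL0,
      ← Real.rpow_add hL0, ← Real.rpow_sub hL0, ← Real.rpow_add hL0]
    refine Real.rpow_le_rpow_of_exponent_le hL ?_
    push_cast
    linarith
  have hT0 : 0 < L ^ κ := Real.rpow_pos_of_pos hL0 _
  have ha0 : 0 < L ^ (-θ) := Real.rpow_pos_of_pos hL0 _
  have hp0 : 0 < L ^ p := Real.rpow_pos_of_pos hL0 _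
  have h40 : (0 : ℝ) < 4 ^ p := Real.rpow_pos_of_pos (by norm_num) _
  rw [Real.div_rpow hL0.le (by norm_num)]
  set T := L ^ κ
  set Tα := T ^ α
  set a := L ^ (-θ)
  set Lp := L ^ p
  set q : ℝ := 4 ^ p
  have h3 : T / 2 * (c₂ * Tα) / ((a * (2 / T) / (4 * b)) ^ 2 * (2 / T) * (Lp / q))
      = c₂ * b ^ 2 * q * (Tα * T ^ 4 / (a ^ 2 * Lp)) := by
    field_simp
    ring
  rw [h3]
  calc v * L ^ D * (c₁ * m * (4 * L ^ (-(D + δ / 4))) + c₂ * b ^ 2 * q * (Tα * T ^ 4 / (a ^ 2 * Lp)))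
      = v * (4 * (c₁ * m)) * (L ^ D * L ^ (-(D + δ / 4)))
        + v * (c₂ * b ^ 2 * q) * (L ^ D * (Tα * T ^ 4 / (a ^ 2 * Lp))) := by ring
    _ ≤ _ := by
        rw [h1]
        gcongr

/-- Slow transport at the time scale `L^κ` forces the boxes of side `L` to be suitable. -/
theorem eventually_measure_not_isSuitable_le {n d : ℕ} {Ω : Type*} [MeasurableSpace Ω]
    (hn : 1 ≤ n) (k : DistKind) {P : Measure Ω}
    [IsProbabilityMeasure P] {μ : Measure ℝ} {M : ℝ} (hμ : IsSingleSiteLaw μ M)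
    {ω : (Fin d → ℤ) → Ω → ℝ} (hω : IsDisorder P ω μ) {Ut : (Fin d → ℤ) → ℝ} {r₀ : ℝ}
    (hU : IsPairInteraction Ut r₀) {g : ℝ → ℝ} (hg : ContDiff ℝ ((⊤ : ℕ∞) : WithTop ℕ∞) g)
    {e : ℝ} (he : ∀ᶠ s in 𝓝 e, g s = 1) {α θ p κ δ : ℝ} (hδ : 0 < δ) (hθ : 0 ≤ θ) (hp : 0 ≤ p)
    (hκ : κ = θ + 2 * (n * d : ℕ) + δ)
    (hexp : κ * (α + 4) + 2 * θ + (n * d : ℕ) - p ≤ -1) {C₀ : ℝ} (hC₀ : 0 ≤ C₀) :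
    ∃ K₁ K₂ : ℝ, ∀ᶠ L : ℝ in atTop, (∀ u : Config n d,
      avgMoment P ω Ut k p g (L ^ κ) u ≤ ENNReal.ofReal (C₀ * (L ^ κ) ^ α)) →
      ∀ y : RConfig n d, P {a | ¬ IsSuitable k (hamiltonian n Ut fun x => ω x a) L y θ e} ≤
        ENNReal.ofReal (K₁ * L ^ (-(δ / 4)) + K₂ * L ^ (-1 : ℝ)) := by
  have hM := hμ.pos
  obtain ⟨c, hc⟩ := hμ.exists_le_smul_volume
  obtain ⟨B, hB, hH⟩ := exists_norm_hamiltonian_le (n := n) hU hM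
  obtain ⟨N, hN⟩ := exists_nat_ge (κ + θ + 1)
  obtain ⟨C, hC, L₀, hdecay⟩ := exists_norm_restr_resolvent_sub_le hn k hU hM hg he N
  set b := B + |e| + 1 with hb
  have hb0 : 0 < b := by positivity
  have hκ0 : 0 < κ := by
    have : (0 : ℝ) ≤ (n * d : ℕ) := Nat.cast_nonneg _
    linarith
  refine ⟨(n * 2 ^ d) ^ n * (4 * (c * Real.pi * n)), (n * 2 ^ d) ^ n * (C₀ * b ^ 2 * 4 ^ p), ?_⟩
  filter_upwards [eventually_gt_atTop (12 : ℝ), eventually_ge_atTop L₀,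
    eventually_scale_bound hδ (n * d) N hκ hN hb0 hC,
    (tendsto_rpow_atTop hκ0).eventually_ge_atTop 2] with L hL12 hL₀ hnum hT hmom y
  have hL0 : 0 < L := by linarith
  have hT0 : 0 < L ^ κ := by linarith
  have hQ : 0 ≤ C₀ * (L ^ κ) ^ α := mul_nonneg hC₀ (Real.rpow_nonneg hT0.le _)
  have hs₁ : 0 < L ^ (-θ) * (2 / L ^ κ) / (4 * b) := by
    have := Real.rpow_pos_of_pos hL0 (-θ)
    positivity
  refine (measure_not_isSuitable_le hn k hμ hω hU hg hc hH hL12 y θ e p hp hT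
    (Real.rpow_pos_of_pos hL0 (-((n * d : ℕ) + δ / 4))) hs₁ hQ
    (fun v hv u => hdecay L hL₀ (2 / L ^ κ) (by positivity) ((div_le_one hT0).2 hT) v hv u)
    hnum hmom).trans (ENNReal.ofReal_le_ofReal ?_)
  exact probability_scale_bound (n * d) hexp hb0 hC₀ (by positivity) (by linarith)

/-- A strictly increasing sequence in a set of positive reals that is not bounded above. -/
theorem exists_strictMono_seq_of_frequently {q : ℝ → Prop} (h : ∃ᶠ T in atTop, q T) :
    ∃ T : ℕ → ℝ, StrictMono T ∧ (∀ m, 1 ≤ T m) ∧ Tendsto T atTop atTop ∧ ∀ m, q (T m) := by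
  -- `f` picks an admissible point above its argument; adding `1` before each choice makes the
  -- sequence strictly increasing and unbounded.
  choose f hf hq using frequently_atTop.1 h
  set T : ℕ → ℝ := fun m => Nat.rec (f 1) (fun _ t => f (t + 1)) m with hT
  have hsucc : ∀ m, T m + 1 ≤ T (m + 1) := fun m => hf (T m + 1)
  have hge : ∀ m : ℕ, (m : ℝ) + 1 ≤ T m := fun m => by
    induction m with
    | zero =>
      have h1 : (1 : ℝ) ≤ T 0 := hf 1
      simpa using h1
    | succ m ih => have := hsucc m; push_cast; linarith
  refine ⟨T, strictMono_nat_of_lt_succ fun m => by linarith [hsucc m], fun m => ?_, ?_, fun m => ?_⟩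
  · have := hge m
    have : (0 : ℝ) ≤ m := Nat.cast_nonneg m
    linarith
  · exact tendsto_atTop_mono (fun m => by linarith [hge m]) tendsto_natCast_atTop_atTop
  · cases m with
    | zero => exact hq 1
    | succ m => exact hq (T m + 1)

end Scales

end AndersonTransport

/-! ### The main theorem -/

open AndersonTransport
theorem mainTheorem3
    {n d : ℕ} (hn : 1 ≤ n) (hd : 1 ≤ d) (k : DistKind)
    {Ω : Type*} [MeasurableSpace Ω] (P : Measure Ω) [IsProbabilityMeasure P]
    (μ : Measure ℝ) (M : ℝ) (hμ : IsSingleSiteLaw μ M)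
    (ω : (Fin d → ℤ) → Ω → ℝ) (hω : IsDisorder P ω μ)
    (Ut : (Fin d → ℤ) → ℝ) (r₀ : ℝ) (hU : IsPairInteraction Ut r₀)
    (I : Set ℝ) (hIopen : IsOpen I) (hIint : I.OrdConnected)
    (g : ℝ → ℝ) (hg_smooth : ContDiff ℝ ((⊤ : ℕ∞) : WithTop ℕ∞) g) (hg_supp : HasCompactSupport g)
    (hg_nonneg : ∀ s, 0 ≤ g s) (hg_one : ∀ s ∈ I, g s = 1)
    (α θ p : ℝ) (hα : 0 ≤ α) (hθ : 2 * (n : ℝ) * d < θ)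
    (hp : (θ + 2 * (n : ℝ) * d) * α + 6 * θ + 15 * (n : ℝ) * d < p)
    (hslow : liminf (fun T : ℝ =>
        (⨆ y : Config n d, avgMoment P ω Ut k p g T y) / ENNReal.ofReal (T ^ α)) atTop < ⊤) :
    ∃ L : ℕ → ℝ, StrictMono L ∧ (∀ m, 1 ≤ L m) ∧ Tendsto L atTop atTop ∧
      ∀ E ∈ I, Tendsto (fun m : ℕ => ⨆ y : RConfig n d,
        P {a | ¬ IsSuitable k (hamiltonian n Ut (fun x => ω x a)) (L m) y θ E}) atTop (𝓝 0) := by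
  have hD : (1 : ℝ) ≤ (n : ℝ) * d := by exact_mod_cast Nat.one_le_iff_ne_zero.2 (by positivity)
  have hθ0 : 0 < θ := by nlinarith
  obtain ⟨C, hC, hCtop⟩ := exists_between hslow
  obtain ⟨T, hTmono, hT1, hTtop, hTC⟩ :=
    exists_strictMono_seq_of_frequently (frequently_lt_of_liminf_lt (h := hC))
  -- Chosen so that `δ (α + 4) = 1`: the excess in `κ` costs exactly one power of `L` in the
  -- probability bound.
  set δ : ℝ := 1 / (α + 4) with hδdef
  have hδ : 0 < δ := by positivity
  set κ : ℝ := θ + 2 * (n * d : ℕ) + δ with hκ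
  have hκ0 : 0 < κ := by positivity
  -- The left side is `(θ + 2nd)α + 6θ + 9nd + 1 - p`, which is below `1 - 6nd` by the hypothesis on
  -- `p`, and `nd ≥ 1`.
  have hexp : κ * (α + 4) + 2 * θ + (n * d : ℕ) - p ≤ -1 := by
    have h1 : δ * (α + 4) = 1 := by rw [hδdef]; field_simp
    have h2 : κ * (α + 4) = (θ + 2 * ((n : ℝ) * d)) * (α + 4) + 1 := by
      rw [hκ, add_mul, h1]; push_cast; ring
    rw [h2]
    push_cast
    nlinarith
  have hp0 : 0 ≤ p := by
    have : 0 ≤ (θ + 2 * (n : ℝ) * d) * α := by positivity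
    nlinarith
  -- The scales come only from the slow times `T m`, before any energy is fixed; the energy affects
  -- only the constants and how large `m` must be.
  set L : ℕ → ℝ := fun m => T m ^ (1 / κ) with hL
  have hLκ : ∀ m, L m ^ κ = T m := fun m => by
    rw [hL, ← Real.rpow_mul (by linarith [hT1 m]), one_div, inv_mul_cancel₀ hκ0.ne', Real.rpow_one]
  have hLtop : Tendsto L atTop atTop := (tendsto_rpow_atTop (by positivity)).comp hTtop
  refine ⟨L, fun i j hij => Real.rpow_lt_rpow (by linarith [hT1 i]) (hTmono hij) (by positivity),
    fun m => Real.one_le_rpow (hT1 m) (by positivity), hLtop, fun E hE => ?_⟩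
  have he : ∀ᶠ s in 𝓝 E, g s = 1 := by
    filter_upwards [hIopen.mem_nhds hE] with s hs using hg_one s hs
  obtain ⟨K₁, K₂, hK⟩ := eventually_measure_not_isSuitable_le hn k hμ hω hU hg_smooth he hδ hθ0.le
    hp0 hκ hexp (C₀ := C.toReal) ENNReal.toReal_nonneg
  have hlim : Tendsto (fun m => ENNReal.ofReal (K₁ * L m ^ (-(δ / 4)) + K₂ * L m ^ (-1 : ℝ)))
      atTop (𝓝 0) := by
    have h1 := ((tendsto_const_mul_rpow_neg K₁ (by positivity : 0 < δ / 4)).add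
      (tendsto_const_mul_rpow_neg K₂ one_pos)).comp hLtop
    simpa using ENNReal.tendsto_ofReal h1
  refine tendsto_of_tendsto_of_tendsto_of_le_of_le' tendsto_const_nhds hlim
    (Eventually.of_forall fun _ => zero_le) ?_
  filter_upwards [hLtop.eventually hK] with m hm
  refine iSup_le (hm fun u => ?_)
  rw [hLκ]
  have hTα : 0 < T m ^ α := Real.rpow_pos_of_pos (by linarith [hT1 m]) _
  rw [ENNReal.ofReal_mul ENNReal.toReal_nonneg, ENNReal.ofReal_toReal hCtop.ne]
  refine (le_iSup (fun y => avgMoment P ω Ut k p g (T m) y) u).trans ?_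
  exact (ENNReal.div_le_iff (ENNReal.ofReal_pos.2 hTα).ne' ENNReal.ofReal_ne_top).1 (hTC m).le
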